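/- **Setting.** Let $\mathbb D$ be the open unit disc. A radial weight is an integrable function $\omega:\mathbb D\to[0,\infty)$ with $\omega(z)=\omega(|z|)$; put $\widehat\omega(r)=\int_r^1\omega(s)\,ds$ for $0\le r<1$, and assume that $\omega$ does not vanish almost everywhere. Write $\omega\in\mathcal D$ if there are $C\ge 1$ with $\widehat\omega(r)\le C\,\widehat\omega(\frac{1+r}{2})$ for all $0\le r<1$, and $K>1$, $C>1$ with $$\widehat\omega(r)\ge C\,\widehat\omega\Bigl(1-\frac{1-r}{K}\Bigr),\qquad 0\le r<1.\tag{K}$$ For $0<p\le\infty$ and $0<q<\infty$, $A^{p,q}_\omega$ is the space of analytic $f$ in $\mathbb D$ with $\|f\|_{A^{p,q}_\omega}^q=\int_0^1M_p^q(r,f)\,\omega(r)\,dr<\infty$, where $M_p(r,f)=\bigl(\frac1{2\pi}\int_0^{2\pi}|f(re^{it})|^p\,dt\bigr)^{1/p}$ for $p<\infty$ and $M_\infty(r,f)=\max_{|z|=r}|f(z)|$. For integers $K\ge2$, $j\ge0$ and $0\le l<K^{j+3}$ let $r_j=1-K^{-j}$ and $$Q_{j,l}=\Bigl\{z: r_j\le|z|<r_{j+1},\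 \arg z\in\Bigl[\tfrac{2\pi l}{K^{j+3}},\tfrac{2\pi(l+1)}{K^{j+3}}\Bigr)\Bigr\}.$$ For $N\ge1$ divide $Q_{j,l}$ by an $N\times N$ polar grid (equal angles, and radii chosen so that all pieces have equal area) into polar rectangles $Q_{j,l}^k$, $1\le k\le N^2$, and let $\zeta_{j,l}^k$ be the centre of $Q_{j,l}^k$ (the midpoint in both polar coordinates). For $\lambda=\{\lambda_{j,l}^k\}$ let $\|\lambda\|_{\ell^{p,q}}=\Bigl(\sum_{j}\bigl(\sum_{l,k}|\lambda_{j,l}^k|^p\bigr)^{q/p}\Bigr)^{1/q}$, the inner sum being replaced by the supremum over $l,k$ if $p=\infty$. **Theorem.** Let $0<p\le\infty$, $0<q<\infty$ and let $\omega\in\mathcal D$ be a radial weight as above. Then there is a real $M=M(p,q,\omega)>0$ such that for every integer $K\ge2$ for which (K) holds with some $C>1$ there is $N_0\ge1$ such that, for every $N\ge N_0$, there is a finite constant $C'$ with the following two properties. 1. Every $f\in A^{p,q}_\omega$ can be written as $$f(z)=\sum_{j,l,k}\lambda(f)_{j,l}^k\,\frac{(1-|\zeta_{j,l}^k|^2)^{M-\frac1p}\,\widehat\omega(r_j)^{-\frac1q}}{(1-\overline{\zeta_{j,l}^k}\,z)^{M}},\qquad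 z\in\mathbb D,$$ with absolute convergence at each point, where $\lambda(f)\in\ell^{p,q}$, $\|\lambda(f)\|_{\ell^{p,q}}\le C'\|f\|_{A^{p,q}_\omega}$ and $\|f\|_{A^{p,q}_\omega}\le C'\|\lambda(f)\|_{\ell^{p,q}}$. 2. Conversely, for every $\lambda\in\ell^{p,q}$ the series above, with $\lambda(f)$ replaced by $\lambda$, converges absolutely at each point of $\mathbb D$, and its sum $f$ belongs to $A^{p,q}_\omega$ and satisfies $\|f\|_{A^{p,q}_\omega}\le C'\|\lambda\|_{\ell^{p,q}}$. -/

import Mathlib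

open scoped ENNReal NNReal

noncomputable section

/-! ### Radial weights on the unit disc and doubling conditions -/

/-- A radial weight on the unit disc: the function `z ↦ ω ‖z‖` is nonnegative and integrable on
the open unit disc. Only the values of `ω` on `[0, 1)` matter. -/
structure IsRadialWeight (ω : ℝ → ℝ) : Prop where
  nonneg : ∀ r ∈ Set.Ico (0 : ℝ) 1, 0 ≤ ω r
  integrableOn : MeasureTheory.IntegrableOn (fun z : ℂ => ω ‖z‖) (Metric.ball (0 : ℂ) 1)

/-- The tail integral `ω̂(r) = ∫_r^1 ω(s) ds`, with values in `[0, ∞]`. -/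
def omegaHat (ω : ℝ → ℝ) (r : ℝ) : ℝ≥0∞ :=
  ∫⁻ s in Set.Ioo r 1, ENNReal.ofReal (ω s)

/-- The upper doubling condition. -/
def UpperDoubling (ω : ℝ → ℝ) : Prop :=
  ∃ C : ℝ, 1 ≤ C ∧ ∀ r ∈ Set.Ico (0 : ℝ) 1,
    omegaHat ω r ≤ ENNReal.ofReal C * omegaHat ω ((1 + r) / 2)

/-- The reverse doubling condition with a prescribed parameter `K`. -/
def LowerDoublingWith (ω : ℝ → ℝ) (K : ℝ) : Prop :=
  ∃ C : ℝ, 1 < C ∧ ∀ r ∈ Set.Ico (0 : ℝ) 1,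
    ENNReal.ofReal C * omegaHat ω (1 - (1 - r) / K) ≤ omegaHat ω r

/-- The class `𝒟` of (two-sided) doubling weights. -/
def Doubling (ω : ℝ → ℝ) : Prop :=
  UpperDoubling ω ∧ ∃ K : ℝ, 1 < K ∧ LowerDoublingWith ω K

/-! ### The weighted mixed norm space -/

/-- The integral mean `M_p(r, f)` over the circle of radius `r`; for `p = ∞` the maximum
modulus. -/
def circleMean (p : ℝ≥0∞) (r : ℝ) (f : ℂ → ℂ) : ℝ≥0∞ :=
  if p = ∞ then ⨆ t : ℝ, ‖f (circleMap 0 r t)‖ₑ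
  else (ENNReal.ofReal (1 / (2 * Real.pi)) *
    ∫⁻ t in Set.Ioo 0 (2 * Real.pi), ‖f (circleMap 0 r t)‖ₑ ^ p.toReal) ^ (1 / p.toReal)

/-- The (quasi-)norm `(∫_0^1 M_p(r, f)^q ω(r) dr)^{1/q}`, with values in `[0, ∞]`. -/
def mixedNorm (p : ℝ≥0∞) (q : ℝ) (ω : ℝ → ℝ) (f : ℂ → ℂ) : ℝ≥0∞ :=
  (∫⁻ r in Set.Ioo (0 : ℝ) 1, circleMean p r f ^ q * ENNReal.ofReal (ω r)) ^ (1 / q)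

/-- Membership in `A^{p,q}_ω`: `f` is analytic in the unit disc and has finite norm. -/
def MemMixedSpace (p : ℝ≥0∞) (q : ℝ) (ω : ℝ → ℝ) (f : ℂ → ℂ) : Prop :=
  DifferentiableOn ℂ f (Metric.ball 0 1) ∧ mixedNorm p q ω f < ∞

/-! ### Dyadic polar rectangles, their subdivision, and their centres -/

/-- The data of a polar rectangle `{ρ e^{iθ} : inner ≤ ρ < outer, lo ≤ θ < hi}`. -/
structure PolarRect where
  inner : ℝ
  outer : ℝ
  lo : ℝ
  hi : ℝ

/-- The set of points of a polar rectangle. -/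
def PolarRect.toSet (R : PolarRect) : Set ℂ :=
  {z | ∃ ρ ∈ Set.Ico R.inner R.outer, ∃ θ ∈ Set.Ico R.lo R.hi, z = circleMap 0 ρ θ}

/-- The centre of a polar rectangle: the midpoint in both polar coordinates. -/
def PolarRect.center (R : PolarRect) : ℂ :=
  circleMap 0 ((R.inner + R.outer) / 2) ((R.lo + R.hi) / 2)

/-- The intermediate radii that cut a polar rectangle into `N` pieces of equal area (the area of
a polar rectangle is `(hi - lo) * (outer ^ 2 - inner ^ 2) / 2`). -/
def PolarRect.cutRadius (R : PolarRect) (N a : ℕ) : ℝ :=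
  Real.sqrt (R.inner ^ 2 + (a : ℝ) / N * (R.outer ^ 2 - R.inner ^ 2))

/-- The piece with radial index `a < N` and angular index `b < N` in the division of a polar
rectangle into `N ^ 2` polar rectangles of equal area. -/
def PolarRect.piece (R : PolarRect) (N a b : ℕ) : PolarRect where
  inner := R.cutRadius N a
  outer := R.cutRadius N (a + 1)
  lo := R.lo + (b : ℝ) / N * (R.hi - R.lo)
  hi := R.lo + ((b : ℝ) + 1) / N * (R.hi - R.lo)

/-- The radii `r_j = 1 - K^{-j}`. -/
def dyadicRadius (K j : ℕ) : ℝ := 1 - ((K : ℝ) ^ j)⁻¹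

/-- The dyadic polar rectangle `Q_{j,l}`, for `l < K ^ (j + 3)`. -/
def dyadicRect (K j l : ℕ) : PolarRect where
  inner := dyadicRadius K j
  outer := dyadicRadius K (j + 1)
  lo := 2 * Real.pi * ((l : ℝ) / (K : ℝ) ^ (j + 3))
  hi := 2 * Real.pi * (((l : ℝ) + 1) / (K : ℝ) ^ (j + 3))

/-- For fixed `j`, the indices `(l, k)`, with `k = (a, b)` running through the `N ^ 2` pieces. -/
abbrev LevelIndex (K N j : ℕ) : Type := Fin (K ^ (j + 3)) × Fin N × Fin N

/-- The indices `(j, l, k)`. -/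
abbrev PieceIndex (K N : ℕ) : Type := Σ j : ℕ, LevelIndex K N j

/-- The centre `ζ_{j,l}^k` of the piece `Q_{j,l}^k`. -/
def pieceCenter (K N : ℕ) (i : PieceIndex K N) : ℂ :=
  ((dyadicRect K i.1 i.2.1).piece N i.2.2.1 i.2.2.2).center

/-! ### The sequence space and the atoms -/

/-- The `ℓ^p` (quasi-)norm of a finite family. -/
def finiteNorm {ι : Type} [Fintype ι] (p : ℝ≥0∞) (c : ι → ℂ) : ℝ≥0∞ :=
  if p = ∞ then ⨆ i, ‖c i‖ₑ else (∑ i, ‖c i‖ₑ ^ p.toReal) ^ (1 / p.toReal)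

/-- The `ℓ^{p,q}` (quasi-)norm: `ℓ^p` in `(l, k)` for each `j`, then `ℓ^q` in `j`. -/
def seqNorm (p : ℝ≥0∞) (q : ℝ) {K N : ℕ} (c : PieceIndex K N → ℂ) : ℝ≥0∞ :=
  (∑' j : ℕ, finiteNorm p (fun a : LevelIndex K N j => c ⟨j, a⟩) ^ q) ^ (1 / q)

/-- The atom
`z ↦ (1 - |ζ|²)^{M - 1/p} ω̂(r_j)^{-1/q} (1 - conj ζ z)^{-M}` with `ζ = ζ_{j,l}^k`. -/
def atom (p : ℝ≥0∞) (q : ℝ) (ω : ℝ → ℝ) (M : ℝ) (K N : ℕ) (i : PieceIndex K N) (z : ℂ) : ℂ :=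
  (((1 - ‖pieceCenter K N i‖ ^ 2) ^ (M - (p⁻¹).toReal) *
      (omegaHat ω (dyadicRadius K i.1)).toReal ^ (-(1 / q)) : ℝ) : ℂ) /
    (1 - (starRingEnd ℂ) (pieceCenter K N i) * z) ^ (M : ℂ)

end

open MeasureTheory

noncomputable section

/-! Take M = 2n with n large in terms of p, q and the upper doubling exponent of ω, and put d = 2n -
2. The weighted Bergman formula (`exists_integral_radialDensity_circleAverage`) writes f(z) as the
integral of f(ζ)(1 - conj ζ z)^{-2n} against (d+1)(1-|ζ|²)^d dA(ζ). Replacing the integral by a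
quadrature sum whose nodes are the centres of the pieces turns it into a sum of atoms Sf. The pieces
at level j have diameter O(K^{-j}/√N), so the Schwarz lemma bounds |f - Sf| by C N^{-1/2} Σ_j
K^{-2nj} Σ_l sup|f| |1 - conj ξ_{j,l} z|^{-2n}, where ξ_{j,l} is a corner of Q_{j,l} and the
supremum is over a neighbourhood of Q_{j,l} (`norm_kernel_osc_le`, `enorm_sub_tsum_le`).

Two estimates carry the rest. Analysis (`exists_coarseNorm_cellCoeff_le`): subharmonicity of |f|^p,
in Poisson form, bounds the ℓ^p norm of the local suprema at level j by the mean of f over any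
circle three levels further out. The mass of ω on that block is comparable with ω̂(r_j) by the two
doubling conditions, so the normalized suprema lie in ℓ^{p,q}. Synthesis
(`exists_mixedNorm_le_of_le_coarseSum`): on circles in block m, the atoms of level j contribute at
most K^{-τ(j-m)_+} ω̂(r_j)^{-1/q} times their ℓ^p norm, with τ = 2n - 1 - 1/p. After q-th powers and
multiplication by ω̂(r_m), this decays geometrically in |j - m|: for m ≥ j by lower doubling, for m
< j because τq exceeds the upper doubling exponent. A Schur-type summation finishes.

Together they give ‖f - Sf‖ ≤ C N^{-1/2}‖f‖ with C independent of N, so for large N the Neumann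
series f = Σ_m S(I - S)^m f converges and yields the coefficients. The second property is the
synthesis estimate by itself. As p or q may be below 1, no triangle inequality or duality is used:
infinite sums are handled by the weighted bound `lpFun_tsum_rpow_le`, whose loss is absorbed by
geometric decay. -/

/-! ### Sums and L^p functionals in [0, ∞] for arbitrary positive exponents -/

/-- Each x_i is at most the ℓ^s norm of x, which can be pulled out of the sum. Crude, but valid for
all s > 0, so it serves in place of both Hölder's inequality and subadditivity of powers. -/
theorem ENNReal.tsum_mul_rpow_le {ι : Type*} (y x : ι → ℝ≥0∞) {s : ℝ} (hs : 0 < s) :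
    (∑' i, y i * x i) ^ s ≤ (∑' i, y i) ^ s * ∑' i, x i ^ s := by
  have h1 : ∀ i, x i ≤ (∑' i, x i ^ s) ^ (1 / s) := by
    intro i
    calc x i = (x i ^ s) ^ (1 / s) := by
          rw [← ENNReal.rpow_mul, mul_one_div_cancel hs.ne', ENNReal.rpow_one]
      _ ≤ _ := ENNReal.rpow_le_rpow (ENNReal.le_tsum i) (by positivity)
  calc (∑' i, y i * x i) ^ s ≤ (∑' i, y i * (∑' i, x i ^ s) ^ (1 / s)) ^ s := by
        gcongr with i
        exact h1 i
    _ = (∑' i, y i) ^ s * ∑' i, x i ^ s := by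
        rw [ENNReal.tsum_mul_right, ENNReal.mul_rpow_of_nonneg _ _ hs.le, ← ENNReal.rpow_mul,
          one_div_mul_cancel hs.ne', ENNReal.rpow_one]

theorem ENNReal.sum_mul_rpow_le {ι : Type*} [Fintype ι] (y x : ι → ℝ≥0∞) {s : ℝ} (hs : 0 < s) :
    (∑ i, y i * x i) ^ s ≤ (∑ i, y i) ^ s * ∑ i, x i ^ s := by
  simpa [tsum_fintype] using ENNReal.tsum_mul_rpow_le y x hs

/-- With truncated subtraction the exponent is |j - m|, and the sum splits into two geometric
series. The right side is infinite when σ ≥ 1. -/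
theorem ENNReal.tsum_pow_dist_le (σ : ℝ≥0∞) (j : ℕ) :
    ∑' m : ℕ, σ ^ ((j - m) + (m - j)) ≤ 2 * (1 - σ)⁻¹ := by
  have h : ∀ m : ℕ, σ ^ ((j - m) + (m - j)) ≤
      (if m ≤ j then σ ^ (j - m) else 0) + (if j ≤ m then σ ^ (m - j) else 0) := by
    intro m
    rcases le_total m j with h | h
    · simp [h, Nat.sub_eq_zero_of_le h]
    · simp [h, Nat.sub_eq_zero_of_le h]
  refine (ENNReal.tsum_le_tsum h).trans ?_
  rw [ENNReal.tsum_add, two_mul, ← ENNReal.tsum_geometric]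
  refine add_le_add ?_ ?_
  · rw [tsum_eq_sum (s := Finset.range (j + 1))]
    · rw [← Finset.sum_range_reflect]
      refine le_trans (le_of_eq ?_) (ENNReal.sum_le_tsum (Finset.range (j + 1)))
      refine Finset.sum_congr rfl fun m hm => ?_
      have := Finset.mem_range.1 hm
      rw [if_pos (by omega)]
      congr 1
      omega
    · intro m hm
      rw [if_neg]
      simpa using hm
  · have h2 := Summable.sum_add_tsum_nat_add' (f := fun m => if j ≤ m then σ ^ (m - j) else 0)
      (k := j) ENNReal.summable
    rw [← h2, Finset.sum_eq_zero, zero_add]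
    · refine ENNReal.tsum_le_tsum fun m => ?_
      simp
    · intro m hm
      have := Finset.mem_range.1 hm
      rw [if_neg (by omega)]

/-- The `L^p` functional `(∫ F^p)^{1/p}` on functions with values in `[0, ∞]`, the supremum
for `p = ∞`. -/
def lpFun {α : Type*} [MeasurableSpace α] (p : ℝ≥0∞) (μ : Measure α) (F : α → ℝ≥0∞) : ℝ≥0∞ :=
  if p = ∞ then ⨆ x, F x else (∫⁻ x, F x ^ p.toReal ∂μ) ^ (1 / p.toReal)

section lpFun

variable {α : Type*} [MeasurableSpace α] {p : ℝ≥0∞} {μ : Measure α}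

theorem lpFun_top (F : α → ℝ≥0∞) : lpFun ∞ μ F = ⨆ x, F x := by simp [lpFun]

theorem lpFun_of_ne_top (hp : p ≠ ∞) (F : α → ℝ≥0∞) :
    lpFun p μ F = (∫⁻ x, F x ^ p.toReal ∂μ) ^ (1 / p.toReal) := by simp [lpFun, hp]

theorem lpFun_rpow (hp0 : 0 < p) (hp : p ≠ ∞) (F : α → ℝ≥0∞) :
    lpFun p μ F ^ p.toReal = ∫⁻ x, F x ^ p.toReal ∂μ := by
  have := ENNReal.toReal_pos hp0.ne' hp
  rw [lpFun_of_ne_top hp, ← ENNReal.rpow_mul, one_div_mul_cancel this.ne', ENNReal.rpow_one]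

theorem lpFun_mono {F G : α → ℝ≥0∞} (h : ∀ x, F x ≤ G x) : lpFun p μ F ≤ lpFun p μ G := by
  unfold lpFun
  split_ifs
  · exact iSup_mono h
  · gcongr
    exact h _

theorem lpFun_const_mul (hp0 : 0 < p) (c : ℝ≥0∞) (hc : c ≠ ∞) (F : α → ℝ≥0∞) :
    lpFun p μ (fun x => c * F x) = c * lpFun p μ F := by
  unfold lpFun
  split_ifs with hp
  · rw [ENNReal.mul_iSup]
  · have := ENNReal.toReal_pos hp0.ne' hp
    simp_rw [ENNReal.mul_rpow_of_nonneg _ _ this.le]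
    rw [lintegral_const_mul' _ _ (by simp [hc, this.le]), ENNReal.mul_rpow_of_nonneg _ _ (by positivity),
      ← ENNReal.rpow_mul, mul_one_div_cancel this.ne', ENNReal.rpow_one]

/-- A countable quasi-triangle inequality with weights, for the `q`-th power of `lpFun`. -/
theorem lpFun_tsum_rpow_le {ι : Type*} [Countable ι] (hp0 : 0 < p) {q : ℝ} (hq : 0 < q)
    (G : ι → α → ℝ≥0∞) (hG : ∀ i, Measurable (G i)) (γ : ι → ℝ≥0∞) (hγ0 : ∀ i, γ i ≠ 0)
    (hγ : ∀ i, γ i ≠ ∞) :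
    lpFun p μ (fun x => ∑' i, G i x) ^ q ≤
      (∑' i, γ i) ^ (q * (1 + (p⁻¹).toReal)) *
        ∑' i, (γ i)⁻¹ ^ (q * (1 + (p⁻¹).toReal)) * lpFun p μ (G i) ^ q := by
  have key : ∀ s : ℝ, 0 < s → ∀ g : ι → ℝ≥0∞,
      (∑' i, g i) ^ s ≤ (∑' i, γ i) ^ s * ∑' i, (γ i)⁻¹ ^ s * g i ^ s := by
    intro s hs g
    have := ENNReal.tsum_mul_rpow_le γ (fun i => (γ i)⁻¹ * g i) hs
    simp_rw [← mul_assoc, ENNReal.mul_inv_cancel (hγ0 _) (hγ _), one_mul,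
      ENNReal.mul_rpow_of_nonneg _ _ hs.le] at this
    exact this
  by_cases hp : p = ∞
  · subst hp
    simp only [lpFun_top, ENNReal.inv_top, ENNReal.toReal_zero, add_zero, mul_one]
    refine le_trans ?_ (key q hq _)
    gcongr
    refine iSup_le fun x => ENNReal.tsum_le_tsum fun i => ?_
    exact le_iSup (G i) x
  · have hpp := ENNReal.toReal_pos hp0.ne' hp
    have hip : (p⁻¹).toReal = 1 / p.toReal := by simp [ENNReal.toReal_inv]
    have e1 : ∀ F : α → ℝ≥0∞, lpFun p μ F ^ q = (∫⁻ x, F x ^ p.toReal ∂μ) ^ (q / p.toReal) := by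
      intro F
      rw [lpFun_of_ne_top hp, ← ENNReal.rpow_mul]
      congr 1; ring
    have hqp : 0 < q / p.toReal := by positivity
    have h1 : ∫⁻ x, (∑' i, G i x) ^ p.toReal ∂μ ≤ (∑' i, γ i) ^ p.toReal *
        ∑' i, (γ i)⁻¹ ^ p.toReal * ∫⁻ x, G i x ^ p.toReal ∂μ := by
      calc ∫⁻ x, (∑' i, G i x) ^ p.toReal ∂μ
          ≤ ∫⁻ x, (∑' i, γ i) ^ p.toReal * ∑' i, (γ i)⁻¹ ^ p.toReal * G i x ^ p.toReal ∂μ :=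
            lintegral_mono fun x => key _ hpp _
        _ = _ := by
          rw [lintegral_const_mul _ (Measurable.tsum fun i => ((hG i).pow_const _).const_mul _),
            lintegral_tsum fun i => (((hG i).pow_const _).const_mul _).aemeasurable]
          congr 1
          refine tsum_congr fun i => ?_
          rw [lintegral_const_mul _ ((hG i).pow_const _)]
    rw [e1]
    have h3 : p.toReal * (q / p.toReal) = q := by field_simp
    -- `key` was used at exponent p under the integral and is used again at exponent q/p outside it;
    -- the powers of γ add up to q + q/p.
    calc _ ≤ ((∑' i, γ i) ^ p.toReal *
        ∑' i, (γ i)⁻¹ ^ p.toReal * ∫⁻ x, G i x ^ p.toReal ∂μ) ^ (q / p.toReal) := by gcongr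
      _ = (∑' i, γ i) ^ q *
        (∑' i, (γ i)⁻¹ ^ p.toReal * ∫⁻ x, G i x ^ p.toReal ∂μ) ^ (q / p.toReal) := by
          rw [ENNReal.mul_rpow_of_nonneg _ _ hqp.le, ← ENNReal.rpow_mul, h3]
      _ ≤ (∑' i, γ i) ^ q * ((∑' i, γ i) ^ (q / p.toReal) * ∑' i, (γ i)⁻¹ ^ (q / p.toReal) *
        ((γ i)⁻¹ ^ p.toReal * ∫⁻ x, G i x ^ p.toReal ∂μ) ^ (q / p.toReal)) := by
          gcongr
          exact key _ hqp _
      _ = _ := by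
          rw [← mul_assoc, ← ENNReal.rpow_add_of_nonneg _ _ hq.le hqp.le, hip]
          congr 2
          · ring
          · refine funext fun i => ?_
            rw [ENNReal.mul_rpow_of_nonneg _ _ hqp.le, ← ENNReal.rpow_mul, h3, e1, ← mul_assoc,
              ← ENNReal.rpow_add_of_nonneg _ _ hqp.le hq.le]
            congr 2
            ring

end lpFun

/-! ### Subharmonicity of |f|^s as a Poisson integral inequality -/

/-- If |u| ≥ R, then z - u has no zero inside the disc and an analytic s-th power exists. If |u| <
R, the zero is reflected: R(1 - conj u z/R²) has the same modulus on the circle, a larger one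
inside, and no zero in the closed disc. -/
theorem exists_diffContOnCl_norm_rpow_sub {R s : ℝ} (hR : 0 < R) (hs : 0 < s) (u : ℂ) :
    ∃ G : ℂ → ℂ, DiffContOnCl ℂ G (Metric.ball 0 R) ∧
      (∀ z ∈ Metric.sphere (0 : ℂ) R, ‖G z‖ = ‖z - u‖ ^ s) ∧
      ∀ z ∈ Metric.ball (0 : ℂ) R, ‖z - u‖ ^ s ≤ ‖G z‖ := by
  have main : ∀ v : ℂ, ‖v‖ * R ≤ 1 → ∀ c : ℝ, 0 ≤ c →
      DiffContOnCl ℂ (fun z => (c ^ s : ℝ) * (1 - v * z) ^ (s : ℂ)) (Metric.ball 0 R) ∧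
      ∀ z, ‖((c ^ s : ℝ) : ℂ) * (1 - v * z) ^ (s : ℂ)‖ = (c * ‖1 - v * z‖) ^ s := by
    intro v hv c hc
    have hre : ∀ z : ℂ, ‖v‖ * ‖z‖ ≤ 1 → 0 ≤ (1 - v * z).re := by
      intro z hz
      have := Complex.re_le_norm (v * z)
      rw [norm_mul] at this
      simp only [Complex.sub_re, Complex.one_re]
      linarith
    refine ⟨⟨?_, ?_⟩, ?_⟩
    · intro z hz
      have hz' : ‖z‖ < R := by simpa using hz
      refine DifferentiableAt.differentiableWithinAt ?_
      refine (DifferentiableAt.cpow (by fun_prop) (by fun_prop) ?_).const_mul _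
      refine Or.inl ?_
      have := Complex.re_le_norm (v * z)
      rw [norm_mul] at this
      simp only [Complex.sub_re, Complex.one_re]
      rcases eq_or_lt_of_le (norm_nonneg v) with h | h
      · rw [← h, zero_mul] at this; linarith
      · have : ‖v‖ * ‖z‖ < ‖v‖ * R := by gcongr
        linarith
    · rw [closure_ball _ hR.ne']
      intro z hz
      have hz' : ‖z‖ ≤ R := by simpa using hz
      have h1 : 0 ≤ (1 - v * z).re := hre z (le_trans (by gcongr) hv)
      refine ContinuousAt.continuousWithinAt ?_
      refine continuousAt_const.mul ?_
      -- The zero may lie on the boundary circle (|u| = R); continuity of the power there uses s >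
      -- 0.
      by_cases h0 : 1 - v * z = 0
      · have h3 : ContinuousAt (fun x : ℂ × ℂ => x.1 ^ x.2) (0, (s : ℂ)) :=
          Complex.continuousAt_cpow_zero_of_re_pos (by simpa using hs)
        rw [← h0] at h3
        exact ContinuousAt.comp (f := fun z : ℂ => ((1 - v * z, (s : ℂ)) : ℂ × ℂ)) h3 (by fun_prop)
      · refine ContinuousAt.cpow (by fun_prop) (by fun_prop) ?_
        rw [Complex.mem_slitPlane_iff]
        rcases h1.lt_or_eq with h | h
        · exact Or.inl h
        · refine Or.inr fun him => h0 (Complex.ext h.symm him)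
    · intro z
      rw [norm_mul, Complex.norm_cpow_real, Complex.norm_real, Real.norm_of_nonneg (by positivity),
        Real.mul_rpow hc (by positivity)]
  rcases le_or_gt R ‖u‖ with h | h
  · have hu : u ≠ 0 := by
      rintro rfl
      simp at h; linarith
    have hu' : 0 < ‖u‖ := norm_pos_iff.2 hu
    obtain ⟨h1, h2⟩ := main u⁻¹ (by rw [norm_inv]; field_simp; exact h) ‖u‖ (norm_nonneg _)
    have h3 : ∀ z, ‖u‖ * ‖1 - u⁻¹ * z‖ = ‖z - u‖ := by
      intro z
      rw [← norm_mul, mul_sub, mul_inv_cancel_left₀ hu, mul_one, norm_sub_rev]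
    refine ⟨_, h1, fun z _ => ?_, fun z _ => ?_⟩ <;> rw [h2, h3]
  · obtain ⟨h1, h2⟩ := main ((starRingEnd ℂ) u / (R : ℂ) ^ 2) (by
      simp only [norm_div, RCLike.norm_conj, norm_pow, Complex.norm_real, Real.norm_of_nonneg hR.le]
      field_simp; exact h.le) R hR.le
    have h3 : ∀ z, (R * ‖1 - (starRingEnd ℂ) u / (R : ℂ) ^ 2 * z‖) ^ 2 =
        ‖z - u‖ ^ 2 + (R ^ 2 - ‖u‖ ^ 2) * (R ^ 2 - ‖z‖ ^ 2) / R ^ 2 := by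
      intro z
      have : R * ‖1 - (starRingEnd ℂ) u / (R : ℂ) ^ 2 * z‖ =
          ‖(R : ℂ) ^ 2 - (starRingEnd ℂ) u * z‖ / R := by
        have hRc : (R : ℂ) ≠ 0 := by exact_mod_cast hR.ne'
        have e : (R : ℂ) ^ 2 - (starRingEnd ℂ) u * z =
          (R : ℂ) ^ 2 * (1 - (starRingEnd ℂ) u / (R : ℂ) ^ 2 * z) := by field_simp
        rw [e, norm_mul, norm_pow, Complex.norm_real, Real.norm_of_nonneg hR.le]
        field_simp
      rw [this, div_pow]
      have e2 : ‖(R : ℂ) ^ 2 - (starRingEnd ℂ) u * z‖ ^ 2 =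
          R ^ 2 * ‖z - u‖ ^ 2 + (R ^ 2 - ‖u‖ ^ 2) * (R ^ 2 - ‖z‖ ^ 2) := by
        simp only [← Complex.normSq_eq_norm_sq, Complex.normSq_apply]
        simp [pow_two]
        ring
      rw [e2]
      field_simp
    refine ⟨_, h1, fun z hz => ?_, fun z hz => ?_⟩ <;> rw [h2]
    · have hz' : ‖z‖ = R := by simpa using hz
      congr 1
      have := h3 z
      rw [hz', sub_self, mul_zero, zero_div, add_zero] at this
      exact (pow_left_inj₀ (by positivity) (by positivity) two_ne_zero).1 this
    · have hz' : ‖z‖ < R := by simpa using hz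
      gcongr
      refine le_of_sq_le_sq ?_ (by positivity)
      rw [h3]
      have : 0 ≤ (R ^ 2 - ‖u‖ ^ 2) * (R ^ 2 - ‖z‖ ^ 2) / R ^ 2 := by
        have : 0 ≤ R ^ 2 - ‖u‖ ^ 2 := by nlinarith [norm_nonneg u]
        have : 0 ≤ R ^ 2 - ‖z‖ ^ 2 := by nlinarith [norm_nonneg z]
        positivity
      linarith

/-- The property is multiplicative, so it passes from linear factors to the factorization over the
roots. -/
theorem Polynomial.exists_diffContOnCl_norm_rpow_eval {R s : ℝ} (hR : 0 < R) (hs : 0 < s)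
    (P : Polynomial ℂ) :
    ∃ G : ℂ → ℂ, DiffContOnCl ℂ G (Metric.ball 0 R) ∧
      (∀ z ∈ Metric.sphere (0 : ℂ) R, ‖G z‖ = ‖P.eval z‖ ^ s) ∧
      ∀ z ∈ Metric.ball (0 : ℂ) R, ‖P.eval z‖ ^ s ≤ ‖G z‖ := by
  have hm : ∀ m : Multiset ℂ, ∃ G : ℂ → ℂ, DiffContOnCl ℂ G (Metric.ball 0 R) ∧
      (∀ z ∈ Metric.sphere (0 : ℂ) R, ‖G z‖ = ‖(m.map fun u => z - u).prod‖ ^ s) ∧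
      ∀ z ∈ Metric.ball (0 : ℂ) R, ‖(m.map fun u => z - u).prod‖ ^ s ≤ ‖G z‖ := by
    intro m
    induction m using Multiset.induction_on with
    | empty => exact ⟨fun _ => 1, diffContOnCl_const, by simp, by simp⟩
    | cons u m ih =>
      obtain ⟨G, h1, h2, h3⟩ := ih
      obtain ⟨H, k1, k2, k3⟩ := exists_diffContOnCl_norm_rpow_sub hR hs u
      refine ⟨fun z => H z * G z, k1.smul h1, fun z hz => ?_, fun z hz => ?_⟩
      · rw [norm_mul, k2 z hz, h2 z hz, Multiset.map_cons, Multiset.prod_cons, norm_mul,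
          Real.mul_rpow (by positivity) (by positivity)]
      · rw [norm_mul, Multiset.map_cons, Multiset.prod_cons, norm_mul,
          Real.mul_rpow (by positivity) (by positivity)]
        exact mul_le_mul (k3 z hz) (h3 z hz) (by positivity) (by positivity)
  obtain ⟨G, h1, h2, h3⟩ := hm P.roots
  have hP : ∀ z, ‖P.eval z‖ ^ s = ‖P.leadingCoeff‖ ^ s * ‖(P.roots.map fun u => z - u).prod‖ ^ s := by
    intro z
    have := (IsAlgClosed.splits P).eval_eq_prod_roots z
    rw [this, norm_mul, Real.mul_rpow (by positivity) (by positivity)]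
  refine ⟨fun z => ((‖P.leadingCoeff‖ ^ s : ℝ) : ℂ) * G z, h1.const_smul ((‖P.leadingCoeff‖ ^ s : ℝ) : ℂ),
    fun z hz => ?_, fun z hz => ?_⟩
  · rw [norm_mul, Complex.norm_real, Real.norm_of_nonneg (by positivity), h2 z hz, hP]
  · rw [norm_mul, Complex.norm_real, Real.norm_of_nonneg (by positivity), hP]
    exact mul_le_mul_of_nonneg_left (h3 z hz) (by positivity)

theorem continuousOn_poissonKernel_sphere {R : ℝ} {w : ℂ} (hw : w ∈ Metric.ball (0 : ℂ) R) :
    ContinuousOn (poissonKernel 0 w) (Metric.sphere 0 R) := by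
  have : poissonKernel 0 w = fun z => (‖z‖ ^ 2 - ‖w‖ ^ 2) / ‖z - w‖ ^ 2 := by
    ext z; simp [poissonKernel_def]
  rw [this]
  refine ContinuousOn.div (by fun_prop) (by fun_prop) fun z hz => ?_
  have h1 : ‖z‖ = R := by simpa using hz
  have h2 : ‖w‖ < R := by simpa using hw
  have : z ≠ w := by rintro rfl; linarith
  have := norm_pos_iff.2 (sub_ne_zero.2 this)
  positivity

theorem poissonKernel_nonneg {R : ℝ} {w z : ℂ} (hw : w ∈ Metric.ball (0 : ℂ) R)
    (hz : z ∈ Metric.sphere (0 : ℂ) R) : 0 ≤ poissonKernel 0 w z := by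
  have h1 : ‖z‖ = R := by simpa using hz
  have h2 : ‖w‖ < R := by simpa using hw
  rw [poissonKernel_def]
  simp only [sub_zero]
  rw [h1]
  have : 0 ≤ R ^ 2 - ‖w‖ ^ 2 := by nlinarith [norm_nonneg w]
  positivity

theorem Polynomial.norm_rpow_eval_le_circleAverage {R s : ℝ} (hR : 0 < R) (hs : 0 < s)
    (P : Polynomial ℂ) {w : ℂ} (hw : w ∈ Metric.ball (0 : ℂ) R) :
    ‖P.eval w‖ ^ s ≤ Real.circleAverage (fun z => poissonKernel 0 w z * ‖P.eval z‖ ^ s) 0 R := by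
  obtain ⟨G, h1, h2, h3⟩ := P.exists_diffContOnCl_norm_rpow_eval hR hs
  refine (h3 w hw).trans ?_
  rw [← h1.circleAverage_poissonKernel_smul hw, Real.circleAverage_def, Real.circleAverage_def,
    norm_smul, Real.norm_of_nonneg (by positivity), smul_eq_mul]
  gcongr
  refine (intervalIntegral.norm_integral_le_integral_norm (by positivity)).trans (le_of_eq ?_)
  refine intervalIntegral.integral_congr fun t _ => ?_
  have hmem := circleMap_mem_sphere (0 : ℂ) hR.le t
  simp only [Pi.smul_apply', norm_smul, Real.norm_of_nonneg (poissonKernel_nonneg hw hmem), h2 _ hmem]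

theorem exists_hasSum_mul_pow {f : ℂ → ℂ} (hf : DifferentiableOn ℂ f (Metric.ball 0 1)) :
    ∃ a : ℕ → ℂ, ∀ z ∈ Metric.ball (0 : ℂ) 1, HasSum (fun k => a k * z ^ k) (f z) := by
  refine ⟨fun k => (k.factorial : ℂ)⁻¹ * iteratedDeriv k f 0, fun z hz => ?_⟩
  have := Complex.hasSum_taylorSeries_on_ball (r := 1) hf hz
  convert! this using 2 with k
  simp only [sub_zero, smul_eq_mul]
  ring

theorem summable_norm_mul_pow {f : ℂ → ℂ} {a : ℕ → ℂ}
    (ha : ∀ z ∈ Metric.ball (0 : ℂ) 1, HasSum (fun k => a k * z ^ k) (f z)) {R : ℝ} (hR : 0 ≤ R)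
    (hR1 : R < 1) : Summable fun k => ‖a k‖ * R ^ k := by
  have := (ha (R : ℂ) (by simpa [abs_of_nonneg hR] using hR1)).summable.norm
  simpa [abs_of_nonneg hR] using this

/-- The subharmonicity of `|f|^s`, in the form of a Poisson integral inequality. -/
theorem norm_rpow_le_circleAverage_poissonKernel {f : ℂ → ℂ}
    (hf : DifferentiableOn ℂ f (Metric.ball 0 1)) {R s : ℝ} (hR : 0 < R) (hR1 : R < 1)
    (hs : 0 < s) {w : ℂ} (hw : w ∈ Metric.ball (0 : ℂ) R) :
    ‖f w‖ ^ s ≤ Real.circleAverage (fun z => poissonKernel 0 w z * ‖f z‖ ^ s) 0 R := by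
  obtain ⟨a, ha⟩ := exists_hasSum_mul_pow hf
  have hsum := summable_norm_mul_pow ha hR.le hR1
  -- The inequality passes from Taylor polynomials to f: they are uniformly bounded on the circle of
  -- radius R, so dominated convergence applies.
  set P : ℕ → Polynomial ℂ := fun n => ∑ k ∈ Finset.range n, Polynomial.C (a k) * Polynomial.X ^ k
    with hPdef
  have hPeval : ∀ n z, (P n).eval z = ∑ k ∈ Finset.range n, a k * z ^ k := by
    intro n z
    simp [hPdef, Polynomial.eval_finsetSum]
  have hlim : ∀ z ∈ Metric.ball (0 : ℂ) 1,
      Filter.Tendsto (fun n => ‖(P n).eval z‖ ^ s) Filter.atTop (nhds (‖f z‖ ^ s)) := by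
    intro z hz
    simp_rw [hPeval]
    exact ((ha z hz).tendsto_sum_nat.norm).rpow_const (Or.inr hs.le)
  have hbound : ∀ n, ∀ z ∈ Metric.sphere (0 : ℂ) R, ‖(P n).eval z‖ ≤ ∑' k, ‖a k‖ * R ^ k := by
    intro n z hz
    have hz' : ‖z‖ = R := by simpa using hz
    rw [hPeval]
    refine (norm_sum_le _ _).trans ?_
    simp_rw [norm_mul, norm_pow, hz']
    exact hsum.sum_le_tsum _ fun _ _ => by positivity
  have hw1 : w ∈ Metric.ball (0 : ℂ) 1 := Metric.ball_subset_ball hR1.le hw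
  have hP := fun n => (P n).norm_rpow_eval_le_circleAverage hR hs hw
  refine le_of_tendsto_of_tendsto' (hlim w hw1) ?_ hP
  have hcont : Continuous fun t => poissonKernel 0 w (circleMap 0 R t) :=
    (continuousOn_poissonKernel_sphere hw).comp_continuous (continuous_circleMap 0 R)
      fun t => circleMap_mem_sphere 0 hR.le t
  simp only [Real.circleAverage_def]
  refine Filter.Tendsto.const_smul ?_ _
  refine intervalIntegral.tendsto_integral_filter_of_dominated_convergence
    (fun t => poissonKernel 0 w (circleMap 0 R t) * (∑' k, ‖a k‖ * R ^ k) ^ s) ?_ ?_ ?_ ?_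
  · refine Filter.Eventually.of_forall fun n => Continuous.aestronglyMeasurable ?_
    refine hcont.mul ?_
    refine Continuous.rpow_const ?_ fun _ => Or.inr hs.le
    exact ((P n).continuous.comp (continuous_circleMap 0 R)).norm
  · refine Filter.Eventually.of_forall fun n => Filter.Eventually.of_forall fun t _ => ?_
    have hmem := circleMap_mem_sphere (0 : ℂ) hR.le t
    have h0 := poissonKernel_nonneg hw hmem
    rw [Real.norm_of_nonneg (mul_nonneg h0 (by positivity))]
    gcongr
    exact hbound n _ hmem
  · exact (hcont.mul continuous_const).intervalIntegrable _ _
  · refine Filter.Eventually.of_forall fun t _ => ?_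
    refine (hlim _ ?_).const_mul _
    simpa [abs_of_pos hR] using hR1

/-- Normalized Lebesgue measure on `(0, 2π)`. -/
def angleMeasure : Measure ℝ :=
  ENNReal.ofReal (1 / (2 * Real.pi)) • volume.restrict (Set.Ioo 0 (2 * Real.pi))

theorem ofReal_circleAverage_eq {g : ℂ → ℝ} {R : ℝ}
    (hg : Continuous fun t => g (circleMap 0 R t)) (h0 : ∀ t, 0 ≤ g (circleMap 0 R t)) :
    ENNReal.ofReal (Real.circleAverage g 0 R) =
      ∫⁻ t, ENNReal.ofReal (g (circleMap 0 R t)) ∂angleMeasure := by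
  rw [Real.circleAverage_def, intervalIntegral.integral_of_le (by positivity),
    integral_Ioc_eq_integral_Ioo, smul_eq_mul, ENNReal.ofReal_mul (by positivity),
    ofReal_integral_eq_lintegral_ofReal, angleMeasure, lintegral_smul_measure, one_div, smul_eq_mul]
  · exact (hg.integrableOn_Icc).mono_set Set.Ioo_subset_Icc_self
  · exact Filter.Eventually.of_forall h0

theorem enorm_rpow_le_lintegral_poissonKernel {f : ℂ → ℂ}
    (hf : DifferentiableOn ℂ f (Metric.ball 0 1)) {R s : ℝ} (hR : 0 < R) (hR1 : R < 1)
    (hs : 0 < s) {w : ℂ} (hw : w ∈ Metric.ball (0 : ℂ) R) :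
    ‖f w‖ₑ ^ s ≤ ∫⁻ t, ENNReal.ofReal (poissonKernel 0 w (circleMap 0 R t)) *
      ‖f (circleMap 0 R t)‖ₑ ^ s ∂angleMeasure := by
  have h := ENNReal.ofReal_le_ofReal (norm_rpow_le_circleAverage_poissonKernel hf hR hR1 hs hw)
  have hn : ∀ z, ENNReal.ofReal (‖f z‖ ^ s) = ‖f z‖ₑ ^ s := fun z => by
    rw [← ENNReal.ofReal_rpow_of_nonneg (norm_nonneg _) hs.le, ofReal_norm]
  have hmem := fun t => circleMap_mem_sphere (0 : ℂ) hR.le t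
  rw [hn, ofReal_circleAverage_eq] at h
  · refine h.trans (le_of_eq (lintegral_congr fun t => ?_))
    rw [ENNReal.ofReal_mul (poissonKernel_nonneg hw (hmem t)), hn]
  · refine ((continuousOn_poissonKernel_sphere hw).comp_continuous (continuous_circleMap 0 R)
      hmem).mul ?_
    refine Continuous.rpow_const ?_ fun _ => Or.inr hs.le
    refine (hf.continuousOn.comp_continuous (continuous_circleMap 0 R) fun t => ?_).norm
    simpa [abs_of_pos hR] using hR1
  · exact fun t => mul_nonneg (poissonKernel_nonneg hw (hmem t)) (by positivity)

theorem lintegral_poissonKernel {R : ℝ} (hR : 0 < R) {w : ℂ} (hw : w ∈ Metric.ball (0 : ℂ) R) :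
    ∫⁻ t, ENNReal.ofReal (poissonKernel 0 w (circleMap 0 R t)) ∂angleMeasure = 1 := by
  have hmem := fun t => circleMap_mem_sphere (0 : ℂ) hR.le t
  rw [← ofReal_circleAverage_eq]
  · have := (diffContOnCl_const (𝕜 := ℂ) (c := (1 : ℂ)) (s := Metric.ball (0 : ℂ) R)
      ).circleAverage_poissonKernel_smul hw
    have h2 : ((Real.circleAverage (poissonKernel 0 w) 0 R : ℝ) : ℂ) = 1 := by
      rw [← this, Real.circleAverage_def, Real.circleAverage_def]
      simp [Pi.smul_apply', Algebra.smul_def]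
      exact intervalIntegral.integral_ofReal.symm
    rw [Complex.ofReal_eq_one.1 h2, ENNReal.ofReal_one]
  · exact (continuousOn_poissonKernel_sphere hw).comp_continuous (continuous_circleMap 0 R) hmem
  · exact fun t => poissonKernel_nonneg hw (hmem t)

/-! ### The weighted Bergman reproducing formula -/

/-- The radial density `(n + 1) (1 - r²)^n 2 r` of the weighted area measure. -/
def radialDensity (n : ℕ) (r : ℝ) : ℝ := (n + 1) * (1 - r ^ 2) ^ n * (2 * r)

theorem continuous_radialDensity (n : ℕ) : Continuous (radialDensity n) := by
  unfold radialDensity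
  fun_prop

/-- These moments are the reciprocals of the Taylor coefficients of (1 - x)^{-(n+2)}, which is what
makes the kernel reproducing. Integration by parts lowers k at the cost of raising n, hence the
induction on k for all n at once. -/
theorem integral_radialDensity_mul_pow (k : ℕ) : ∀ n : ℕ,
    ∫ r in (0 : ℝ)..1, radialDensity n r * r ^ (2 * k) = ((k + (n + 1)).choose (n + 1) : ℝ)⁻¹ := by
  have hd : ∀ (n : ℕ) (r : ℝ), HasDerivAt (fun r : ℝ => -(1 - r ^ 2) ^ (n + 1)) (radialDensity n r) r := by
    intro n r
    have := (((hasDerivAt_id r).pow 2).const_sub 1).pow (n + 1)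
    convert! this.neg using 1
    simp [radialDensity]
  induction k with
  | zero =>
    intro n
    have := intervalIntegral.integral_eq_sub_of_hasDerivAt (a := 0) (b := 1) (fun r _ => hd n r)
      ((continuous_radialDensity n).intervalIntegrable _ _)
    simp [this]
  | succ k ih =>
    intro n
    -- The primitive vanishes at both 0 and 1, so no boundary terms appear.
    have h1 : ∀ r : ℝ, HasDerivAt (fun r : ℝ => -(1 - r ^ 2) ^ (n + 1) * r ^ (2 * (k + 1)))
        (radialDensity n r * r ^ (2 * (k + 1)) -
          ((k : ℝ) + 1) / (n + 2) * (radialDensity (n + 1) r * r ^ (2 * k))) r := by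
      intro r
      convert! (hd n r).mul (hasDerivAt_pow (2 * (k + 1)) r) using 1
      simp only [radialDensity]
      have : 2 * (k + 1) - 1 = 2 * k + 1 := by omega
      push_cast
      rw [this]
      field_simp
      ring
    have hc : ∀ n k : ℕ, Continuous fun r => radialDensity n r * r ^ (2 * k) :=
      fun n k => (continuous_radialDensity n).mul (continuous_pow (M := ℝ) (2 * k))
    have h2 := intervalIntegral.integral_eq_sub_of_hasDerivAt (a := 0) (b := 1) (fun r _ => h1 r)
      (((hc n (k + 1)).sub ((hc (n + 1) k).const_mul _)).intervalIntegrable _ _)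
    rw [intervalIntegral.integral_sub ((hc n (k + 1)).intervalIntegrable _ _)
      (((hc (n + 1) k).const_mul _).intervalIntegrable _ _),
      intervalIntegral.integral_const_mul, ih] at h2
    rw [sub_eq_zero.1 (h2.trans (by simp))]
    have h3 := Nat.choose_succ_right_eq (k + (n + 2)) (n + 1)
    have e1 : k + (n + 2) - (n + 1) = k + 1 := by omega
    rw [e1] at h3
    have h4 : (0 : ℝ) < ((k + (n + 2)).choose (n + 1) : ℝ) := by
      exact_mod_cast Nat.choose_pos (by omega)
    have h5 : (0 : ℝ) < ((k + (n + 2)).choose (n + 2) : ℝ) := by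
      exact_mod_cast Nat.choose_pos (by omega)
    have h3' : ((k + (n + 2)).choose (n + 2) : ℝ) * (n + 2) =
        ((k + (n + 2)).choose (n + 1) : ℝ) * (k + 1) := by exact_mod_cast h3
    rw [show k + 1 + (n + 1) = k + (n + 2) by ring, show k + (n + 1 + 1) = k + (n + 2) by ring,
      show n + 1 + 1 = n + 2 by ring]
    field_simp
    linarith

/-- Orthogonality of the exponentials leaves only the k-th term of the power series. -/
theorem circleAverage_mul_conj_pow {f : ℂ → ℂ} {a : ℕ → ℂ}
    (ha : ∀ z ∈ Metric.ball (0 : ℂ) 1, HasSum (fun k => a k * z ^ k) (f z)) {r : ℝ} (hr : 0 < r)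
    (hr1 : r < 1) (k : ℕ) :
    Real.circleAverage (fun ζ => f ζ * (starRingEnd ℂ) ζ ^ k) 0 r = a k * (r : ℂ) ^ (2 * k) := by
  have hsum := summable_norm_mul_pow ha hr.le hr1
  have hmem : ∀ t, circleMap 0 r t ∈ Metric.ball (0 : ℂ) 1 := fun t => by
    simpa [abs_of_pos hr] using hr1
  have hn : ∀ t, ‖circleMap 0 r t‖ = r := fun t => by simp [abs_of_pos hr]
  have h1 := intervalIntegral.hasSum_integral_of_dominated_convergence (a := 0) (b := 2 * Real.pi)
    (μ := volume)
    (F := fun n t => a n * circleMap 0 r t ^ n * (starRingEnd ℂ) (circleMap 0 r t) ^ k)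
    (f := fun t => f (circleMap 0 r t) * (starRingEnd ℂ) (circleMap 0 r t) ^ k)
    (fun n _ => ‖a n‖ * r ^ n * r ^ k) (fun n => Continuous.aestronglyMeasurable (by fun_prop))
    (fun n => Filter.Eventually.of_forall fun t _ => by simp [abs_of_pos hr])
    (Filter.Eventually.of_forall fun t _ => hsum.mul_right _)
    (by simp) (Filter.Eventually.of_forall fun t _ => (ha _ (hmem t)).mul_right _)
  have h2 : ∀ n : ℕ, ∫ t in (0 : ℝ)..2 * Real.pi,
      a n * circleMap 0 r t ^ n * (starRingEnd ℂ) (circleMap 0 r t) ^ k =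
      if n = k then 2 * Real.pi * (a k * (r : ℂ) ^ (2 * k)) else 0 := by
    intro n
    have e : ∀ t : ℝ, a n * circleMap 0 r t ^ n * (starRingEnd ℂ) (circleMap 0 r t) ^ k =
        a n * (r : ℂ) ^ (n + k) * Complex.exp (((n : ℂ) - k) * Complex.I * t) := by
      intro t
      have : (starRingEnd ℂ) (Complex.exp (t * Complex.I)) = Complex.exp (-(t * Complex.I)) := by
        rw [← Complex.exp_conj]; simp
      simp only [circleMap, zero_add, map_mul, Complex.conj_ofReal, mul_pow, this, ← Complex.exp_nat_mul]
      rw [show ((n : ℂ) - k) * Complex.I * t = n * (t * Complex.I) + k * -(t * Complex.I) by ring,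
        Complex.exp_add]
      ring
    simp_rw [e]
    rw [intervalIntegral.integral_const_mul]
    split_ifs with h
    · subst h
      simp
      ring
    · have hc : ((n : ℂ) - k) * Complex.I ≠ 0 := by
        refine mul_ne_zero (sub_ne_zero.2 ?_) Complex.I_ne_zero
        exact_mod_cast h
      rw [integral_exp_mul_complex hc]
      have : Complex.exp (((n : ℂ) - k) * Complex.I * ((2 * Real.pi : ℝ) : ℂ)) = 1 := by
        rw [Complex.exp_eq_one_iff]
        exact ⟨n - k, by push_cast; ring⟩
      rw [this]
      simp
  simp_rw [h2] at h1
  have h3 := h1.unique (hasSum_ite_eq k _)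
  rw [Real.circleAverage_def, h3, Complex.real_smul]
  push_cast
  have : (Real.pi : ℂ) ≠ 0 := by exact_mod_cast Real.pi_ne_zero
  field_simp

/-- The circular means of `f` against the kernel `(1 - conj ζ z)^{-(n+2)}`. -/
theorem hasSum_circleAverage_kernel {f : ℂ → ℂ} {a : ℕ → ℂ}
    (ha : ∀ z ∈ Metric.ball (0 : ℂ) 1, HasSum (fun k => a k * z ^ k) (f z)) {r : ℝ} (hr : 0 < r)
    (hr1 : r < 1) (hfc : ContinuousOn f (Metric.ball 0 1)) (n : ℕ) {z : ℂ} (hz : ‖z‖ < 1) :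
    HasSum (fun k : ℕ => ((k + (n + 1)).choose (n + 1) : ℂ) * z ^ k * (a k * (r : ℂ) ^ (2 * k)))
      (Real.circleAverage (fun ζ => f ζ * (1 / (1 - (starRingEnd ℂ) ζ * z) ^ (n + 2))) 0 r) := by
  have hmem : ∀ t, circleMap 0 r t ∈ Metric.ball (0 : ℂ) 1 := fun t => by
    simpa [abs_of_pos hr] using hr1
  have hn : ∀ t, ‖circleMap 0 r t‖ = r := fun t => by simp [abs_of_pos hr]
  have hcont : Continuous fun t => f (circleMap 0 r t) :=
    hfc.comp_continuous (continuous_circleMap 0 r) hmem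
  have hrz : ‖((r * ‖z‖ : ℝ) : ℂ)‖ < 1 := by
    rw [Complex.norm_real, Real.norm_of_nonneg (by positivity)]
    nlinarith [norm_nonneg z]
  have hS := (hasSum_choose_mul_geometric_of_norm_lt_one (n + 1) hrz).summable.norm
  have h1 := intervalIntegral.hasSum_integral_of_dominated_convergence (a := 0) (b := 2 * Real.pi)
    (μ := volume)
    (F := fun k t => ((k + (n + 1)).choose (n + 1) : ℂ) * z ^ k *
      (f (circleMap 0 r t) * (starRingEnd ℂ) (circleMap 0 r t) ^ k))
    (f := fun t => f (circleMap 0 r t) * (1 / (1 - (starRingEnd ℂ) (circleMap 0 r t) * z) ^ (n + 2)))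
    (fun k t => ‖f (circleMap 0 r t)‖ * ‖((k + (n + 1)).choose (n + 1) : ℂ) * ((r * ‖z‖ : ℝ) : ℂ) ^ k‖)
    (fun k => Continuous.aestronglyMeasurable
      (continuous_const.mul (hcont.mul (by fun_prop))))
    (fun k => Filter.Eventually.of_forall fun t _ => by
      simp only [norm_mul, norm_pow, hn, RCLike.norm_conj, Complex.norm_real,
        Real.norm_of_nonneg hr.le, norm_norm, mul_pow, Complex.ofReal_mul]
      refine le_of_eq ?_
      ring)
    (Filter.Eventually.of_forall fun t _ => hS.mul_left _)
    (by
      simp_rw [tsum_mul_left]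
      exact (hcont.norm.mul continuous_const).intervalIntegrable _ _)
    (Filter.Eventually.of_forall fun t _ => by
      have hlt : ‖(starRingEnd ℂ) (circleMap 0 r t) * z‖ < 1 := by
        rw [norm_mul, RCLike.norm_conj, hn]
        nlinarith [norm_nonneg z]
      have := (hasSum_choose_mul_geometric_of_norm_lt_one (n + 1) hlt).mul_left (f (circleMap 0 r t))
      convert! this using 2 with k
      rw [mul_pow]; ring)
  have h2 := h1.const_smul ((2 * Real.pi)⁻¹ : ℝ)
  rw [← Real.circleAverage_def (f := fun ζ => f ζ * (1 / (1 - (starRingEnd ℂ) ζ * z) ^ (n + 2)))] at h2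
  convert! h2 using 2 with k
  rw [intervalIntegral.integral_const_mul, ← circleAverage_mul_conj_pow ha hr hr1 k,
    Real.circleAverage_def, mul_smul_comm]

/-- The weighted Bergman reproducing formula, in polar coordinates. -/
theorem exists_integral_radialDensity_circleAverage {f : ℂ → ℂ}
    (hf : DifferentiableOn ℂ f (Metric.ball 0 1)) (n : ℕ) {z : ℂ} (hz : ‖z‖ < 1) :
    ∃ D : ℝ → ℂ, ContinuousOn D (Set.Icc 0 1) ∧
      (∀ r ∈ Set.Ioo (0 : ℝ) 1, D r =
        Real.circleAverage (fun ζ => f ζ * (1 / (1 - (starRingEnd ℂ) ζ * z) ^ (n + 2))) 0 r) ∧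
      ∫ r in (0 : ℝ)..1, radialDensity n r • D r = f z := by
  obtain ⟨a, ha⟩ := exists_hasSum_mul_pow hf
  set g : ℕ → ℂ := fun k => ((k + (n + 1)).choose (n + 1) : ℂ) * z ^ k * a k with hg
  have hgs : Summable fun k => ‖g k‖ := by
    obtain ⟨R, hzR, hR1⟩ := exists_between hz
    have hR : 0 < R := (norm_nonneg z).trans_lt hzR
    have hs := summable_norm_mul_pow ha hR.le hR1
    have hq : ‖((‖z‖ / R : ℝ) : ℂ)‖ < 1 := by
      rw [Complex.norm_real, Real.norm_of_nonneg (by positivity), div_lt_one hR]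
      exact hzR
    have hS := (hasSum_choose_mul_geometric_of_norm_lt_one (n + 1) hq).summable.norm
    obtain ⟨B, hB⟩ : ∃ B, ∀ k, ‖a k‖ * R ^ k ≤ B :=
      ⟨_, fun k => hs.le_tsum k fun _ _ => by positivity⟩
    refine Summable.of_nonneg_of_le (fun _ => norm_nonneg _) (fun k => ?_) (hS.mul_right B)
    have : ‖g k‖ = ‖((k + (n + 1)).choose (n + 1) : ℂ) * ((‖z‖ / R : ℝ) : ℂ) ^ k‖ * (‖a k‖ * R ^ k) := by
      simp only [hg, norm_mul, norm_pow, Complex.norm_real]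
      rw [Real.norm_of_nonneg (by positivity), div_pow]
      field_simp
    rw [this]
    gcongr
    exact hB k
  have hbd : ∀ k : ℕ, ∀ r ∈ Set.Icc (0 : ℝ) 1, ‖g k * (r : ℂ) ^ (2 * k)‖ ≤ ‖g k‖ := by
    intro k r hr
    rw [norm_mul, norm_pow, Complex.norm_real, Real.norm_of_nonneg hr.1]
    exact mul_le_of_le_one_right (norm_nonneg _) (pow_le_one₀ hr.1 hr.2)
  -- Because |z| < 1, this series converges uniformly up to r = 1. Hence the iterated integral makes
  -- sense for every analytic f, without any integrability of f over the disc.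
  refine ⟨fun r => ∑' k, g k * (r : ℂ) ^ (2 * k), ?_, ?_, ?_⟩
  · exact continuousOn_tsum (fun k => by fun_prop) hgs hbd
  · intro r hr
    rw [← (hasSum_circleAverage_kernel ha hr.1 hr.2 hf.continuousOn n hz).tsum_eq]
    refine tsum_congr fun k => ?_
    simp only [hg]; ring
  · have h1 := intervalIntegral.hasSum_integral_of_dominated_convergence (a := 0) (b := 1)
      (μ := volume)
      (F := fun k (r : ℝ) => radialDensity n r • (g k * (r : ℂ) ^ (2 * k)))
      (f := fun r : ℝ => radialDensity n r • ∑' k, g k * (r : ℂ) ^ (2 * k))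
      (fun k r => ‖radialDensity n r‖ * ‖g k‖)
      (fun k => Continuous.aestronglyMeasurable
        ((continuous_radialDensity n).smul (by fun_prop)))
      (fun k => Filter.Eventually.of_forall fun r hr => by
        rw [Set.uIoc_of_le zero_le_one] at hr
        rw [norm_smul]
        gcongr
        exact hbd k r ⟨hr.1.le, hr.2⟩)
      (Filter.Eventually.of_forall fun r _ => hgs.mul_left _)
      (by
        simp_rw [tsum_mul_left]
        exact ((continuous_radialDensity n).norm.mul continuous_const).intervalIntegrable _ _)
      (Filter.Eventually.of_forall fun r hr => by
        rw [Set.uIoc_of_le zero_le_one] at hr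
        exact (Summable.of_norm_bounded hgs fun k => hbd k r ⟨hr.1.le, hr.2⟩).hasSum.const_smul _)
    have h2 : ∀ k : ℕ, ∫ r in (0 : ℝ)..1, radialDensity n r • (g k * (r : ℂ) ^ (2 * k)) =
        a k * z ^ k := by
      intro k
      have e : ∀ r : ℝ, radialDensity n r • (g k * (r : ℂ) ^ (2 * k)) =
          g k * ((radialDensity n r * r ^ (2 * k) : ℝ) : ℂ) := by
        intro r
        rw [Complex.real_smul]; push_cast; ring
      simp_rw [e]
      rw [intervalIntegral.integral_const_mul, intervalIntegral.integral_ofReal,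
        integral_radialDensity_mul_pow]
      have : ((k + (n + 1)).choose (n + 1) : ℂ) ≠ 0 := by
        exact_mod_cast (Nat.choose_pos (by omega)).ne'
      simp only [hg]
      push_cast
      field_simp
    simp_rw [h2] at h1
    exact h1.unique (ha z (by simpa using hz))

/-! ### The kernel |1 - conj ξ z|⁻¹: comparisons, circle integrals, sums over corners -/

/-- The modulus of the kernel `1 / (1 - conj ξ z)`. -/
def kerAbs (ξ z : ℂ) : ℝ≥0∞ := ‖1 - (starRingEnd ℂ) ξ * z‖ₑ⁻¹

theorem norm_one_sub_conj_mul_comm (ξ z : ℂ) :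
    ‖1 - (starRingEnd ℂ) ξ * z‖ = ‖1 - (starRingEnd ℂ) z * ξ‖ := by
  rw [← RCLike.norm_conj]
  simp [mul_comm]

theorem kerAbs_comm (ξ z : ℂ) : kerAbs ξ z = kerAbs z ξ := by
  unfold kerAbs
  rw [← ofReal_norm, norm_one_sub_conj_mul_comm, ofReal_norm]

theorem one_sub_mul_le_norm_one_sub_conj_mul (ξ z : ℂ) :
    1 - ‖ξ‖ * ‖z‖ ≤ ‖1 - (starRingEnd ℂ) ξ * z‖ := by
  have := norm_sub_norm_le (1 : ℂ) ((starRingEnd ℂ) ξ * z)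
  rwa [norm_one, norm_mul, RCLike.norm_conj] at this

theorem norm_one_sub_conj_mul_of_norm_eq_one (ξ : ℂ) {u : ℂ} (hu : ‖u‖ = 1) :
    ‖1 - (starRingEnd ℂ) ξ * u‖ = ‖u - ξ‖ := by
  rw [norm_one_sub_conj_mul_comm]
  have : u * (1 - (starRingEnd ℂ) u * ξ) = u - ξ := by
    rw [mul_sub, ← mul_assoc, Complex.mul_conj, Complex.normSq_eq_norm_sq, hu]
    simp
  rw [← this, norm_mul, hu, one_mul]

theorem kerAbs_eq_ofReal {ξ z : ℂ} (h : ‖ξ‖ * ‖z‖ < 1) :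
    kerAbs ξ z = ENNReal.ofReal (‖1 - (starRingEnd ℂ) ξ * z‖⁻¹) := by
  have h1 := one_sub_mul_le_norm_one_sub_conj_mul ξ z
  rw [kerAbs, ← ofReal_norm, ENNReal.ofReal_inv_of_pos (by linarith)]

theorem kerAbs_le {ξ z : ℂ} {d : ℝ} (h : d ≤ 1 - ‖ξ‖ * ‖z‖) :
    kerAbs ξ z ≤ (ENNReal.ofReal d)⁻¹ := by
  rw [kerAbs, ← ofReal_norm]
  exact ENNReal.inv_le_inv.2 (ENNReal.ofReal_le_ofReal
    (h.trans (one_sub_mul_le_norm_one_sub_conj_mul ξ z)))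

theorem kerAbs_le_mul {ξ η z : ℂ} {c : ℝ} (hc : 0 < c)
    (h : ‖1 - (starRingEnd ℂ) ξ * z‖ ≤ c * ‖1 - (starRingEnd ℂ) η * z‖) :
    kerAbs η z ≤ ENNReal.ofReal c * kerAbs ξ z := by
  unfold kerAbs
  rw [← ofReal_norm, ← ofReal_norm]
  have h1 := ENNReal.ofReal_le_ofReal h
  rw [ENNReal.ofReal_mul hc.le] at h1
  have hc0 : ENNReal.ofReal c ≠ 0 := by simpa using hc
  calc (ENNReal.ofReal ‖1 - (starRingEnd ℂ) η * z‖)⁻¹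
      = ENNReal.ofReal c * (ENNReal.ofReal c * ENNReal.ofReal ‖1 - (starRingEnd ℂ) η * z‖)⁻¹ := by
        rw [ENNReal.mul_inv (Or.inl hc0) (Or.inl ENNReal.ofReal_ne_top), ← mul_assoc,
          ENNReal.mul_inv_cancel hc0 ENNReal.ofReal_ne_top, one_mul]
    _ ≤ _ := by
        gcongr

/-- Changing η to ξ perturbs the kernel by at most |ξ - η|, which is measured here against a lower
bound d for the kernel itself. This makes kernels based at nearby points of one cell
interchangeable. -/
theorem norm_one_sub_conj_mul_le {ξ η z : ℂ} {A d : ℝ} (hz : ‖z‖ ≤ 1) (hA : 0 ≤ A)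
    (h : ‖ξ - η‖ ≤ A * d) (hd : d ≤ ‖1 - (starRingEnd ℂ) η * z‖) :
    ‖1 - (starRingEnd ℂ) ξ * z‖ ≤ (1 + A) * ‖1 - (starRingEnd ℂ) η * z‖ := by
  have e : 1 - (starRingEnd ℂ) ξ * z =
      (1 - (starRingEnd ℂ) η * z) - (starRingEnd ℂ) (ξ - η) * z := by
    rw [map_sub]; ring
  rw [e]
  refine (norm_sub_le _ _).trans ?_
  rw [norm_mul, RCLike.norm_conj]
  have h1 : ‖ξ - η‖ * ‖z‖ ≤ ‖ξ - η‖ := mul_le_of_le_one_right (norm_nonneg _) hz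
  have h2 : A * d ≤ A * ‖1 - (starRingEnd ℂ) η * z‖ := by gcongr
  linarith

theorem measurable_kerAbs_circleMap (ξ : ℂ) (r : ℝ) :
    Measurable fun t => kerAbs ξ (circleMap 0 r t) := by
  unfold kerAbs
  refine Measurable.inv ?_
  exact (Continuous.enorm (by fun_prop)).measurable

/-- Two of the s factors, multiplied by d, are dominated by the Poisson kernel at the point rξ,
whose integral is 1; the other s - 2 factors are bounded by 1/d. This is why s ≥ 2 is required. -/
theorem lintegral_kerAbs_rpow_le {ξ : ℂ} {r d s : ℝ} (hr : 0 ≤ r) (hd : 0 < d)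
    (h : d ≤ 1 - ‖ξ‖ * r) (hs : 2 ≤ s) :
    ∫⁻ t, kerAbs ξ (circleMap 0 r t) ^ s ∂angleMeasure ≤ (ENNReal.ofReal d)⁻¹ ^ (s - 1) := by
  have hx0 : 0 ≤ ‖ξ‖ * r := by positivity
  have hw : (r : ℂ) * ξ ∈ Metric.ball (0 : ℂ) 1 := by
    simp [abs_of_nonneg hr]; linarith
  have hk : ∀ t, kerAbs ξ (circleMap 0 r t) ^ s ≤ (ENNReal.ofReal d)⁻¹ ^ (s - 1) *
      ENNReal.ofReal (poissonKernel 0 (r * ξ) (circleMap 0 1 t)) := by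
    intro t
    have hn : ‖circleMap 0 r t‖ = r := by simp [abs_of_nonneg hr]
    have h1 : kerAbs ξ (circleMap 0 r t) ≤ (ENNReal.ofReal d)⁻¹ := kerAbs_le (by rwa [hn])
    have h2 : kerAbs ξ (circleMap 0 r t) ^ (2 : ℝ) ≤ (ENNReal.ofReal d)⁻¹ *
        ENNReal.ofReal (poissonKernel 0 (r * ξ) (circleMap 0 1 t)) := by
      have hu : ‖circleMap 0 1 t‖ = 1 := by simp
      have e1 : ‖1 - (starRingEnd ℂ) ξ * circleMap 0 r t‖ = ‖circleMap 0 1 t - r * ξ‖ := by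
        rw [← norm_one_sub_conj_mul_of_norm_eq_one _ hu]
        simp [circleMap]
        ring_nf
      have h3 := one_sub_mul_le_norm_one_sub_conj_mul ξ (circleMap 0 r t)
      rw [hn, e1] at h3
      have hpos : 0 < ‖circleMap 0 1 t - r * ξ‖ := by linarith
      rw [kerAbs_eq_ofReal (by rw [hn]; linarith), ENNReal.ofReal_rpow_of_nonneg (by positivity)
        (by norm_num), ← ENNReal.ofReal_inv_of_pos hd, ← ENNReal.ofReal_mul (by positivity), e1]
      refine ENNReal.ofReal_le_ofReal ?_
      rw [poissonKernel_def]
      simp only [sub_zero, hu, norm_mul, Complex.norm_real, Real.norm_of_nonneg hr]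
      rw [Real.rpow_two, inv_pow, ← one_div, ← mul_div_assoc]
      gcongr
      rw [inv_mul_eq_div, le_div_iff₀ hd]
      nlinarith
    calc kerAbs ξ (circleMap 0 r t) ^ s
        = kerAbs ξ (circleMap 0 r t) ^ (s - 2) * kerAbs ξ (circleMap 0 r t) ^ (2 : ℝ) := by
          rw [← ENNReal.rpow_add_of_nonneg _ _ (by linarith) (by norm_num)]
          congr 1; ring
      _ ≤ (ENNReal.ofReal d)⁻¹ ^ (s - 2) * ((ENNReal.ofReal d)⁻¹ *
        ENNReal.ofReal (poissonKernel 0 (r * ξ) (circleMap 0 1 t))) :=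
          mul_le_mul' (ENNReal.rpow_le_rpow h1 (by linarith)) h2
      _ = _ := by
          rw [← mul_assoc]
          congr 1
          nth_rewrite 2 [← ENNReal.rpow_one (ENNReal.ofReal d)⁻¹]
          rw [← ENNReal.rpow_add_of_nonneg _ _ (by linarith) (by norm_num)]
          congr 1; ring
  refine (lintegral_mono hk).trans ?_
  rw [lintegral_const_mul']
  · rw [lintegral_poissonKernel one_pos hw, mul_one]
  · exact ENNReal.rpow_ne_top_of_nonneg (by linarith) (by simpa using hd)

/-- The distance `K^{-j}` of the radius `r_j` to `1`. -/
def level (K j : ℕ) : ℝ := ((K : ℝ) ^ j)⁻¹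

/-- The corner of smallest modulus and argument of the rectangle `Q_{j,l}`. -/
def corner (K j l : ℕ) : ℂ :=
  circleMap 0 (dyadicRadius K j) (2 * Real.pi * ((l : ℝ) / (K : ℝ) ^ (j + 3)))

section level

variable {K : ℕ}

theorem level_pos (hK : 2 ≤ K) (j : ℕ) : 0 < level K j := by
  have : 0 < K := by omega
  unfold level
  positivity

theorem level_zero : level K 0 = 1 := by simp [level]

theorem level_succ (hK : 2 ≤ K) (j : ℕ) : (K : ℝ) * level K (j + 1) = level K j := by
  have : (0 : ℝ) < K := by exact_mod_cast (by omega : 0 < K)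
  simp only [level]
  field_simp
  ring

theorem level_anti (hK : 2 ≤ K) {i j : ℕ} (h : i ≤ j) : level K j ≤ level K i := by
  have : (1 : ℝ) ≤ K := by exact_mod_cast (by omega : 1 ≤ K)
  unfold level
  gcongr

theorem level_le_one (hK : 2 ≤ K) (j : ℕ) : level K j ≤ 1 := by
  simpa [level] using level_anti hK (Nat.zero_le j)

theorem two_mul_level_succ_le (hK : 2 ≤ K) (j : ℕ) : 2 * level K (j + 1) ≤ level K j := by
  rw [← level_succ hK j]
  have : (2 : ℝ) ≤ K := by exact_mod_cast hK
  have := level_pos hK (j + 1)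
  gcongr

theorem dyadicRadius_eq (j : ℕ) : dyadicRadius K j = 1 - level K j := rfl

theorem dyadicRadius_nonneg (hK : 2 ≤ K) (j : ℕ) : 0 ≤ dyadicRadius K j := by
  rw [dyadicRadius_eq]; linarith [level_le_one hK j]

theorem dyadicRadius_lt_one (hK : 2 ≤ K) (j : ℕ) : dyadicRadius K j < 1 := by
  rw [dyadicRadius_eq]; linarith [level_pos hK j]

theorem dyadicRadius_mono (hK : 2 ≤ K) {i j : ℕ} (h : i ≤ j) :
    dyadicRadius K i ≤ dyadicRadius K j := by
  rw [dyadicRadius_eq, dyadicRadius_eq]; linarith [level_anti hK h]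

theorem norm_corner (hK : 2 ≤ K) (j l : ℕ) : ‖corner K j l‖ = 1 - level K j := by
  rw [corner, norm_circleMap_zero, abs_of_nonneg (dyadicRadius_nonneg hK j), dyadicRadius_eq]

/-- Since 2π < 8 ≤ K³, using K^{j+3} sectors makes their angular width at most the distance K^{-j}
to the unit circle. -/
theorem two_pi_div_le_level (hK : 2 ≤ K) (j : ℕ) :
    2 * Real.pi / (K : ℝ) ^ (j + 3) ≤ level K j := by
  have h2 : (2 : ℝ) ≤ K := by exact_mod_cast hK
  have h8 : (8 : ℝ) ≤ (K : ℝ) ^ 3 := by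
    calc (8 : ℝ) = 2 ^ 3 := by norm_num
      _ ≤ _ := by gcongr
  have hpi := Real.pi_lt_d2
  have hK0 : (0 : ℝ) < (K : ℝ) ^ j := by positivity
  rw [level, pow_add, ← one_div, div_le_div_iff₀ (by positivity) hK0]
  nlinarith

theorem dist_circleMap_le (r s t : ℝ) (hr : 0 ≤ r) :
    ‖circleMap 0 r s - circleMap 0 r t‖ ≤ r * |s - t| := by
  have := (lipschitzWith_circleMap 0 r).dist_le_mul s t
  rwa [dist_eq_norm, Real.dist_eq, Real.coe_nnabs, abs_of_nonneg hr] at this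

/-- On each angular cell the kernel at the corner is at most twice the kernel at any point of the
arc of radius r_j, so the sum is bounded by K^{j+3} times a circle integral. -/
theorem sum_kerAbs_corner_rpow_le (hK : 2 ≤ K) (j : ℕ) {z : ℂ} (hz : ‖z‖ ≤ 1) {d s : ℝ}
    (hd : 0 < d) (h : d ≤ 1 - dyadicRadius K j * ‖z‖) (hs : 2 ≤ s) :
    ∑ l : Fin (K ^ (j + 3)), kerAbs (corner K j l) z ^ s ≤
      2 ^ s * (K : ℝ≥0∞) ^ (j + 3) * (ENNReal.ofReal d)⁻¹ ^ (s - 1) := by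
  have hr0 := dyadicRadius_nonneg hK j
  have hr1 := dyadicRadius_lt_one hK j
  have hK0 : (0 : ℝ) < K := by exact_mod_cast (by omega : 0 < K)
  set L : ℝ := (K : ℝ) ^ (j + 3) with hL
  have hL0 : 0 < L := by positivity
  have hpi := Real.pi_pos
  set cell : Fin (K ^ (j + 3)) → Set ℝ := fun l =>
    Set.Ioo (2 * Real.pi * ((l : ℕ) / L)) (2 * Real.pi * (((l : ℕ) + 1) / L)) with hcell
  have hpt : ∀ l : Fin (K ^ (j + 3)), ∀ t ∈ cell l,
      kerAbs (corner K j l) z ^ s ≤ 2 ^ s * kerAbs z (circleMap 0 (dyadicRadius K j) t) ^ s := by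
    intro l t ht
    rw [← ENNReal.mul_rpow_of_nonneg _ _ (by linarith)]
    refine ENNReal.rpow_le_rpow ?_ (by linarith)
    rw [kerAbs_comm z]
    have h2 : (2 : ℝ≥0∞) = ENNReal.ofReal 2 := by simp
    rw [h2]
    refine kerAbs_le_mul two_pos ?_
    have := norm_one_sub_conj_mul_le (ξ := circleMap 0 (dyadicRadius K j) t) (η := corner K j l)
      (A := 1) (d := level K j) hz zero_le_one ?_ ?_
    · linarith
    · rw [corner]
      refine (dist_circleMap_le _ _ _ hr0).trans ?_
      have h3 : |t - 2 * Real.pi * ((l : ℕ) / L)| ≤ level K j := by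
        refine le_trans ?_ (two_pi_div_le_level hK j)
        rw [abs_of_pos (by linarith [ht.1])]
        have := ht.2
        have e : 2 * Real.pi * (((l : ℕ) + 1) / L) = 2 * Real.pi * ((l : ℕ) / L) + 2 * Real.pi / L := by
          ring
        rw [e] at this
        linarith
      rw [one_mul]
      exact (mul_le_of_le_one_left (abs_nonneg _) hr1.le).trans h3
    · refine le_trans ?_ (one_sub_mul_le_norm_one_sub_conj_mul _ _)
      rw [norm_corner hK]
      nlinarith [level_pos hK j, level_le_one hK j, norm_nonneg z]
  have hμ : ∀ l, (ENNReal.ofReal (1 / (2 * Real.pi)) • (volume : Measure ℝ)) (cell l) =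
      (K : ℝ≥0∞)⁻¹ ^ (j + 3) := by
    intro l
    rw [Measure.smul_apply, Real.volume_Ioo, smul_eq_mul, ← ENNReal.ofReal_mul (by positivity)]
    have : 1 / (2 * Real.pi) * (2 * Real.pi * (((l : ℕ) + 1) / L) - 2 * Real.pi * ((l : ℕ) / L)) =
        (K : ℝ)⁻¹ ^ (j + 3) := by
      rw [inv_pow, ← hL]; field_simp; ring
    rw [this, ENNReal.ofReal_pow (by positivity), ENNReal.ofReal_inv_of_pos hK0,
      ENNReal.ofReal_natCast]
  have hdisj : Pairwise (Function.onFun Disjoint cell) := by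
    intro l l' hne
    have key : ∀ a b : ℕ, a < b → 2 * Real.pi * (((a : ℝ) + 1) / L) ≤ 2 * Real.pi * ((b : ℝ) / L) := by
      intro a b hab
      have : (a : ℝ) + 1 ≤ b := by exact_mod_cast hab
      gcongr
    rw [Function.onFun, Set.disjoint_left]
    intro t ht ht'
    rcases lt_or_gt_of_ne (fun h => hne (Fin.ext h) : (l : ℕ) ≠ l') with h | h
    · linarith [key _ _ h, ht.2, ht'.1]
    · linarith [key _ _ h, ht'.2, ht.1]
  have hsub : (⋃ l, cell l) ⊆ Set.Ioo 0 (2 * Real.pi) := by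
    intro t ht
    obtain ⟨l, hl⟩ := Set.mem_iUnion.1 ht
    refine ⟨lt_of_le_of_lt (by positivity) hl.1, lt_of_lt_of_le hl.2 ?_⟩
    have : ((l : ℕ) : ℝ) + 1 ≤ L := by
      rw [hL]; exact_mod_cast l.2
    refine mul_le_of_le_one_right (by positivity) ((div_le_one hL0).2 this)
  have hsum : (∑ l : Fin (K ^ (j + 3)), kerAbs (corner K j l) z ^ s) * (K : ℝ≥0∞)⁻¹ ^ (j + 3) ≤
      2 ^ s * (ENNReal.ofReal d)⁻¹ ^ (s - 1) := by
    rw [Finset.sum_mul]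
    calc ∑ l : Fin (K ^ (j + 3)), kerAbs (corner K j l) z ^ s * (K : ℝ≥0∞)⁻¹ ^ (j + 3)
        ≤ ∑ l : Fin (K ^ (j + 3)), ∫⁻ t in cell l,
          2 ^ s * kerAbs z (circleMap 0 (dyadicRadius K j) t) ^ s
            ∂(ENNReal.ofReal (1 / (2 * Real.pi)) • (volume : Measure ℝ)) := by
          refine Finset.sum_le_sum fun l _ => ?_
          rw [← hμ l, ← setLIntegral_const]
          exact setLIntegral_mono' measurableSet_Ioo (hpt l)
      _ = ∫⁻ t in ⋃ l, cell l, 2 ^ s * kerAbs z (circleMap 0 (dyadicRadius K j) t) ^ s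
            ∂(ENNReal.ofReal (1 / (2 * Real.pi)) • (volume : Measure ℝ)) := by
          rw [lintegral_iUnion (fun _ => measurableSet_Ioo) hdisj, tsum_fintype]
      _ ≤ ∫⁻ t, 2 ^ s * kerAbs z (circleMap 0 (dyadicRadius K j) t) ^ s ∂angleMeasure := by
          rw [angleMeasure, ← Measure.restrict_smul]
          exact lintegral_mono_set hsub
      _ ≤ _ := by
          rw [lintegral_const_mul' _ _ (ENNReal.rpow_ne_top_of_nonneg (by linarith) (by simp))]
          gcongr
          exact lintegral_kerAbs_rpow_le hr0 hd (by rwa [mul_comm]) hs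
  have hKtop : (K : ℝ≥0∞) ≠ ∞ := by simp
  have hK00 : (K : ℝ≥0∞) ≠ 0 := by
    have : K ≠ 0 := by omega
    exact_mod_cast this
  calc _ = (∑ l : Fin (K ^ (j + 3)), kerAbs (corner K j l) z ^ s) * (K : ℝ≥0∞)⁻¹ ^ (j + 3) *
        (K : ℝ≥0∞) ^ (j + 3) := by
        rw [mul_assoc, ← mul_pow, ENNReal.inv_mul_cancel hK00 hKtop, one_pow, mul_one]
    _ ≤ 2 ^ s * (ENNReal.ofReal d)⁻¹ ^ (s - 1) * (K : ℝ≥0∞) ^ (j + 3) := by gcongr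
    _ = _ := by ring

end level

/-! ### Local suprema against integral means -/

/-- A neighbourhood of `Q_{j,l}` in the disc, of comparable size. -/
def cellRegion (K j l : ℕ) : Set ℂ :=
  {w | ‖w - corner K j l‖ ≤ 3 * level K j ∧ ‖w‖ ≤ 1 - level K (j + 1) / 2}

/-- The supremum of `|f|` over the neighbourhood `cellRegion K j l` of `Q_{j,l}`. -/
def cellSup (K : ℕ) (f : ℂ → ℂ) (j l : ℕ) : ℝ≥0∞ := ⨆ w ∈ cellRegion K j l, ‖f w‖ₑ

theorem le_cellSup {K : ℕ} (f : ℂ → ℂ) {j l : ℕ} {w : ℂ} (hw : w ∈ cellRegion K j l) :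
    ‖f w‖ₑ ≤ cellSup K f j l := le_iSup₂ (f := fun w _ => ‖f w‖ₑ) w hw

theorem lpFun_count_rpow {ι : Type*} [Fintype ι] [MeasurableSpace ι] [MeasurableSingletonClass ι]
    {p : ℝ≥0∞} (hp0 : 0 < p) (hp : p ≠ ∞)
    (F : ι → ℝ≥0∞) : lpFun p Measure.count F ^ p.toReal = ∑ i, F i ^ p.toReal := by
  rw [lpFun_rpow hp0 hp, lintegral_count, tsum_fintype]

theorem circleMean_eq (p : ℝ≥0∞) (r : ℝ) (f : ℂ → ℂ) :
    circleMean p r f = lpFun p angleMeasure fun t => ‖f (circleMap 0 r t)‖ₑ := by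
  unfold circleMean lpFun angleMeasure
  simp only [lintegral_smul_measure, smul_eq_mul]

/-- For R ≥ r_{j+3} the region stays at distance at least K^{-(j+1)}/4 from the circle |z| = R, so
all its points have Poisson kernels controlled by the single kernel at the corner. -/
theorem poissonKernel_le_kerAbs_corner {K : ℕ} (hK : 2 ≤ K) {j l : ℕ} {w : ℂ}
    (hw : w ∈ cellRegion K j l) {R : ℝ} (hR : dyadicRadius K (j + 3) ≤ R) (hR1 : R < 1) (t : ℝ) :
    ENNReal.ofReal (poissonKernel 0 w (circleMap 0 R t)) ≤
      ENNReal.ofReal (2312 * K ^ 2 * level K j) * kerAbs (corner K j l) (circleMap 0 1 t) ^ (2 : ℝ) := by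
  obtain ⟨hw1, hw2⟩ := hw
  have hK2 : (2 : ℝ) ≤ K := by exact_mod_cast hK
  have hR0 : 0 ≤ R := (dyadicRadius_nonneg hK _).trans hR
  have h0 := level_pos hK j
  have h1 := level_pos hK (j + 1)
  have h2 := level_pos hK (j + 2)
  have h3 := level_pos hK (j + 3)
  have a1 := two_mul_level_succ_le hK j
  have a2 := two_mul_level_succ_le hK (j + 1)
  have a3 := two_mul_level_succ_le hK (j + 2)
  have e1 := level_succ hK j
  rw [dyadicRadius_eq] at hR
  have hu : ‖circleMap 0 1 t‖ = 1 := by simp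
  have hz : ‖circleMap 0 R t‖ = R := by simp [abs_of_nonneg hR0]
  have hdist : level K (j + 1) / 4 ≤ ‖circleMap 0 R t - w‖ := by
    have := norm_sub_norm_le (circleMap 0 R t) w
    rw [hz] at this
    linarith
  have hcn := norm_corner hK j l
  -- The triangle inequality through Re^{it} and w, with K^{-j} ≤ 4K |Re^{it} - w|, gives at most
  -- 17K. The final constant is 2312 = 8 · 17², the 8 coming from R² - |w|² ≤ 8K^{-j}.
  have hker : ‖1 - (starRingEnd ℂ) (corner K j l) * circleMap 0 1 t‖ ≤
      17 * K * ‖circleMap 0 R t - w‖ := by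
    rw [norm_one_sub_conj_mul_of_norm_eq_one _ hu]
    have e : circleMap 0 1 t - corner K j l =
        (circleMap 0 1 t - circleMap 0 R t) + (circleMap 0 R t - w) + (w - corner K j l) := by ring
    have h5 : ‖circleMap 0 1 t - circleMap 0 R t‖ = 1 - R := by
      have : circleMap 0 1 t - circleMap 0 R t = circleMap 0 (1 - R) t := by
        simp [circleMap]; ring
      rw [this, norm_circleMap_zero, abs_of_nonneg (by linarith)]
    have h6 := norm_add₃_le (a := circleMap 0 1 t - circleMap 0 R t)
      (b := circleMap 0 R t - w) (c := w - corner K j l)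
    rw [← e, h5] at h6
    have h7 : level K j ≤ 4 * K * ‖circleMap 0 R t - w‖ := by
      rw [← e1]
      nlinarith
    nlinarith [norm_nonneg (circleMap 0 R t - w)]
  have hkpos : 0 < ‖1 - (starRingEnd ℂ) (corner K j l) * circleMap 0 1 t‖ := by
    have := one_sub_mul_le_norm_one_sub_conj_mul (corner K j l) (circleMap 0 1 t)
    rw [hu, hcn] at this
    linarith
  rw [kerAbs_eq_ofReal (by rw [hu, hcn]; linarith), ENNReal.ofReal_rpow_of_nonneg (by positivity)
    (by norm_num), ← ENNReal.ofReal_mul (by positivity)]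
  refine ENNReal.ofReal_le_ofReal ?_
  rw [poissonKernel_def, Real.rpow_two, inv_pow]
  simp only [sub_zero, hz]
  have hnum : R ^ 2 - ‖w‖ ^ 2 ≤ 8 * level K j := by
    have := norm_sub_norm_le (corner K j l) w
    rw [norm_sub_rev, hcn] at this
    nlinarith [norm_nonneg w]
  have hdpos : 0 < ‖circleMap 0 R t - w‖ := by linarith
  rw [← div_eq_mul_inv, div_le_div_iff₀ (by positivity) (by positivity)]
  have hsq : ‖1 - (starRingEnd ℂ) (corner K j l) * circleMap 0 1 t‖ ^ 2 ≤
      (17 * K * ‖circleMap 0 R t - w‖) ^ 2 := by gcongr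
  calc (R ^ 2 - ‖w‖ ^ 2) * ‖1 - (starRingEnd ℂ) (corner K j l) * circleMap 0 1 t‖ ^ 2
      ≤ 8 * level K j * ‖1 - (starRingEnd ℂ) (corner K j l) * circleMap 0 1 t‖ ^ 2 := by gcongr
    _ ≤ 8 * level K j * (17 * K * ‖circleMap 0 R t - w‖) ^ 2 := by gcongr
    _ = _ := by ring

theorem mem_ball_of_mem_cellRegion {K : ℕ} (hK : 2 ≤ K) {j l : ℕ} {w : ℂ}
    (hw : w ∈ cellRegion K j l) {R : ℝ} (hR : dyadicRadius K (j + 3) ≤ R) :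
    w ∈ Metric.ball (0 : ℂ) R := by
  have h1 := level_pos hK (j + 1)
  have a2 := two_mul_level_succ_le hK (j + 1)
  have a3 := two_mul_level_succ_le hK (j + 2)
  have := hw.2
  rw [dyadicRadius_eq] at hR
  rw [mem_ball_zero_iff]
  linarith

/-- The `ℓ^p` norm of the local suprema at level `j` is controlled by the integral mean over any
circle that is closer to the boundary. -/
theorem exists_lpFun_cellSup_le {K : ℕ} (hK : 2 ≤ K) {p : ℝ≥0∞} (hp0 : 0 < p) :
    ∃ C : ℝ≥0∞, C ≠ ∞ ∧ ∀ f : ℂ → ℂ, DifferentiableOn ℂ f (Metric.ball 0 1) → ∀ j : ℕ, ∀ R : ℝ,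
      dyadicRadius K (j + 3) ≤ R → R < 1 →
      lpFun p Measure.count (fun l : Fin (K ^ (j + 3)) => cellSup K f j l) ≤
        C * ((K : ℝ≥0∞) ^ j) ^ (p⁻¹).toReal * circleMean p R f := by
  by_cases hp : p = ∞
  · subst hp
    -- For p = ∞ this is the maximum principle, read off from the Poisson inequality with exponent
    -- 1.
    refine ⟨1, by simp, fun f hf j R hR hR1 => ?_⟩
    have hR0 : 0 < R := by
      refine lt_of_lt_of_le ?_ hR
      rw [dyadicRadius_eq]
      have a1 := two_mul_level_succ_le hK (j + 2)
      linarith [level_le_one hK (j + 2), level_pos hK (j + 3)]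
    rw [circleMean_eq]
    simp only [lpFun_top, ENNReal.inv_top, ENNReal.toReal_zero, ENNReal.rpow_zero, one_mul]
    refine iSup_le fun l => iSup₂_le fun w hw => ?_
    have hwR := mem_ball_of_mem_cellRegion hK hw hR
    have h1 := enorm_rpow_le_lintegral_poissonKernel hf hR0 hR1 one_pos hwR
    simp only [ENNReal.rpow_one] at h1
    refine h1.trans ?_
    calc _ ≤ ∫⁻ t, ENNReal.ofReal (poissonKernel 0 w (circleMap 0 R t)) *
          (⨆ t, ‖f (circleMap 0 R t)‖ₑ) ∂angleMeasure :=
          lintegral_mono fun t => mul_le_mul_right (le_iSup (fun t => ‖f (circleMap 0 R t)‖ₑ) t) _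
      _ = _ := by
          rw [lintegral_mul_const'' , lintegral_poissonKernel hR0 hwR, one_mul]
          refine Continuous.aemeasurable (ENNReal.continuous_ofReal.comp ?_)
          exact (continuousOn_poissonKernel_sphere hwR).comp_continuous (continuous_circleMap 0 R)
            fun t => circleMap_mem_sphere 0 hR0.le t
  · have hpp := ENNReal.toReal_pos hp0.ne' hp
    have hip : (p⁻¹).toReal = 1 / p.toReal := by simp [ENNReal.toReal_inv]
    set C : ℝ≥0∞ := ENNReal.ofReal (2312 * K ^ 2) * (2 ^ (2 : ℝ) * (K : ℝ≥0∞) ^ 3) with hC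
    have hCtop : C ≠ ∞ := by
      rw [hC]
      refine ENNReal.mul_ne_top ENNReal.ofReal_ne_top (ENNReal.mul_ne_top ?_ ?_)
      · exact ENNReal.rpow_ne_top_of_nonneg (by norm_num) (by simp)
      · exact ENNReal.pow_ne_top (by simp)
    refine ⟨C ^ (p⁻¹).toReal, ENNReal.rpow_ne_top_of_nonneg (by positivity) hCtop,
      fun f hf j R hR hR1 => ?_⟩
    have hR0 : 0 < R := by
      refine lt_of_lt_of_le ?_ hR
      rw [dyadicRadius_eq]
      have a1 := two_mul_level_succ_le hK (j + 2)
      linarith [level_le_one hK (j + 2), level_pos hK (j + 3)]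
    have hmem : ∀ t, circleMap 0 R t ∈ Metric.ball (0 : ℂ) 1 := fun t => by
      simpa [abs_of_pos hR0] using hR1
    have hmeas : Measurable fun t => ‖f (circleMap 0 R t)‖ₑ ^ p.toReal :=
      ((hf.continuousOn.comp_continuous (continuous_circleMap 0 R) hmem).enorm.measurable).pow_const _
    have hcell : ∀ l : Fin (K ^ (j + 3)), cellSup K f j l ^ p.toReal ≤
        ∫⁻ t, ENNReal.ofReal (2312 * K ^ 2 * level K j) *
          (kerAbs (corner K j l) (circleMap 0 1 t) ^ (2 : ℝ) *
          ‖f (circleMap 0 R t)‖ₑ ^ p.toReal) ∂angleMeasure := by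
      intro l
      rw [← ENNReal.le_rpow_inv_iff hpp]
      refine iSup₂_le fun w hw => ?_
      rw [ENNReal.le_rpow_inv_iff hpp]
      refine (enorm_rpow_le_lintegral_poissonKernel hf hR0 hR1 hpp
        (mem_ball_of_mem_cellRegion hK hw hR)).trans (lintegral_mono fun t => ?_)
      rw [← mul_assoc]
      gcongr
      exact poissonKernel_le_kerAbs_corner hK hw hR hR1 t
    -- The sum is of order K^{2j}; the factor K^{-j} in the Poisson bound leaves K^j, and the p-th
    -- root turns it into the K^{j/p} of the conclusion.
    have hsum : ∀ t, ∑ l : Fin (K ^ (j + 3)), kerAbs (corner K j l) (circleMap 0 1 t) ^ (2 : ℝ) ≤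
        2 ^ (2 : ℝ) * (K : ℝ≥0∞) ^ (j + 3) * (ENNReal.ofReal (level K j))⁻¹ := by
      intro t
      have := sum_kerAbs_corner_rpow_le hK j (z := circleMap 0 1 t) (by simp) (d := level K j) (s := 2)
        (level_pos hK j) (by simp [dyadicRadius_eq]) le_rfl
      norm_num at this ⊢
      exact this
    have hmain : lpFun p Measure.count (fun l : Fin (K ^ (j + 3)) => cellSup K f j l) ^ p.toReal ≤
        C * (K : ℝ≥0∞) ^ j * circleMean p R f ^ p.toReal := by
      rw [lpFun_count_rpow hp0 hp, circleMean_eq, lpFun_rpow hp0 hp]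
      calc _ ≤ ∑ l : Fin (K ^ (j + 3)), ∫⁻ t, ENNReal.ofReal (2312 * K ^ 2 * level K j) *
            (kerAbs (corner K j l) (circleMap 0 1 t) ^ (2 : ℝ) *
            ‖f (circleMap 0 R t)‖ₑ ^ p.toReal) ∂angleMeasure := Finset.sum_le_sum fun l _ => hcell l
        _ = ∫⁻ t, ENNReal.ofReal (2312 * K ^ 2 * level K j) *
            ((∑ l : Fin (K ^ (j + 3)), kerAbs (corner K j l) (circleMap 0 1 t) ^ (2 : ℝ)) *
            ‖f (circleMap 0 R t)‖ₑ ^ p.toReal) ∂angleMeasure := by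
            rw [← lintegral_finsetSum]
            · simp_rw [Finset.sum_mul, Finset.mul_sum]
            · intro l _
              exact (((measurable_kerAbs_circleMap _ _).pow_const _).mul hmeas).const_mul _
        _ ≤ ∫⁻ t, ENNReal.ofReal (2312 * K ^ 2 * level K j) *
            ((2 ^ (2 : ℝ) * (K : ℝ≥0∞) ^ (j + 3) * (ENNReal.ofReal (level K j))⁻¹) *
            ‖f (circleMap 0 R t)‖ₑ ^ p.toReal) ∂angleMeasure := by
            refine lintegral_mono fun t => ?_
            gcongr
            exact hsum t
        _ = C * (K : ℝ≥0∞) ^ j * ∫⁻ t, ‖f (circleMap 0 R t)‖ₑ ^ p.toReal ∂angleMeasure := by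
            rw [lintegral_const_mul _ (hmeas.const_mul _), lintegral_const_mul _ hmeas, ← mul_assoc]
            congr 1
            have hl0 : ENNReal.ofReal (level K j) ≠ 0 := by simpa using level_pos hK j
            rw [hC, ENNReal.ofReal_mul (by positivity), pow_add]
            calc _ = ENNReal.ofReal (2312 * K ^ 2) * (2 ^ (2 : ℝ) * (K : ℝ≥0∞) ^ 3) * (K : ℝ≥0∞) ^ j *
                  (ENNReal.ofReal (level K j) * (ENNReal.ofReal (level K j))⁻¹) := by ring
              _ = _ := by rw [ENNReal.mul_inv_cancel hl0 ENNReal.ofReal_ne_top, mul_one]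
    have h4 : ∀ x : ℝ≥0∞, x = (x ^ p.toReal) ^ (p⁻¹).toReal := by
      intro x
      rw [hip, ← ENNReal.rpow_mul, mul_one_div_cancel hpp.ne', ENNReal.rpow_one]
    rw [h4 (lpFun _ _ _), h4 (circleMean p R f), ← ENNReal.mul_rpow_of_nonneg _ _ (by positivity),
      ← ENNReal.mul_rpow_of_nonneg _ _ (by positivity)]
    gcongr

/-! ### Doubling weights along the radii r_j -/

theorem omegaHat_anti (ω : ℝ → ℝ) {r s : ℝ} (h : r ≤ s) : omegaHat ω s ≤ omegaHat ω r :=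
  lintegral_mono_set (Set.Ioo_subset_Ioo_left h)

/-- In polar coordinates planar integrability only controls rω(r), which is equivalent to ω(r) away
from the origin. -/
theorem IsRadialWeight.omegaHat_half_ne_top {ω : ℝ → ℝ} (hω : IsRadialWeight ω) :
    omegaHat ω (1 / 2) ≠ ∞ := by
  have h1 := hω.integrableOn
  rw [← integrable_indicator_iff Metric.isOpen_ball.measurableSet] at h1
  have e : (Metric.ball (0 : ℂ) 1).indicator (fun z : ℂ => ω ‖z‖) =
      fun z : ℂ => (Set.Iio (1 : ℝ)).indicator ω ‖z‖ := by
    ext z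
    by_cases hz : ‖z‖ < 1 <;> simp [Set.indicator, hz]
  rw [e, integrable_fun_norm_addHaar volume (E := ℂ)] at h1
  have h2 : IntegrableOn (fun y : ℝ => y * ω y) (Set.Ioo (1 / 2) 1) := by
    have h3 := h1.mono_set (t := Set.Ioi (0 : ℝ)) (s := Set.Ioo (1 / 2) 1)
      fun y hy => lt_trans (by norm_num) hy.1
    refine h3.congr_fun (fun y hy => ?_) measurableSet_Ioo
    simp [Complex.finrank_real_complex, Set.indicator, hy.2]
  have h4 := h2.lintegral_lt_top
  have h5 : omegaHat ω (1 / 2) ≤ 2 * ∫⁻ y in Set.Ioo (1 / 2 : ℝ) 1, ENNReal.ofReal (y * ω y) := by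
    rw [omegaHat, ← lintegral_const_mul' _ _ (by simp)]
    refine setLIntegral_mono' measurableSet_Ioo fun y hy => ?_
    have h2 : (2 : ℝ≥0∞) = ENNReal.ofReal 2 := by simp
    have h0 := hω.nonneg y ⟨by linarith [hy.1], hy.2⟩
    rw [h2, ← ENNReal.ofReal_mul (by norm_num)]
    refine ENNReal.ofReal_le_ofReal ?_
    nlinarith [hy.1]
  exact (h5.trans_lt (ENNReal.mul_lt_top (by simp) h4)).ne

/-- Upper doubling at r = 0 compares ω̂(0) with ω̂(1/2), excluding a non-integrable singularity of ω
at the origin. -/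
theorem IsRadialWeight.omegaHat_zero_ne_top {ω : ℝ → ℝ} (hω : IsRadialWeight ω)
    (hU : UpperDoubling ω) : omegaHat ω 0 ≠ ∞ := by
  obtain ⟨C, -, h⟩ := hU
  have := h 0 (by simp)
  rw [add_zero] at this
  exact (this.trans_lt (ENNReal.mul_lt_top ENNReal.ofReal_lt_top
    (lt_top_iff_ne_top.2 hω.omegaHat_half_ne_top))).ne

/-- The values `ω̂(r_j)`. -/
def weightAt (ω : ℝ → ℝ) (K j : ℕ) : ℝ≥0∞ := omegaHat ω (dyadicRadius K j)

/-- The mass of `ω` on `(r_j, r_{j+1}]`. -/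
def blockMass (ω : ℝ → ℝ) (K j : ℕ) : ℝ≥0∞ :=
  ∫⁻ s in Set.Ioc (dyadicRadius K j) (dyadicRadius K (j + 1)), ENNReal.ofReal (ω s)

/-- Passing from r_j to r_{j+1} takes about log₂ K halvings, each costing a factor at most 2^b. The
exponent B does not depend on K, which allows M to be fixed before K. -/
theorem UpperDoubling.exists_weightAt_le {ω : ℝ → ℝ} (hU : UpperDoubling ω) :
    ∃ B : ℕ, ∀ K : ℕ, 2 ≤ K → ∀ j, weightAt ω K j ≤ (K : ℝ≥0∞) ^ B * weightAt ω K (j + 1) := by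
  obtain ⟨C, hC1, h⟩ := hU
  obtain ⟨b, hb⟩ := pow_unbounded_of_one_lt C (one_lt_two)
  refine ⟨b * 2, fun K hK j => ?_⟩
  have hiter : ∀ n : ℕ, ∀ δ : ℝ, 0 < δ → δ ≤ 1 →
      omegaHat ω (1 - δ) ≤ ((2 : ℝ≥0∞) ^ n) ^ b * omegaHat ω (1 - δ / 2 ^ n) := by
    intro n
    induction n with
    | zero => intro δ _ _; simp
    | succ n ih =>
      intro δ h0 h1
      have hδ : δ / 2 ^ n ≤ 1 := (div_le_self h0.le (one_le_pow₀ one_le_two)).trans h1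
      have h2 := h (1 - δ / 2 ^ n) ⟨by linarith, by have : 0 < δ / 2 ^ n := by positivity
                                                    linarith⟩
      have e : (1 + (1 - δ / 2 ^ n)) / 2 = 1 - δ / 2 ^ (n + 1) := by
        rw [pow_succ]; field_simp; ring
      rw [e] at h2
      have hC2 : ENNReal.ofReal C ≤ 2 ^ b := by
        calc ENNReal.ofReal C ≤ ENNReal.ofReal (2 ^ b) := ENNReal.ofReal_le_ofReal hb.le
          _ = 2 ^ b := by rw [ENNReal.ofReal_pow (by norm_num)]; simp
      calc _ ≤ ((2 : ℝ≥0∞) ^ n) ^ b * (ENNReal.ofReal C * omegaHat ω (1 - δ / 2 ^ (n + 1))) :=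
            (ih δ h0 h1).trans (by gcongr)
        _ ≤ ((2 : ℝ≥0∞) ^ n) ^ b * (2 ^ b * omegaHat ω (1 - δ / 2 ^ (n + 1))) := by gcongr
        _ = _ := by rw [pow_succ (2 : ℝ≥0∞) n, mul_pow]; ring
  have hK0 : (0 : ℝ) < K := by exact_mod_cast (by omega : 0 < K)
  have hKn : K ≤ 2 ^ Nat.clog 2 K := Nat.le_pow_clog one_lt_two K
  -- Rounding log₂ K up costs at most a factor 2 ≤ K; hence B = 2b.
  have hKn2 : 2 ^ Nat.clog 2 K ≤ K ^ 2 := by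
    have := Nat.pow_pred_clog_lt_self one_lt_two (x := K) (by omega)
    have hpos : Nat.clog 2 K ≠ 0 := (Nat.clog_pos one_lt_two hK).ne'
    obtain ⟨m, hm⟩ := Nat.exists_eq_succ_of_ne_zero hpos
    rw [hm] at this ⊢
    simp only [Nat.succ_eq_add_one, Nat.pred_succ] at this ⊢
    rw [pow_succ]
    nlinarith
  have h3 := hiter (Nat.clog 2 K) (level K j) (level_pos hK j) (level_le_one hK j)
  have h4 : omegaHat ω (1 - level K j / 2 ^ Nat.clog 2 K) ≤ weightAt ω K (j + 1) := by
    refine omegaHat_anti ω ?_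
    rw [dyadicRadius_eq, ← level_succ hK j]
    have h5 : (K : ℝ) ≤ 2 ^ Nat.clog 2 K := by exact_mod_cast hKn
    have h6 : (K : ℝ) * level K (j + 1) / 2 ^ Nat.clog 2 K ≤ level K (j + 1) := by
      rw [div_le_iff₀ (by positivity), mul_comm]
      have := level_pos hK (j + 1)
      gcongr
    linarith
  calc weightAt ω K j ≤ _ := h3
    _ ≤ ((K : ℝ≥0∞) ^ 2) ^ b * weightAt ω K (j + 1) := by
      refine mul_le_mul' (pow_le_pow_left' ?_ b) h4
      exact_mod_cast hKn2
    _ = _ := by rw [← pow_mul, mul_comm 2 b]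

section

variable {ω : ℝ → ℝ} {K B : ℕ}

theorem weightAt_le_pow_mul (hB : ∀ j, weightAt ω K j ≤ (K : ℝ≥0∞) ^ B * weightAt ω K (j + 1))
    (j m : ℕ) : weightAt ω K j ≤ ((K : ℝ≥0∞) ^ m) ^ B * weightAt ω K (j + m) := by
  induction m with
  | zero => simp
  | succ m ih =>
    calc _ ≤ ((K : ℝ≥0∞) ^ m) ^ B * ((K : ℝ≥0∞) ^ B * weightAt ω K (j + m + 1)) :=
          ih.trans (by gcongr; exact hB _)
      _ = _ := by rw [pow_succ, mul_pow, add_assoc]; ring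

theorem weightAt_zero : weightAt ω K 0 = omegaHat ω 0 := by
  simp [weightAt, dyadicRadius]

theorem weightAt_ne_zero (hB : ∀ j, weightAt ω K j ≤ (K : ℝ≥0∞) ^ B * weightAt ω K (j + 1))
    (h0 : omegaHat ω 0 ≠ 0) (j : ℕ) : weightAt ω K j ≠ 0 := by
  intro h
  have := weightAt_le_pow_mul hB 0 j
  rw [zero_add, h, mul_zero, weightAt_zero] at this
  exact h0 (le_antisymm this zero_le)

theorem weightAt_ne_top (hK : 2 ≤ K) (h0 : omegaHat ω 0 ≠ ∞) (j : ℕ) : weightAt ω K j ≠ ∞ :=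
  ((omegaHat_anti ω (dyadicRadius_nonneg hK j)).trans_lt (lt_top_iff_ne_top.2 h0)).ne

/-- The map r ↦ 1 - (1 - r)/K sends r_j to r_{j+1}, so the condition (K) is exactly a one-step gain
along the radii of this partition. -/
theorem LowerDoublingWith.exists_mul_weightAt_le (hK : 2 ≤ K) (hL : LowerDoublingWith ω K) :
    ∃ c : ℝ≥0∞, 1 < c ∧ c ≠ ∞ ∧ ∀ j m, c ^ m * weightAt ω K (j + m) ≤ weightAt ω K j := by
  obtain ⟨C, hC1, h⟩ := hL
  refine ⟨ENNReal.ofReal C, by simpa using hC1, ENNReal.ofReal_ne_top, fun j m => ?_⟩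
  have hs : ∀ j, ENNReal.ofReal C * weightAt ω K (j + 1) ≤ weightAt ω K j := by
    intro j
    have hK0 : (0 : ℝ) < K := by exact_mod_cast (by omega : 0 < K)
    have := h (dyadicRadius K j) ⟨dyadicRadius_nonneg hK j, dyadicRadius_lt_one hK j⟩
    have e : 1 - (1 - dyadicRadius K j) / K = dyadicRadius K (j + 1) := by
      rw [dyadicRadius_eq, dyadicRadius_eq, ← level_succ hK j]
      field_simp
      ring
    rwa [e] at this
  induction m with
  | zero => simp
  | succ m ih =>
    refine le_trans ?_ ih
    rw [pow_succ, mul_assoc, ← add_assoc]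
    gcongr
    exact hs _

theorem weightAt_eq_add (hK : 2 ≤ K) (j : ℕ) :
    weightAt ω K j = blockMass ω K j + weightAt ω K (j + 1) := by
  rw [weightAt, weightAt, omegaHat, omegaHat, blockMass, ← lintegral_union measurableSet_Ioo]
  · rw [Set.Ioc_union_Ioo_eq_Ioo (dyadicRadius_mono hK (Nat.le_succ j))
      (dyadicRadius_lt_one hK (j + 1))]
  · rw [Set.disjoint_left]
    intro x hx hx'
    exact absurd hx.2 (not_le.2 hx'.1)

theorem blockMass_le (hK : 2 ≤ K) (j : ℕ) : blockMass ω K j ≤ weightAt ω K j := by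
  rw [weightAt_eq_add hK]; exact le_self_add

/-- Subtracting ω̂(r_{j+1}) from c ω̂(r_{j+1}) ≤ ω̂(r_j) leaves (c - 1) ω̂(r_{j+1}) bounded by the
mass of the block: a fixed proportion of the tail sits in its first block. -/
theorem LowerDoublingWith.exists_weightAt_le_blockMass (hK : 2 ≤ K) (hL : LowerDoublingWith ω K)
    (h0 : omegaHat ω 0 ≠ ∞) :
    ∃ C : ℝ≥0∞, C ≠ ∞ ∧ ∀ j, weightAt ω K j ≤ C * blockMass ω K j := by
  obtain ⟨c, hc1, hc, h⟩ := hL.exists_mul_weightAt_le hK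
  have hc0 : c - 1 ≠ 0 := (tsub_pos_of_lt hc1).ne'
  have hct : c - 1 ≠ ∞ := ENNReal.sub_ne_top hc
  refine ⟨1 + (c - 1)⁻¹, by simp [hc0], fun j => ?_⟩
  have h1 := h j 1
  rw [pow_one, weightAt_eq_add hK j] at h1
  have h2 : (c - 1) * weightAt ω K (j + 1) ≤ blockMass ω K j := by
    rw [ENNReal.sub_mul (fun _ _ => weightAt_ne_top hK h0 _), one_mul]
    exact tsub_le_iff_right.2 h1
  have h3 : weightAt ω K (j + 1) ≤ (c - 1)⁻¹ * blockMass ω K j := by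
    calc weightAt ω K (j + 1) = (c - 1)⁻¹ * ((c - 1) * weightAt ω K (j + 1)) := by
          rw [← mul_assoc, ENNReal.inv_mul_cancel hc0 hct, one_mul]
      _ ≤ _ := by gcongr
  rw [weightAt_eq_add hK, add_mul, one_mul]
  gcongr

theorem tendsto_dyadicRadius (hK : 2 ≤ K) :
    Filter.Tendsto (dyadicRadius K) Filter.atTop (nhds 1) := by
  have : Filter.Tendsto (fun j => 1 - ((K : ℝ)⁻¹) ^ j) Filter.atTop (nhds (1 - 0)) := by
    refine Filter.Tendsto.const_sub 1 (tendsto_pow_atTop_nhds_zero_of_lt_one (by positivity) ?_)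
    exact inv_lt_one_of_one_lt₀ (by exact_mod_cast hK)
  simpa [dyadicRadius, inv_pow, sub_zero, Function.comp_def] using! this

theorem iUnion_Ioc_dyadicRadius (hK : 2 ≤ K) :
    ⋃ j, Set.Ioc (dyadicRadius K j) (dyadicRadius K (j + 1)) = Set.Ioo 0 1 := by
  ext s
  simp only [Set.mem_iUnion, Set.mem_Ioc, Set.mem_Ioo]
  constructor
  · rintro ⟨j, h1, h2⟩
    exact ⟨(dyadicRadius_nonneg hK j).trans_lt h1, h2.trans_lt (dyadicRadius_lt_one hK _)⟩
  · rintro ⟨h0, h1⟩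
    have hex : ∃ j, s ≤ dyadicRadius K j :=
      (((tendsto_dyadicRadius hK).eventually (lt_mem_nhds h1)).exists).imp fun _ h => h.le
    classical
    have hne : Nat.find hex ≠ 0 := by
      intro h
      have := Nat.find_spec hex
      rw [h] at this
      simp [dyadicRadius] at this
      linarith
    obtain ⟨m, hm⟩ := Nat.exists_eq_succ_of_ne_zero hne
    refine ⟨m, not_le.1 (Nat.find_min hex (by omega)), ?_⟩
    have := Nat.find_spec hex
    rwa [hm] at this

theorem lintegral_Ioo_eq_tsum (hK : 2 ≤ K) (F : ℝ → ℝ≥0∞) :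
    ∫⁻ r in Set.Ioo (0 : ℝ) 1, F r =
      ∑' j, ∫⁻ r in Set.Ioc (dyadicRadius K j) (dyadicRadius K (j + 1)), F r := by
  rw [← iUnion_Ioc_dyadicRadius hK, lintegral_iUnion (fun _ => measurableSet_Ioc)]
  exact Monotone.pairwise_disjoint_on_Ioc_succ fun _ _ h => dyadicRadius_mono hK h

end

/-! ### The synthesis estimate -/

theorem natCast_ennreal_ne_zero {K : ℕ} (hK : 2 ≤ K) : (K : ℝ≥0∞) ≠ 0 := by
  have : K ≠ 0 := by omega
  exact_mod_cast this

theorem ofReal_level {K : ℕ} (hK : 2 ≤ K) (j : ℕ) :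
    ENNReal.ofReal (level K j) = ((K : ℝ≥0∞) ^ j)⁻¹ := by
  have hK0 : (0 : ℝ) < K := by exact_mod_cast (by omega : 0 < K)
  rw [level, ENNReal.ofReal_inv_of_pos (by positivity), ENNReal.ofReal_pow hK0.le,
    ENNReal.ofReal_natCast]

theorem ofReal_level_inv {K : ℕ} (hK : 2 ≤ K) (j : ℕ) :
    (ENNReal.ofReal (level K j))⁻¹ = (K : ℝ≥0∞) ^ j := by
  rw [ofReal_level hK, inv_inv]

/-- The absolute kernel sum `∑_l a_l |1 - conj ξ_{j,l} z|^{-2n}` over one level. -/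
def levelSum (K n j : ℕ) (a : Fin (K ^ (j + 3)) → ℝ≥0∞) (z : ℂ) : ℝ≥0∞ :=
  ∑ l, a l * kerAbs (corner K j l) z ^ (2 * n)

/-- The majorant of the sum of atoms of exponent `2n` with coefficients bounded by `a`. -/
def coarseSum (p : ℝ≥0∞) (q : ℝ) (ω : ℝ → ℝ) (K n : ℕ) (a : ∀ j, Fin (K ^ (j + 3)) → ℝ≥0∞)
    (z : ℂ) : ℝ≥0∞ :=
  ∑' j, (((K : ℝ≥0∞) ^ j)⁻¹ ^ (2 * (n : ℝ) - (p⁻¹).toReal) * weightAt ω K j ^ (-(1 / q))) *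
    levelSum K n j (a j) z

/-- The `ℓ^{p,q}` norm of a family indexed by the rectangles `Q_{j,l}`. -/
def coarseNorm (p : ℝ≥0∞) (q : ℝ) {K : ℕ} (a : ∀ j, Fin (K ^ (j + 3)) → ℝ≥0∞) : ℝ≥0∞ :=
  (∑' j, lpFun p Measure.count (a j) ^ q) ^ (1 / q)

theorem measurable_levelSum {K n j : ℕ} (a : Fin (K ^ (j + 3)) → ℝ≥0∞) (r : ℝ) :
    Measurable fun t => levelSum K n j a (circleMap 0 r t) := by
  unfold levelSum
  exact Finset.measurable_sum _ fun l _ => ((measurable_kerAbs_circleMap _ _).pow_const _).const_mul _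

/-- The power 2n is split as n + n. For finite p, one half is summed over l, which frees the
coefficients from the p-th power for every p > 0, and the other half is integrated over the circle;
these use n ≥ 2 and np ≥ 2 respectively. For p = ∞ the kernel sum alone suffices. -/
theorem lpFun_levelSum_le {K : ℕ} (hK : 2 ≤ K) {p : ℝ≥0∞} (hp0 : 0 < p) {n : ℕ} (hn : 2 ≤ n)
    (hnp : p ≠ ∞ → 2 ≤ n * p.toReal) {j i : ℕ} {r : ℝ} (hr0 : 0 ≤ r) (hr1 : r ≤ 1)
    (hi : level K i ≤ 1 - dyadicRadius K j * r) (a : Fin (K ^ (j + 3)) → ℝ≥0∞) :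
    lpFun p angleMeasure (fun t => levelSum K n j a (circleMap 0 r t)) ≤
      2 ^ (2 * n) * (K : ℝ≥0∞) ^ (j + 3) *
        ((K : ℝ≥0∞) ^ i) ^ (2 * (n : ℝ) - 1 - (p⁻¹).toReal) * lpFun p Measure.count a := by
  have hn' : (2 : ℝ) ≤ n := by exact_mod_cast hn
  have hnorm : ∀ t, ‖circleMap 0 r t‖ = r := fun t => by simp [abs_of_nonneg hr0]
  have hE : ∀ m : ℕ, 2 ≤ m → ∀ t, ∑ l : Fin (K ^ (j + 3)), kerAbs (corner K j l) (circleMap 0 r t) ^ m ≤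
      2 ^ m * (K : ℝ≥0∞) ^ (j + 3) * ((K : ℝ≥0∞) ^ i) ^ ((m : ℝ) - 1) := by
    intro m hm t
    have := sum_kerAbs_corner_rpow_le hK j (z := circleMap 0 r t) (by rwa [hnorm])
      (level_pos hK i) (by rwa [hnorm]) (s := m) (by exact_mod_cast hm)
    simpa only [ofReal_level_inv hK, ENNReal.rpow_natCast] using this
  by_cases hp : p = ∞
  · subst hp
    simp only [lpFun_top, ENNReal.inv_top, ENNReal.toReal_zero, sub_zero]
    refine iSup_le fun t => ?_
    calc levelSum K n j a (circleMap 0 r t)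
        ≤ ∑ l : Fin (K ^ (j + 3)), (⨆ l, a l) * kerAbs (corner K j l) (circleMap 0 r t) ^ (2 * n) := by
          refine Finset.sum_le_sum fun l _ => ?_
          gcongr
          exact le_iSup a l
      _ ≤ (⨆ l, a l) * (2 ^ (2 * n) * (K : ℝ≥0∞) ^ (j + 3) *
          ((K : ℝ≥0∞) ^ i) ^ (((2 * n : ℕ) : ℝ) - 1)) := by
          rw [← Finset.mul_sum]
          gcongr
          exact hE _ (by omega) t
      _ = _ := by push_cast; ring
  · have hpp := ENNReal.toReal_pos hp0.ne' hp
    have hip : (p⁻¹).toReal = 1 / p.toReal := by simp [ENNReal.toReal_inv]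
    have hnp := hnp hp
    set P := p.toReal with hP
    have hpt : ∀ t, levelSum K n j a (circleMap 0 r t) ^ P ≤
        (2 ^ n * (K : ℝ≥0∞) ^ (j + 3) * ((K : ℝ≥0∞) ^ i) ^ ((n : ℝ) - 1)) ^ P *
        ∑ l, a l ^ P * kerAbs (corner K j l) (circleMap 0 r t) ^ (n * P) := by
      intro t
      have h1 := ENNReal.sum_mul_rpow_le (fun l : Fin (K ^ (j + 3)) => kerAbs (corner K j l) (circleMap 0 r t) ^ n)
        (fun l => a l * kerAbs (corner K j l) (circleMap 0 r t) ^ n) hpp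
      have e : levelSum K n j a (circleMap 0 r t) =
          ∑ l : Fin (K ^ (j + 3)), kerAbs (corner K j l) (circleMap 0 r t) ^ n *
            (a l * kerAbs (corner K j l) (circleMap 0 r t) ^ n) := by
        unfold levelSum
        refine Finset.sum_congr rfl fun l _ => ?_
        ring
      rw [e]
      refine h1.trans ?_
      gcongr ?_ ^ P * ?_
      · exact hE n hn t
      · refine le_of_eq (Finset.sum_congr rfl fun l _ => ?_)
        rw [ENNReal.mul_rpow_of_nonneg _ _ hpp.le, ENNReal.rpow_mul, ENNReal.rpow_natCast]
    have hint : ∫⁻ t, ∑ l, a l ^ P * kerAbs (corner K j l) (circleMap 0 r t) ^ (n * P)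
        ∂angleMeasure ≤ ((K : ℝ≥0∞) ^ i) ^ (n * P - 1) * ∑ l, a l ^ P := by
      rw [lintegral_finsetSum]
      · rw [Finset.mul_sum]
        refine Finset.sum_le_sum fun l _ => ?_
        rw [lintegral_const_mul _ ((measurable_kerAbs_circleMap _ _).pow_const _), mul_comm]
        gcongr
        rw [← ofReal_level_inv hK]
        refine lintegral_kerAbs_rpow_le hr0 (level_pos hK i) ?_ hnp
        rwa [norm_corner hK, ← dyadicRadius_eq]
      · exact fun l _ => ((measurable_kerAbs_circleMap _ _).pow_const _).const_mul _
    have hmain : lpFun p angleMeasure (fun t => levelSum K n j a (circleMap 0 r t)) ^ P ≤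
        (2 ^ n * (K : ℝ≥0∞) ^ (j + 3) * ((K : ℝ≥0∞) ^ i) ^ ((n : ℝ) - 1)) ^ P *
        (((K : ℝ≥0∞) ^ i) ^ (n * P - 1) * lpFun p Measure.count a ^ P) := by
      rw [lpFun_rpow hp0 hp, lpFun_count_rpow hp0 hp]
      refine (lintegral_mono hpt).trans ?_
      rw [lintegral_const_mul]
      · gcongr
      · exact Finset.measurable_sum _ fun l _ =>
          ((measurable_kerAbs_circleMap _ _).pow_const _).const_mul _
    have hk0 : (K : ℝ≥0∞) ^ i ≠ 0 := pow_ne_zero _ (natCast_ennreal_ne_zero hK)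
    have hkt : (K : ℝ≥0∞) ^ i ≠ ∞ := ENNReal.pow_ne_top (by simp)
    have e2 : ((K : ℝ≥0∞) ^ i) ^ (n * P - 1) = (((K : ℝ≥0∞) ^ i) ^ ((n : ℝ) - (p⁻¹).toReal)) ^ P := by
      rw [← ENNReal.rpow_mul, hip]
      congr 1
      field_simp
    rw [e2, ← ENNReal.mul_rpow_of_nonneg _ _ hpp.le, ← ENNReal.mul_rpow_of_nonneg _ _ hpp.le,
      ENNReal.rpow_le_rpow_iff hpp] at hmain
    refine hmain.trans ?_
    have e3 : ((K : ℝ≥0∞) ^ i) ^ (2 * (n : ℝ) - 1 - (p⁻¹).toReal) =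
        ((K : ℝ≥0∞) ^ i) ^ ((n : ℝ) - 1) * ((K : ℝ≥0∞) ^ i) ^ ((n : ℝ) - (p⁻¹).toReal) := by
      rw [← ENNReal.rpow_add _ _ hk0 hkt]
      congr 1; ring
    rw [e3]
    calc _ = 2 ^ n * ((K : ℝ≥0∞) ^ (j + 3) * ((K : ℝ≥0∞) ^ i) ^ ((n : ℝ) - 1) *
          (((K : ℝ≥0∞) ^ i) ^ ((n : ℝ) - (p⁻¹).toReal) * lpFun p Measure.count a)) := by ring
      _ ≤ 2 ^ (2 * n) * ((K : ℝ≥0∞) ^ (j + 3) * ((K : ℝ≥0∞) ^ i) ^ ((n : ℝ) - 1) *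
          (((K : ℝ≥0∞) ^ i) ^ ((n : ℝ) - (p⁻¹).toReal) * lpFun p Measure.count a)) := by
          gcongr
          · exact one_le_two
          · omega
      _ = _ := by ring

/-- With i = min(j, m) + 1 the powers of K cancel except for K^{-τ(j-m)_+}. For j ≤ m the kernel
gives no decay; there it must come from the weight. -/
theorem lpFun_coarseTerm_le {K : ℕ} (hK : 2 ≤ K) {p : ℝ≥0∞} (hp0 : 0 < p) {n : ℕ} (hn : 2 ≤ n)
    (hnp : p ≠ ∞ → 2 ≤ n * p.toReal) (hτ : 0 < 2 * (n : ℝ) - 1 - (p⁻¹).toReal) {w : ℝ≥0∞}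
    (hw : w ≠ ∞) {j m : ℕ} {r : ℝ} (hr0 : 0 ≤ r) (hr1 : r ≤ dyadicRadius K (m + 1))
    (a : Fin (K ^ (j + 3)) → ℝ≥0∞) :
    lpFun p angleMeasure (fun t => (((K : ℝ≥0∞) ^ j)⁻¹ ^ (2 * (n : ℝ) - (p⁻¹).toReal) * w) *
        levelSum K n j a (circleMap 0 r t)) ≤
      2 ^ (2 * n) * (K : ℝ≥0∞) ^ 3 * (K : ℝ≥0∞) ^ (2 * (n : ℝ) - 1 - (p⁻¹).toReal) * w *
        ((K : ℝ≥0∞) ^ (j - m))⁻¹ ^ (2 * (n : ℝ) - 1 - (p⁻¹).toReal) * lpFun p Measure.count a := by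
  have hk0 := natCast_ennreal_ne_zero hK
  have hkt : (K : ℝ≥0∞) ≠ ∞ := by simp
  set k := (K : ℝ≥0∞) with hk
  have hpow0 : ∀ i, k ^ i ≠ 0 := fun i => pow_ne_zero _ hk0
  have hpowt : ∀ i, k ^ i ≠ ∞ := fun i => ENNReal.pow_ne_top hkt
  set τ := 2 * (n : ℝ) - 1 - (p⁻¹).toReal with hτdef
  have e1 : 2 * (n : ℝ) - (p⁻¹).toReal = τ + 1 := by rw [hτdef]; ring
  have hfin : (k ^ j)⁻¹ ^ (2 * (n : ℝ) - (p⁻¹).toReal) ≠ ∞ :=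
    ENNReal.rpow_ne_top_of_nonneg (by linarith) (ENNReal.inv_ne_top.2 (hpow0 j))
  rw [lpFun_const_mul hp0 _ (ENNReal.mul_ne_top hfin hw)]
  -- The + 1 is needed for m ≤ j, where r can reach r_{m+1}; for j ≤ m it is only slack.
  have hlev : level K (min j m + 1) ≤ 1 - dyadicRadius K j * r := by
    have h1 := dyadicRadius_lt_one hK (m + 1)
    have h2 := dyadicRadius_nonneg hK j
    have h3 := dyadicRadius_lt_one hK j
    rcases le_total j m with h | h
    · rw [min_eq_left h]
      have := level_anti hK (Nat.le_succ j)
      rw [dyadicRadius_eq] at h2 h3 ⊢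
      nlinarith
    · rw [min_eq_right h]
      rw [dyadicRadius_eq] at hr1
      nlinarith
  have hmain := lpFun_levelSum_le hK hp0 hn hnp hr0 (hr1.trans (dyadicRadius_lt_one hK _).le) hlev a
  refine (mul_le_mul_right hmain _).trans (le_of_eq ?_)
  rw [← hτdef, ← hk]
  have e2 : (k ^ j)⁻¹ ^ (2 * (n : ℝ) - (p⁻¹).toReal) = (k ^ j)⁻¹ ^ τ * (k ^ j)⁻¹ := by
    rw [e1, ENNReal.rpow_add_of_nonneg _ _ hτ.le zero_le_one, ENNReal.rpow_one]
  have e3 : (k ^ j)⁻¹ ^ τ * (k ^ (min j m + 1)) ^ τ = k ^ τ * (k ^ (j - m))⁻¹ ^ τ := by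
    rw [← ENNReal.mul_rpow_of_nonneg _ _ hτ.le, ← ENNReal.mul_rpow_of_nonneg _ _ hτ.le]
    congr 1
    have hj : k ^ j = k ^ (min j m) * k ^ (j - m) := by
      rw [← pow_add]; congr 1; omega
    rw [hj, ENNReal.mul_inv (Or.inl (hpow0 _)) (Or.inl (hpowt _)), pow_succ]
    calc _ = (k ^ (min j m))⁻¹ * k ^ (min j m) * (k * (k ^ (j - m))⁻¹) := by ring
      _ = _ := by rw [ENNReal.inv_mul_cancel (hpow0 _) (hpowt _), one_mul]
  rw [e2, pow_add]
  calc _ = 2 ^ (2 * n) * k ^ 3 * ((k ^ j)⁻¹ ^ τ * (k ^ (min j m + 1)) ^ τ) * ((k ^ j)⁻¹ * k ^ j) * w *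
        lpFun p Measure.count a := by ring
    _ = _ := by
      rw [ENNReal.inv_mul_cancel (hpow0 _) (hpowt _), e3]
      ring

/-- For m ≥ j the ratio of weights decays by lower doubling. For m < j it grows at most like
K^{B(j-m)}, and s ≥ B + 1 leaves a factor K^{-(j-m)} ≤ 2^{-(j-m)}. The minimum with 2 gives both
regimes a common rate. -/
theorem weightAt_mul_inv_le {ω : ℝ → ℝ} {K B : ℕ} (hK : 2 ≤ K)
    (hB : ∀ j, weightAt ω K j ≤ (K : ℝ≥0∞) ^ B * weightAt ω K (j + 1))
    (h0 : omegaHat ω 0 ≠ 0) (hT : omegaHat ω 0 ≠ ∞) {c : ℝ≥0∞} (hc1 : 1 < c) (hc : c ≠ ∞)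
    (hcW : ∀ j m, c ^ m * weightAt ω K (j + m) ≤ weightAt ω K j) {s : ℝ} (hs : (B : ℝ) + 1 ≤ s)
    (j m : ℕ) :
    weightAt ω K m * (weightAt ω K j)⁻¹ * ((K : ℝ≥0∞) ^ (j - m))⁻¹ ^ s ≤
      ((min c 2)⁻¹) ^ ((j - m) + (m - j)) := by
  have hk0 := natCast_ennreal_ne_zero hK
  have hkt : (K : ℝ≥0∞) ≠ ∞ := by simp
  have hW0 := weightAt_ne_zero hB h0 j
  have hWt := weightAt_ne_top (ω := ω) hK hT j
  rcases le_total j m with h | h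
  · obtain ⟨d, rfl⟩ := Nat.exists_eq_add_of_le h
    simp only [Nat.sub_eq_zero_of_le h, pow_zero, inv_one, ENNReal.one_rpow, mul_one, zero_add,
      Nat.add_sub_cancel_left]
    rw [← div_eq_mul_inv]
    refine ENNReal.div_le_of_le_mul ?_
    have hcd0 : c ^ d ≠ 0 := pow_ne_zero _ (zero_lt_one.trans hc1).ne'
    have hcdt : c ^ d ≠ ∞ := ENNReal.pow_ne_top hc
    calc weightAt ω K (j + d) = (c ^ d)⁻¹ * (c ^ d * weightAt ω K (j + d)) := by
          rw [← mul_assoc, ENNReal.inv_mul_cancel hcd0 hcdt, one_mul]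
      _ ≤ (c ^ d)⁻¹ * weightAt ω K j := by gcongr; exact hcW j d
      _ ≤ (min c 2)⁻¹ ^ d * weightAt ω K j := by
          rw [← ENNReal.inv_pow]
          gcongr
          exact min_le_left _ _
  · obtain ⟨d, rfl⟩ := Nat.exists_eq_add_of_le h
    simp only [Nat.sub_eq_zero_of_le h, add_zero, Nat.add_sub_cancel_left]
    have hd0 : (K : ℝ≥0∞) ^ d ≠ 0 := pow_ne_zero _ hk0
    have hdt : (K : ℝ≥0∞) ^ d ≠ ∞ := ENNReal.pow_ne_top hkt
    have h1 : weightAt ω K m * (weightAt ω K (m + d))⁻¹ ≤ ((K : ℝ≥0∞) ^ d) ^ B := by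
      rw [← div_eq_mul_inv]
      exact ENNReal.div_le_of_le_mul (weightAt_le_pow_mul hB m d)
    have h2 : ((K : ℝ≥0∞) ^ d)⁻¹ ^ s ≤ (((K : ℝ≥0∞) ^ d) ^ B)⁻¹ * ((K : ℝ≥0∞) ^ d)⁻¹ := by
      have hle : ((K : ℝ≥0∞) ^ d)⁻¹ ≤ 1 := by
        rw [ENNReal.inv_le_one]
        exact one_le_pow₀ (by exact_mod_cast (by omega : 1 ≤ K))
      refine (ENNReal.rpow_le_rpow_of_exponent_ge hle hs).trans (le_of_eq ?_)
      rw [ENNReal.rpow_add_of_nonneg _ _ (by positivity) zero_le_one, ENNReal.rpow_one,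
        ENNReal.rpow_natCast]
      simp only [ENNReal.inv_pow]
    calc _ ≤ ((K : ℝ≥0∞) ^ d) ^ B * ((((K : ℝ≥0∞) ^ d) ^ B)⁻¹ * ((K : ℝ≥0∞) ^ d)⁻¹) :=
          mul_le_mul' h1 h2
      _ = ((K : ℝ≥0∞) ^ d)⁻¹ := by
          rw [← mul_assoc, ENNReal.mul_inv_cancel (pow_ne_zero _ hd0) (ENNReal.pow_ne_top hdt), one_mul]
      _ ≤ _ := by
          rw [← ENNReal.inv_pow]
          gcongr
          exact (min_le_right _ _).trans (by exact_mod_cast hK)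

theorem coarseNorm_rpow {p : ℝ≥0∞} {q : ℝ} (hq : 0 < q) {K : ℕ}
    (a : ∀ j, Fin (K ^ (j + 3)) → ℝ≥0∞) :
    coarseNorm p q a ^ q = ∑' j, lpFun p Measure.count (a j) ^ q := by
  rw [coarseNorm, ← ENNReal.rpow_mul, one_div_mul_cancel hq.ne', ENNReal.rpow_one]

theorem mixedNorm_rpow {p : ℝ≥0∞} {q : ℝ} (hq : 0 < q) (ω : ℝ → ℝ) (f : ℂ → ℂ) :
    mixedNorm p q ω f ^ q =
      ∫⁻ r in Set.Ioo (0 : ℝ) 1, circleMean p r f ^ q * ENNReal.ofReal (ω r) := by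
  rw [mixedNorm, ← ENNReal.rpow_mul, one_div_mul_cancel hq.ne', ENNReal.rpow_one]

/-- The synthesis estimate: functions dominated by a sum of atoms have mixed norm bounded by the
norm of the coefficients. -/
theorem exists_mixedNorm_le_of_le_coarseSum {ω : ℝ → ℝ} {p : ℝ≥0∞} (hp0 : 0 < p) {q : ℝ}
    (hq : 0 < q) {K B n : ℕ} (hK : 2 ≤ K)
    (hB : ∀ j, weightAt ω K j ≤ (K : ℝ≥0∞) ^ B * weightAt ω K (j + 1))
    (h0 : omegaHat ω 0 ≠ 0) (hT : omegaHat ω 0 ≠ ∞) (hL : LowerDoublingWith ω K)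
    (hn : 2 ≤ n) (hnp : p ≠ ∞ → 2 ≤ n * p.toReal)
    (hτ : (B : ℝ) + 1 ≤ (2 * (n : ℝ) - 1 - (p⁻¹).toReal) * q) :
    ∃ C : ℝ≥0∞, C ≠ 0 ∧ C ≠ ∞ ∧ ∀ (a : ∀ j, Fin (K ^ (j + 3)) → ℝ≥0∞) (f : ℂ → ℂ),
      (∀ z ∈ Metric.ball (0 : ℂ) 1, ‖f z‖ₑ ≤ coarseSum p q ω K n a z) →
      mixedNorm p q ω f ≤ C * coarseNorm p q a := by
  obtain ⟨c, hc1, hc, hcW⟩ := hL.exists_mul_weightAt_le hK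
  set τ := 2 * (n : ℝ) - 1 - (p⁻¹).toReal with hτdef
  have hτ0 : 0 < τ := by
    by_contra h
    have : τ * q ≤ 0 := mul_nonpos_of_nonpos_of_nonneg (not_lt.1 h) hq.le
    have : (0 : ℝ) ≤ B := by positivity
    linarith
  set E := q * (1 + (p⁻¹).toReal) with hE
  have hE0 : 0 < E := by positivity
  set η := min c 2 with hη
  have hη1 : 1 < η := lt_min hc1 (by norm_num)
  have hη0 : η ≠ 0 := (lt_trans zero_lt_one hη1).ne'
  have hηt : η ≠ ∞ := ((min_le_right c 2).trans_lt (by simp)).ne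
  -- The weights θ^{|j-m|} in the quasi-triangle inequality cost θ^{-E|j-m|} = η^{|j-m|/2}, half of
  -- the available decay; σ = η^{-1/2} is the rate that remains.
  set θ := η ^ (-(1 / (2 * E))) with hθ
  have hθ1 : θ < 1 := ENNReal.rpow_lt_one_of_one_lt_of_neg hη1 (by
    have : 0 < 1 / (2 * E) := by positivity
    linarith)
  have hθ0 : θ ≠ 0 := by
    rw [hθ]
    exact (ENNReal.rpow_pos (pos_iff_ne_zero.2 hη0) hηt).ne'
  set σ := η ^ (-(1 / 2 : ℝ)) with hσ
  have hσ1 : σ < 1 := ENNReal.rpow_lt_one_of_one_lt_of_neg hη1 (by norm_num)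
  set Γ := 2 * (1 - θ)⁻¹ with hΓ
  set C₁ := 2 ^ (2 * n) * (K : ℝ≥0∞) ^ 3 * (K : ℝ≥0∞) ^ τ with hC₁
  have hC₁t : C₁ ≠ ∞ := ENNReal.mul_ne_top (ENNReal.mul_ne_top (ENNReal.pow_ne_top (by simp))
    (ENNReal.pow_ne_top (by simp))) (ENNReal.rpow_ne_top_of_nonneg hτ0.le (by simp))
  have hC₁0 : C₁ ≠ 0 := by
    have hk0 := natCast_ennreal_ne_zero hK
    refine mul_ne_zero (mul_ne_zero (pow_ne_zero _ two_ne_zero) (pow_ne_zero _ hk0)) ?_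
    exact (ENNReal.rpow_pos (pos_iff_ne_zero.2 hk0) (by simp)).ne'
  have hΓt : Γ ≠ ∞ := ENNReal.mul_ne_top (by simp) (ENNReal.inv_ne_top.2 (tsub_pos_of_lt hθ1).ne')
  have hΓ0 : Γ ≠ 0 := mul_ne_zero two_ne_zero
    (ENNReal.inv_ne_zero.2 (ENNReal.sub_ne_top ENNReal.one_ne_top))
  set S := 2 * (1 - σ)⁻¹ with hS
  have hSt : S ≠ ∞ := ENNReal.mul_ne_top (by simp) (ENNReal.inv_ne_top.2 (tsub_pos_of_lt hσ1).ne')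
  have hS0 : S ≠ 0 := mul_ne_zero two_ne_zero
    (ENNReal.inv_ne_zero.2 (ENNReal.sub_ne_top ENNReal.one_ne_top))
  set C₂ := Γ ^ E * C₁ ^ q * S with hC₂
  have hC₂t : C₂ ≠ ∞ := ENNReal.mul_ne_top (ENNReal.mul_ne_top
    (ENNReal.rpow_ne_top_of_nonneg hE0.le hΓt) (ENNReal.rpow_ne_top_of_nonneg hq.le hC₁t)) hSt
  have hC₂0 : C₂ ≠ 0 := mul_ne_zero (mul_ne_zero
    (ENNReal.rpow_pos (pos_iff_ne_zero.2 hΓ0) hΓt).ne'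
    (ENNReal.rpow_pos (pos_iff_ne_zero.2 hC₁0) hC₁t).ne') hS0
  have hdecay : ∀ j m : ℕ, weightAt ω K m * ((θ ^ ((j - m) + (m - j)))⁻¹ ^ E *
      ((weightAt ω K j)⁻¹ * ((K : ℝ≥0∞) ^ (j - m))⁻¹ ^ (τ * q))) ≤ σ ^ ((j - m) + (m - j)) := by
    intro j m
    have h1 := weightAt_mul_inv_le hK hB h0 hT hc1 hc hcW hτ j m
    set d := (j - m) + (m - j) with hd
    have h2 : (θ ^ d)⁻¹ ^ E = η ^ ((d : ℝ) / 2) := by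
      rw [hθ, ← ENNReal.rpow_natCast, ← ENNReal.rpow_mul, ← ENNReal.rpow_neg, ← ENNReal.rpow_mul]
      congr 1
      field_simp
    calc _ = (θ ^ d)⁻¹ ^ E * (weightAt ω K m * (weightAt ω K j)⁻¹ *
          ((K : ℝ≥0∞) ^ (j - m))⁻¹ ^ (τ * q)) := by ring
      _ ≤ η ^ ((d : ℝ) / 2) * η⁻¹ ^ d := by rw [h2]; gcongr
      _ = σ ^ d := by
          rw [hσ, ← ENNReal.rpow_natCast, ← ENNReal.rpow_natCast, ← ENNReal.rpow_neg_one,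
            ← ENNReal.rpow_mul, ← ENNReal.rpow_mul, ← ENNReal.rpow_add _ _ hη0 hηt]
          congr 1
          ring
  refine ⟨C₂ ^ (1 / q), (ENNReal.rpow_pos (pos_iff_ne_zero.2 hC₂0) hC₂t).ne',
    ENNReal.rpow_ne_top_of_nonneg (by positivity) hC₂t, fun a f hf => ?_⟩
  set A : ℕ → ℝ≥0∞ := fun j => lpFun p Measure.count (a j) ^ q with hA
  rw [← ENNReal.rpow_le_rpow_iff hq, ENNReal.mul_rpow_of_nonneg _ _ hq.le, ← ENNReal.rpow_mul,
    one_div_mul_cancel hq.ne', ENNReal.rpow_one, coarseNorm_rpow hq, mixedNorm_rpow hq]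
  -- When the coefficient norm is finite, each bound `bd m` is finite too and can be moved through
  -- the integral below.
  by_cases hAt : ∑' j, A j = ∞
  · rw [hAt, ENNReal.mul_top hC₂0]
    exact le_top
  set bd : ℕ → ℝ≥0∞ := fun m => Γ ^ E * ∑' j, (θ ^ ((j - m) + (m - j)))⁻¹ ^ E *
    (C₁ ^ q * ((weightAt ω K j)⁻¹ * ((K : ℝ≥0∞) ^ (j - m))⁻¹ ^ (τ * q)) * A j) with hbd
  have hmean : ∀ m : ℕ, ∀ r ∈ Set.Ioc (dyadicRadius K m) (dyadicRadius K (m + 1)),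
      circleMean p r f ^ q ≤ bd m := by
    intro m r hr
    have hr0 : 0 ≤ r := (dyadicRadius_nonneg hK m).trans hr.1.le
    have hr1 : r < 1 := hr.2.trans_lt (dyadicRadius_lt_one hK _)
    have h1 : circleMean p r f ≤ lpFun p angleMeasure fun t => ∑' j,
        (((K : ℝ≥0∞) ^ j)⁻¹ ^ (2 * (n : ℝ) - (p⁻¹).toReal) * weightAt ω K j ^ (-(1 / q))) *
        levelSum K n j (a j) (circleMap 0 r t) := by
      rw [circleMean_eq]
      refine lpFun_mono fun t => hf _ ?_
      simpa [abs_of_nonneg hr0] using hr1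
    refine (ENNReal.rpow_le_rpow h1 hq.le).trans ?_
    refine (lpFun_tsum_rpow_le hp0 hq _ (fun j => (measurable_levelSum (a j) r).const_mul _)
      (fun j => θ ^ ((j - m) + (m - j))) (fun j => pow_ne_zero _ hθ0)
      (fun j => ENNReal.pow_ne_top (hθ1.trans ENNReal.one_lt_top).ne)).trans ?_
    rw [hbd]
    refine mul_le_mul' (ENNReal.rpow_le_rpow ?_ hE0.le) (ENNReal.tsum_le_tsum fun j => ?_)
    · simpa only [add_comm] using ENNReal.tsum_pow_dist_le θ m
    · refine mul_le_mul_right ?_ _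
      have hW0 := weightAt_ne_zero hB h0 j
      have hWt := weightAt_ne_top (ω := ω) hK hT j
      have hw : weightAt ω K j ^ (-(1 / q)) ≠ ∞ := by
        rw [ENNReal.rpow_neg]
        exact ENNReal.inv_ne_top.2 (ENNReal.rpow_pos (pos_iff_ne_zero.2 hW0) hWt).ne'
      refine (ENNReal.rpow_le_rpow (lpFun_coarseTerm_le hK hp0 hn hnp hτ0 hw hr0 hr.2 (a j))
        hq.le).trans (le_of_eq ?_)
      rw [← hτdef, ← hC₁, ENNReal.mul_rpow_of_nonneg _ _ hq.le, ENNReal.mul_rpow_of_nonneg _ _ hq.le,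
        ENNReal.mul_rpow_of_nonneg _ _ hq.le, ← ENNReal.rpow_mul, ← ENNReal.rpow_mul]
      have e : -(1 / q) * q = -1 := by field_simp
      rw [e, ENNReal.rpow_neg_one]
      ring
  have htot : ∑' m, weightAt ω K m * bd m ≤ C₂ * ∑' j, A j := by
    calc ∑' m, weightAt ω K m * bd m
        = ∑' m, ∑' j, Γ ^ E * C₁ ^ q * ((weightAt ω K m * ((θ ^ ((j - m) + (m - j)))⁻¹ ^ E *
          ((weightAt ω K j)⁻¹ * ((K : ℝ≥0∞) ^ (j - m))⁻¹ ^ (τ * q)))) * A j) := by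
          refine tsum_congr fun m => ?_
          rw [hbd, ← mul_assoc, ← ENNReal.tsum_mul_left]
          refine tsum_congr fun j => ?_
          ring
      _ ≤ ∑' m, ∑' j, Γ ^ E * C₁ ^ q * (σ ^ ((j - m) + (m - j)) * A j) := by
          gcongr with m j
          exact hdecay j m
      _ = Γ ^ E * C₁ ^ q * ∑' j, (∑' m, σ ^ ((j - m) + (m - j))) * A j := by
          rw [ENNReal.tsum_comm, ← ENNReal.tsum_mul_left]
          refine tsum_congr fun j => ?_
          rw [ENNReal.tsum_mul_left, ENNReal.tsum_mul_right]
      _ ≤ Γ ^ E * C₁ ^ q * ∑' j, S * A j := by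
          gcongr with j
          exact ENNReal.tsum_pow_dist_le σ j
      _ = _ := by rw [ENNReal.tsum_mul_left, hC₂]; ring
  refine le_trans ?_ htot
  rw [lintegral_Ioo_eq_tsum hK]
  refine ENNReal.tsum_le_tsum fun m => ?_
  have hbt : bd m ≠ ∞ := by
    intro h
    have h1 := (ENNReal.le_tsum m).trans htot
    rw [h, ENNReal.mul_top (weightAt_ne_zero hB h0 m), top_le_iff] at h1
    exact ENNReal.mul_ne_top hC₂t hAt h1
  calc _ ≤ ∫⁻ r in Set.Ioc (dyadicRadius K m) (dyadicRadius K (m + 1)),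
        bd m * ENNReal.ofReal (ω r) := by
        refine setLIntegral_mono' measurableSet_Ioc fun r hr => ?_
        gcongr
        exact hmean m r hr
    _ = bd m * blockMass ω K m := by rw [lintegral_const_mul' _ _ hbt, blockMass]
    _ ≤ _ := by
        rw [mul_comm]
        gcongr
        exact blockMass_le hK m

theorem le_lpFun_count {ι : Type*} [Fintype ι] [MeasurableSpace ι] [MeasurableSingletonClass ι]
    {p : ℝ≥0∞} (hp0 : 0 < p) (F : ι → ℝ≥0∞) (i : ι) : F i ≤ lpFun p Measure.count F := by
  by_cases hp : p = ∞
  · subst hp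
    rw [lpFun_top]
    exact le_iSup F i
  · have hpp := ENNReal.toReal_pos hp0.ne' hp
    rw [← ENNReal.rpow_le_rpow_iff hpp, lpFun_count_rpow hp0 hp]
    exact Finset.single_le_sum (f := fun i => F i ^ p.toReal) (fun _ _ => zero_le) (Finset.mem_univ i)

theorem lpFun_le_coarseNorm {p : ℝ≥0∞} {q : ℝ} (hq : 0 < q) {K : ℕ}
    (a : ∀ j, Fin (K ^ (j + 3)) → ℝ≥0∞) (j : ℕ) :
    lpFun p Measure.count (a j) ≤ coarseNorm p q a := by
  rw [← ENNReal.rpow_le_rpow_iff hq, coarseNorm_rpow hq]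
  exact ENNReal.le_tsum j

/-- Pointwise convergence of the majorant. -/
theorem exists_coarseSum_le {ω : ℝ → ℝ} {p : ℝ≥0∞} (hp0 : 0 < p) {q : ℝ}
    (hq : 0 < q) {K B n : ℕ} (hK : 2 ≤ K)
    (hB : ∀ j, weightAt ω K j ≤ (K : ℝ≥0∞) ^ B * weightAt ω K (j + 1))
    (h0 : omegaHat ω 0 ≠ 0) (hτ : (B : ℝ) + 1 ≤ (2 * (n : ℝ) - 1 - (p⁻¹).toReal) * q)
    {z : ℂ} (hz : z ∈ Metric.ball (0 : ℂ) 1) :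
    ∃ C : ℝ≥0∞, C ≠ ∞ ∧ ∀ a : ∀ j, Fin (K ^ (j + 3)) → ℝ≥0∞,
      coarseSum p q ω K n a z ≤ C * coarseNorm p q a := by
  have hz1 : ‖z‖ < 1 := by simpa using hz
  have hk0 := natCast_ennreal_ne_zero hK
  have hkt : (K : ℝ≥0∞) ≠ ∞ := by simp
  set k := (K : ℝ≥0∞) with hk
  set τ := 2 * (n : ℝ) - 1 - (p⁻¹).toReal with hτdef
  -- The part B/q of the exponent absorbs the growth of ω̂(r_j)^{-1/q}; the part 1/q supplies the
  -- geometric ratio x = K^{-1/q}.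
  have hτ' : (B : ℝ) / q + 1 / q ≤ τ := by
    rw [← add_div, div_le_iff₀ hq]; exact hτ
  have hτ0 : 0 < τ := lt_of_lt_of_le (by positivity) hτ'
  set Z := (ENNReal.ofReal (1 - ‖z‖))⁻¹ with hZ
  have hZt : Z ≠ ∞ := by
    rw [hZ]; simp; exact hz1
  set V := (weightAt ω K 0)⁻¹ ^ (1 / q) with hV
  have hVt : V ≠ ∞ := ENNReal.rpow_ne_top_of_nonneg (by positivity)
    (ENNReal.inv_ne_top.2 (by rwa [weightAt_zero]))
  set x := k⁻¹ ^ (1 / q) with hx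
  have hx1 : x < 1 := by
    refine ENNReal.rpow_lt_one ?_ (by positivity)
    rw [ENNReal.inv_lt_one]
    rw [hk]
    exact_mod_cast (by omega : 1 < K)
  refine ⟨k ^ 3 * Z ^ (2 * n) * V * (1 - x)⁻¹, ?_, fun a => ?_⟩
  · exact ENNReal.mul_ne_top (ENNReal.mul_ne_top (ENNReal.mul_ne_top (ENNReal.pow_ne_top hkt)
      (ENNReal.pow_ne_top hZt)) hVt) (ENNReal.inv_ne_top.2 (tsub_pos_of_lt hx1).ne')
  have hterm : ∀ j, (k ^ j)⁻¹ ^ (2 * (n : ℝ) - (p⁻¹).toReal) * weightAt ω K j ^ (-(1 / q)) *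
      levelSum K n j (a j) z ≤ k ^ 3 * Z ^ (2 * n) * V * coarseNorm p q a * x ^ j := by
    intro j
    have hj0 : k ^ j ≠ 0 := pow_ne_zero _ hk0
    have hjt : k ^ j ≠ ∞ := ENNReal.pow_ne_top hkt
    have h1 : levelSum K n j (a j) z ≤ k ^ j * k ^ 3 * (coarseNorm p q a * Z ^ (2 * n)) := by
      calc levelSum K n j (a j) z ≤ ∑ l : Fin (K ^ (j + 3)), coarseNorm p q a * Z ^ (2 * n) := by
            refine Finset.sum_le_sum fun l _ => ?_
            refine mul_le_mul' ((le_lpFun_count hp0 (a j) l).trans (lpFun_le_coarseNorm hq a j))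
              (pow_le_pow_left' (kerAbs_le ?_) _)
            have : ‖corner K j l‖ * ‖z‖ ≤ ‖z‖ :=
              mul_le_of_le_one_left (norm_nonneg _) (by
                rw [norm_corner hK]; linarith [level_pos hK j])
            linarith
        _ = _ := by
            rw [Finset.sum_const, Finset.card_univ, Fintype.card_fin, nsmul_eq_mul, ← pow_add]
            push_cast
            rfl
    have h2 : weightAt ω K j ^ (-(1 / q)) ≤ (k ^ j) ^ ((B : ℝ) / q) * V := by
      have h3 : (weightAt ω K j)⁻¹ ≤ (k ^ j) ^ B * (weightAt ω K 0)⁻¹ := by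
        have h4 := weightAt_le_pow_mul hB 0 j
        rw [zero_add] at h4
        have h5 : (k ^ j) ^ B ≠ 0 := pow_ne_zero _ hj0
        have h6 : (k ^ j) ^ B ≠ ∞ := ENNReal.pow_ne_top hjt
        have h7 := ENNReal.inv_le_inv.2 h4
        rw [ENNReal.mul_inv (Or.inl h5) (Or.inl h6)] at h7
        calc (weightAt ω K j)⁻¹ = (k ^ j) ^ B * (((k ^ j) ^ B)⁻¹ * (weightAt ω K j)⁻¹) := by
              rw [← mul_assoc, ENNReal.mul_inv_cancel h5 h6, one_mul]
          _ ≤ _ := by gcongr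
      rw [ENNReal.rpow_neg, ← ENNReal.inv_rpow]
      refine (ENNReal.rpow_le_rpow h3 (by positivity)).trans (le_of_eq ?_)
      rw [ENNReal.mul_rpow_of_nonneg _ _ (by positivity), ← ENNReal.rpow_natCast, ← ENNReal.rpow_mul]
      congr 2
      ring
    have h3 : (k ^ j)⁻¹ ^ (2 * (n : ℝ) - (p⁻¹).toReal) ≤
        (k ^ j)⁻¹ ^ ((B : ℝ) / q) * x ^ j * (k ^ j)⁻¹ := by
      have e : 2 * (n : ℝ) - (p⁻¹).toReal = τ + 1 := by rw [hτdef]; ring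
      rw [e, ENNReal.rpow_add_of_nonneg _ _ hτ0.le zero_le_one, ENNReal.rpow_one]
      refine mul_le_mul_left ?_ _
      have hle : (k ^ j)⁻¹ ≤ 1 := by
        rw [ENNReal.inv_le_one]
        exact one_le_pow₀ (by rw [hk]; exact_mod_cast (by omega : 1 ≤ K))
      refine (ENNReal.rpow_le_rpow_of_exponent_ge hle hτ').trans (le_of_eq ?_)
      rw [ENNReal.rpow_add_of_nonneg _ _ (by positivity) (by positivity), hx]
      congr 1
      rw [ENNReal.inv_pow, ← ENNReal.rpow_natCast, ← ENNReal.rpow_natCast, ← ENNReal.rpow_mul,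
        ← ENNReal.rpow_mul, mul_comm]
    have h4 : (k ^ j)⁻¹ ^ ((B : ℝ) / q) * (k ^ j) ^ ((B : ℝ) / q) = 1 := by
      rw [← ENNReal.mul_rpow_of_nonneg _ _ (by positivity), ENNReal.inv_mul_cancel hj0 hjt,
        ENNReal.one_rpow]
    calc _ ≤ (k ^ j)⁻¹ ^ ((B : ℝ) / q) * x ^ j * (k ^ j)⁻¹ * ((k ^ j) ^ ((B : ℝ) / q) * V) *
          (k ^ j * k ^ 3 * (coarseNorm p q a * Z ^ (2 * n))) :=
          mul_le_mul' (mul_le_mul' h3 h2) h1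
      _ = ((k ^ j)⁻¹ ^ ((B : ℝ) / q) * (k ^ j) ^ ((B : ℝ) / q)) * ((k ^ j)⁻¹ * k ^ j) *
          (k ^ 3 * Z ^ (2 * n) * V * coarseNorm p q a * x ^ j) := by ring
      _ = _ := by rw [h4, ENNReal.inv_mul_cancel hj0 hjt, one_mul, one_mul]
  refine (ENNReal.tsum_le_tsum hterm).trans (le_of_eq ?_)
  rw [ENNReal.tsum_mul_left, ENNReal.tsum_geometric]
  ring

/-! ### The analysis estimate -/

/-- The local suprema of `f`, normalized as coefficients of atoms. -/
def cellCoeff (p : ℝ≥0∞) (q : ℝ) (ω : ℝ → ℝ) (K : ℕ) (f : ℂ → ℂ) (j : ℕ)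
    (l : Fin (K ^ (j + 3))) : ℝ≥0∞ :=
  (((K : ℝ≥0∞) ^ j)⁻¹ ^ (p⁻¹).toReal * weightAt ω K j ^ (1 / q)) * cellSup K f j l

/-- The analysis estimate: the normalized local suprema of `f` lie in `ℓ^{p,q}`. -/
theorem exists_coarseNorm_cellCoeff_le {ω : ℝ → ℝ} {p : ℝ≥0∞} (hp0 : 0 < p) {q : ℝ}
    (hq : 0 < q) {K B : ℕ} (hK : 2 ≤ K)
    (hB : ∀ j, weightAt ω K j ≤ (K : ℝ≥0∞) ^ B * weightAt ω K (j + 1))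
    (h0 : omegaHat ω 0 ≠ 0) (hT : omegaHat ω 0 ≠ ∞) (hL : LowerDoublingWith ω K) :
    ∃ C : ℝ≥0∞, C ≠ ∞ ∧ ∀ f : ℂ → ℂ, DifferentiableOn ℂ f (Metric.ball 0 1) →
      coarseNorm p q (cellCoeff p q ω K f) ≤ C * mixedNorm p q ω f := by
  obtain ⟨C₁, hC₁t, hC₁⟩ := exists_lpFun_cellSup_le hK hp0
  obtain ⟨C₂, hC₂t, hC₂⟩ := hL.exists_weightAt_le_blockMass hK hT
  set k := (K : ℝ≥0∞) with hk
  have hk0 := natCast_ennreal_ne_zero hK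
  have hkt : k ≠ ∞ := by simp [hk]
  set C₃ := C₁ ^ q * ((k ^ 3) ^ B * C₂) with hC₃
  have hC₃t : C₃ ≠ ∞ := ENNReal.mul_ne_top (ENNReal.rpow_ne_top_of_nonneg hq.le hC₁t)
    (ENNReal.mul_ne_top (ENNReal.pow_ne_top (ENNReal.pow_ne_top hkt)) hC₂t)
  refine ⟨C₃ ^ (1 / q), ENNReal.rpow_ne_top_of_nonneg (by positivity) hC₃t, fun f hf => ?_⟩
  rw [← ENNReal.rpow_le_rpow_iff hq, ENNReal.mul_rpow_of_nonneg _ _ hq.le, ← ENNReal.rpow_mul,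
    one_div_mul_cancel hq.ne', ENNReal.rpow_one, coarseNorm_rpow hq, mixedNorm_rpow hq,
    lintegral_Ioo_eq_tsum hK]
  set I : ℕ → ℝ≥0∞ := fun j => ∫⁻ r in Set.Ioc (dyadicRadius K j) (dyadicRadius K (j + 1)),
    circleMean p r f ^ q * ENNReal.ofReal (ω r) with hI
  -- Every circle in block j + 3 controls the suprema at level j. Integrating over that block
  -- against ω brings in its mass, which dominates ω̂(r_j) up to a constant; the factor ω̂(r_j) then
  -- cancels.
  have hterm : ∀ j, lpFun p Measure.count (cellCoeff p q ω K f j) ^ q ≤ C₃ * I (j + 3) := by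
    intro j
    have hj0 : k ^ j ≠ 0 := pow_ne_zero _ hk0
    have hjt : k ^ j ≠ ∞ := ENNReal.pow_ne_top hkt
    have hWt := weightAt_ne_top (ω := ω) hK hT j
    have hct : (k ^ j)⁻¹ ^ (p⁻¹).toReal * weightAt ω K j ^ (1 / q) ≠ ∞ := ENNReal.mul_ne_top
      (ENNReal.rpow_ne_top_of_nonneg (by positivity) (ENNReal.inv_ne_top.2 hj0))
      (ENNReal.rpow_ne_top_of_nonneg (by positivity) hWt)
    set X := lpFun p Measure.count (cellCoeff p q ω K f j) with hX
    have h1 : ∀ r ∈ Set.Ioc (dyadicRadius K (j + 3)) (dyadicRadius K (j + 3 + 1)),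
        X ^ q ≤ weightAt ω K j * C₁ ^ q * circleMean p r f ^ q := by
      intro r hr
      have h2 := hC₁ f hf j r hr.1.le (hr.2.trans_lt (dyadicRadius_lt_one hK _))
      have h3 : X ≤ weightAt ω K j ^ (1 / q) * C₁ * circleMean p r f := by
        calc X = (k ^ j)⁻¹ ^ (p⁻¹).toReal * weightAt ω K j ^ (1 / q) *
              lpFun p Measure.count fun l : Fin (K ^ (j + 3)) => cellSup K f j l :=
              lpFun_const_mul hp0 _ hct _
          _ ≤ (k ^ j)⁻¹ ^ (p⁻¹).toReal * weightAt ω K j ^ (1 / q) *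
              (C₁ * (k ^ j) ^ (p⁻¹).toReal * circleMean p r f) := by gcongr
          _ = ((k ^ j)⁻¹ ^ (p⁻¹).toReal * (k ^ j) ^ (p⁻¹).toReal) *
              (weightAt ω K j ^ (1 / q) * C₁ * circleMean p r f) := by ring
          _ = _ := by
            rw [← ENNReal.mul_rpow_of_nonneg _ _ (by positivity), ENNReal.inv_mul_cancel hj0 hjt,
              ENNReal.one_rpow, one_mul]
      refine (ENNReal.rpow_le_rpow h3 hq.le).trans (le_of_eq ?_)
      rw [ENNReal.mul_rpow_of_nonneg _ _ hq.le, ENNReal.mul_rpow_of_nonneg _ _ hq.le,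
        ← ENNReal.rpow_mul, one_div_mul_cancel hq.ne', ENNReal.rpow_one]
    have hc4 : weightAt ω K j * C₁ ^ q ≠ ∞ :=
      ENNReal.mul_ne_top hWt (ENNReal.rpow_ne_top_of_nonneg hq.le hC₁t)
    have h5 : X ^ q * blockMass ω K (j + 3) ≤ weightAt ω K j * C₁ ^ q * I (j + 3) := by
      rw [hI, blockMass, ← lintegral_const_mul' _ _ hc4]
      refine (lintegral_const_mul_le _ _).trans (setLIntegral_mono' measurableSet_Ioc fun r hr => ?_)
      rw [← mul_assoc]
      exact mul_le_mul_left (h1 r hr) _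
    have h6 : weightAt ω K j ≤ (k ^ 3) ^ B * (C₂ * blockMass ω K (j + 3)) :=
      (weightAt_le_pow_mul hB j 3).trans (by gcongr; exact hC₂ _)
    rw [← ENNReal.mul_le_mul_iff_right (weightAt_ne_zero hB h0 j) hWt]
    calc weightAt ω K j * X ^ q ≤ (k ^ 3) ^ B * (C₂ * blockMass ω K (j + 3)) * X ^ q := by gcongr
      _ = (k ^ 3) ^ B * C₂ * (X ^ q * blockMass ω K (j + 3)) := by ring
      _ ≤ (k ^ 3) ^ B * C₂ * (weightAt ω K j * C₁ ^ q * I (j + 3)) := by gcongr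
      _ = _ := by rw [hC₃]; ring
  calc _ ≤ ∑' j, C₃ * I (j + 3) := ENNReal.tsum_le_tsum hterm
    _ = C₃ * ∑' j, I (j + 3) := ENNReal.tsum_mul_left
    _ ≤ _ := mul_le_mul_right
      (ENNReal.tsum_comp_le_tsum_of_injective (add_left_injective 3) I) _

/-! ### Geometry of the pieces and oscillation on a piece -/

theorem norm_circleMap_sub_circleMap_le {r r' t t' : ℝ} (h0 : 0 ≤ r') (h1 : r' ≤ 1) :
    ‖circleMap 0 r t - circleMap 0 r' t'‖ ≤ |r - r'| + |t - t'| := by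
  have e : circleMap 0 r t - circleMap 0 r' t' =
      circleMap 0 (r - r') t + (circleMap 0 r' t - circleMap 0 r' t') := by
    simp [circleMap]; ring
  rw [e]
  refine (norm_add_le _ _).trans ?_
  rw [norm_circleMap_zero]
  gcongr
  exact (dist_circleMap_le _ _ _ h0).trans (mul_le_of_le_one_left (abs_nonneg _) h1)

/-- The radii that cut the annulus `r_j ≤ |z| < r_{j+1}` into `N` annuli of equal area. -/
def cutAt (K j N a : ℕ) : ℝ :=
  Real.sqrt (dyadicRadius K j ^ 2 +
    (a : ℝ) / N * (dyadicRadius K (j + 1) ^ 2 - dyadicRadius K j ^ 2))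

/-- The angles that cut the circle into `N K^{j+3}` equal arcs. -/
def cutAngle (K j N l b : ℕ) : ℝ :=
  2 * Real.pi * ((l : ℝ) / (K : ℝ) ^ (j + 3)) + (b : ℝ) / N * (2 * Real.pi / (K : ℝ) ^ (j + 3))

section cut

variable {K : ℕ}

theorem cutAt_zero (hK : 2 ≤ K) (j N : ℕ) : cutAt K j N 0 = dyadicRadius K j := by
  simp [cutAt, Real.sqrt_sq (dyadicRadius_nonneg hK j)]

theorem cutAt_self (hK : 2 ≤ K) (j : ℕ) {N : ℕ} (hN : 1 ≤ N) :
    cutAt K j N N = dyadicRadius K (j + 1) := by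
  have : (N : ℝ) ≠ 0 := by exact_mod_cast (by omega : N ≠ 0)
  rw [cutAt, div_self this, one_mul, add_sub_cancel, Real.sqrt_sq (dyadicRadius_nonneg hK _)]

theorem sq_dyadicRadius_le (hK : 2 ≤ K) (j : ℕ) :
    dyadicRadius K j ^ 2 ≤ dyadicRadius K (j + 1) ^ 2 :=
  pow_le_pow_left₀ (dyadicRadius_nonneg hK j) (dyadicRadius_mono hK (Nat.le_succ j)) 2

theorem cutAt_mono (hK : 2 ≤ K) (j N : ℕ) : Monotone (cutAt K j N) := by
  intro a b h
  refine Real.sqrt_le_sqrt ?_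
  have := sub_nonneg.2 (sq_dyadicRadius_le hK j)
  have : (a : ℝ) ≤ b := by exact_mod_cast h
  gcongr

theorem dyadicRadius_le_cutAt (hK : 2 ≤ K) (j N a : ℕ) : dyadicRadius K j ≤ cutAt K j N a := by
  rw [← cutAt_zero hK j N]
  exact cutAt_mono hK j N (Nat.zero_le a)

theorem cutAt_le_dyadicRadius (hK : 2 ≤ K) (j : ℕ) {N a : ℕ} (hN : 1 ≤ N) (ha : a ≤ N) :
    cutAt K j N a ≤ dyadicRadius K (j + 1) := by
  rw [← cutAt_self hK j hN]
  exact cutAt_mono hK j N ha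

/-- Equal areas make the squares of the radii equidistant. For j ≥ 1 all radii are at least 1/2 and
the gaps are O(K^{-j}/N). For j = 0 the inner radius is 0 and the first gap has order N^{-1/2},
which fixes the rate. -/
theorem cutAt_succ_sub_le (hK : 2 ≤ K) (j : ℕ) {N : ℕ} (hN : 1 ≤ N) (a : ℕ) :
    cutAt K j N (a + 1) - cutAt K j N a ≤ 2 * level K j / Real.sqrt N := by
  have hN0 : (0 : ℝ) < N := by exact_mod_cast hN
  have hs : 0 < Real.sqrt N := Real.sqrt_pos.2 hN0
  have hsN : Real.sqrt N * Real.sqrt N = N := Real.mul_self_sqrt hN0.le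
  have hs1 : 1 ≤ Real.sqrt N := by
    rw [Real.one_le_sqrt]; exact_mod_cast hN
  have hmono := cutAt_mono hK j N (Nat.le_succ a)
  simp only [Nat.succ_eq_add_one] at hmono
  set D := dyadicRadius K (j + 1) ^ 2 - dyadicRadius K j ^ 2 with hD
  have hD0 : 0 ≤ D := sub_nonneg.2 (sq_dyadicRadius_le hK j)
  have hsq : ∀ a : ℕ, cutAt K j N a ^ 2 = dyadicRadius K j ^ 2 + (a : ℝ) / N * D := by
    intro a
    exact Real.sq_sqrt (by positivity)
  have hdiff : (cutAt K j N (a + 1) - cutAt K j N a) * (cutAt K j N (a + 1) + cutAt K j N a) = D / N := by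
    have h1 := hsq a
    have h2 := hsq (a + 1)
    push_cast at h2
    have : (cutAt K j N (a + 1) - cutAt K j N a) * (cutAt K j N (a + 1) + cutAt K j N a) =
        cutAt K j N (a + 1) ^ 2 - cutAt K j N a ^ 2 := by ring
    rw [this, h1, h2]; ring
  have hr0 := dyadicRadius_nonneg hK j
  have hr1 := dyadicRadius_lt_one hK (j + 1)
  have hr2 := dyadicRadius_nonneg hK (j + 1)
  have hlow := dyadicRadius_le_cutAt hK j N a
  have hl0 := level_pos hK j
  rw [le_div_iff₀ hs]
  rcases Nat.eq_zero_or_pos j with rfl | hj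
  · have hD1 : D ≤ 1 := by
      rw [hD]; nlinarith
    have h3 : (cutAt K 0 N (a + 1) - cutAt K 0 N a) ^ 2 ≤ D / N := by
      rw [← hdiff]
      nlinarith
    rw [level_zero]
    have h4 : ((cutAt K 0 N (a + 1) - cutAt K 0 N a) * Real.sqrt N) ^ 2 ≤ 1 := by
      rw [mul_pow, Real.sq_sqrt hN0.le]
      calc _ ≤ D / N * N := by gcongr
        _ = D := by field_simp
        _ ≤ 1 := hD1
    nlinarith
  · have hhalf : 1 / 2 ≤ dyadicRadius K j := by
      obtain ⟨i, rfl⟩ := Nat.exists_eq_add_of_le' hj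
      rw [dyadicRadius_eq]
      linarith [two_mul_level_succ_le hK i, level_le_one hK i]
    have hDl : D ≤ 2 * level K j := by
      have e : D = (level K j - level K (j + 1)) * (dyadicRadius K (j + 1) + dyadicRadius K j) := by
        rw [hD, dyadicRadius_eq, dyadicRadius_eq]; ring
      rw [e]
      have h5 := level_pos hK (j + 1)
      have h6 := level_anti hK (Nat.le_succ j)
      have h7 := dyadicRadius_lt_one hK j
      simp only [Nat.succ_eq_add_one] at h6
      nlinarith
    have h3 : cutAt K j N (a + 1) - cutAt K j N a ≤ D / N := by
      rw [← hdiff]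
      nlinarith
    calc _ ≤ D / N * Real.sqrt N := by gcongr
      _ ≤ 2 * level K j / N * Real.sqrt N := by gcongr
      _ = 2 * level K j * (Real.sqrt N / N) := by ring
      _ ≤ 2 * level K j * 1 := by
        gcongr
        rw [div_le_one hN0]
        nlinarith
      _ = _ := by ring

theorem cutAngle_zero (j N l : ℕ) :
    cutAngle K j N l 0 = 2 * Real.pi * ((l : ℝ) / (K : ℝ) ^ (j + 3)) := by simp [cutAngle]

theorem cutAngle_self (j l : ℕ) {N : ℕ} (hN : 1 ≤ N) :
    cutAngle K j N l N = 2 * Real.pi * (((l + 1 : ℕ) : ℝ) / (K : ℝ) ^ (j + 3)) := by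
  have : (N : ℝ) ≠ 0 := by exact_mod_cast (by omega : N ≠ 0)
  rw [cutAngle, div_self this]
  push_cast
  ring

theorem cutAngle_succ_sub (j N l b : ℕ) :
    cutAngle K j N l (b + 1) - cutAngle K j N l b = 2 * Real.pi / ((K : ℝ) ^ (j + 3) * N) := by
  simp only [cutAngle]
  push_cast
  rw [← div_div]
  ring

theorem cutAngle_mono (j N l : ℕ) : Monotone (cutAngle K j N l) := by
  refine monotone_nat_of_le_succ fun b => ?_
  have := cutAngle_succ_sub (K := K) j N l b
  have : 0 ≤ 2 * Real.pi / ((K : ℝ) ^ (j + 3) * N) := by positivity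
  linarith

theorem pieceCenter_eq (N : ℕ) (i : PieceIndex K N) :
    pieceCenter K N i = circleMap 0
      ((cutAt K i.1 N i.2.2.1 + cutAt K i.1 N (i.2.2.1 + 1)) / 2)
      ((cutAngle K i.1 N i.2.1 i.2.2.2 + cutAngle K i.1 N i.2.1 (i.2.2.2 + 1)) / 2) := by
  simp only [pieceCenter, PolarRect.center, PolarRect.piece, PolarRect.cutRadius, dyadicRect, cutAt,
    cutAngle]
  congr 2
  push_cast
  ring

/-- A point of the closed piece with indices `(l, a, b)` at level `j`. -/
def InPiece (K N j l a b : ℕ) (ζ : ℂ) : Prop :=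
  ∃ r ∈ Set.Icc (cutAt K j N a) (cutAt K j N (a + 1)),
    ∃ t ∈ Set.Icc (cutAngle K j N l b) (cutAngle K j N l (b + 1)), ζ = circleMap 0 r t

theorem inPiece_pieceCenter (hK : 2 ≤ K) {N : ℕ} (i : PieceIndex K N) :
    InPiece K N i.1 i.2.1 i.2.2.1 i.2.2.2 (pieceCenter K N i) := by
  have h1 := cutAt_mono hK i.1 N (Nat.le_succ i.2.2.1)
  have h2 := cutAngle_mono (K := K) i.1 N i.2.1 (Nat.le_succ i.2.2.2)
  simp only [Nat.succ_eq_add_one] at h1 h2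
  exact ⟨_, ⟨by linarith, by linarith⟩, _, ⟨by linarith, by linarith⟩, pieceCenter_eq N i⟩

theorem InPiece.norm_le (hK : 2 ≤ K) {N j l a b : ℕ} (hN : 1 ≤ N) (ha : a < N) {ζ : ℂ}
    (h : InPiece K N j l a b ζ) :
    ‖ζ‖ ≤ dyadicRadius K (j + 1) ∧ dyadicRadius K j ≤ ‖ζ‖ := by
  obtain ⟨r, hr, t, ht, rfl⟩ := h
  have h1 := dyadicRadius_le_cutAt hK j N a
  have h2 := dyadicRadius_nonneg hK j
  rw [norm_circleMap_zero, abs_of_nonneg (by linarith [hr.1])]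
  exact ⟨hr.2.trans (cutAt_le_dyadicRadius hK j hN ha), h1.trans hr.1⟩

theorem InPiece.dist_corner_le (hK : 2 ≤ K) {N j l a b : ℕ} (hN : 1 ≤ N) (ha : a < N) (hb : b < N)
    {ζ : ℂ} (h : InPiece K N j l a b ζ) : ‖ζ - corner K j l‖ ≤ 2 * level K j := by
  obtain ⟨r, hr, t, ht, rfl⟩ := h
  have h1 := dyadicRadius_le_cutAt hK j N a
  have h2 : cutAt K j N (a + 1) ≤ _ := cutAt_le_dyadicRadius hK j hN ha
  have h3 := cutAngle_mono (K := K) j N l (Nat.zero_le b)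
  have h4 := cutAngle_mono (K := K) j N l hb
  have h5 := two_pi_div_le_level hK j
  rw [cutAngle_zero] at h3
  have h6 : cutAngle K j N l N = 2 * Real.pi * ((l : ℝ) / (K : ℝ) ^ (j + 3)) +
      2 * Real.pi / (K : ℝ) ^ (j + 3) := by
    rw [cutAngle_self _ _ hN]; push_cast; ring
  simp only [Nat.succ_eq_add_one] at h4
  have h7 := level_pos hK (j + 1)
  rw [corner]
  refine (norm_circleMap_sub_circleMap_le (dyadicRadius_nonneg hK j)
    (dyadicRadius_lt_one hK j).le).trans ?_
  rw [abs_of_nonneg (by linarith [hr.1]), abs_of_nonneg (by linarith [ht.1])]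
  rw [dyadicRadius_eq] at *
  linarith [hr.2, ht.2]

theorem InPiece.dist_le (hK : 2 ≤ K) {N j l a b : ℕ} (hN : 1 ≤ N) (ha : a < N) {ζ ζ' : ℂ}
    (h : InPiece K N j l a b ζ) (h' : InPiece K N j l a b ζ') :
    ‖ζ - ζ'‖ ≤ 3 * level K j / Real.sqrt N := by
  obtain ⟨r, hr, t, ht, rfl⟩ := h
  obtain ⟨r', hr', t', ht', rfl⟩ := h'
  have h1 := dyadicRadius_le_cutAt hK j N a
  have h2 : cutAt K j N (a + 1) ≤ _ := cutAt_le_dyadicRadius hK j hN ha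
  have h3 := cutAt_succ_sub_le hK j hN a
  have h4 := cutAngle_succ_sub (K := K) j N l b
  have h5 := two_pi_div_le_level hK j
  have hN0 : (0 : ℝ) < N := by exact_mod_cast hN
  have hs : 0 < Real.sqrt N := Real.sqrt_pos.2 hN0
  have hs1 : 1 ≤ Real.sqrt N := by
    rw [Real.one_le_sqrt]; exact_mod_cast hN
  have hsN : Real.sqrt N * Real.sqrt N = N := Real.mul_self_sqrt hN0.le
  have hl := level_pos hK j
  have h6 : 2 * Real.pi / ((K : ℝ) ^ (j + 3) * N) ≤ level K j / Real.sqrt N := by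
    rw [← div_div]
    refine div_le_div₀ hl.le h5 hs ?_
    nlinarith
  refine (norm_circleMap_sub_circleMap_le ((dyadicRadius_nonneg hK j).trans (h1.trans hr'.1))
    (hr'.2.trans (h2.trans (dyadicRadius_lt_one hK _).le))).trans ?_
  have h7 : |r - r'| ≤ 2 * level K j / Real.sqrt N :=
    (abs_sub_le_of_le_of_le hr.1 hr.2 hr'.1 hr'.2).trans h3
  have h8 : |t - t'| ≤ level K j / Real.sqrt N :=
    (abs_sub_le_of_le_of_le ht.1 ht.2 ht'.1 ht'.2).trans (h4.le.trans h6)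
  calc _ ≤ 2 * level K j / Real.sqrt N + level K j / Real.sqrt N := add_le_add h7 h8
    _ = _ := by ring

/-- Pieces lie within 2K^{-j} of the corner and in |ζ| ≤ 1 - K^{-(j+1)}; the constants of
`cellRegion` leave room for a disc of radius K^{-(j+1)}/2 around each of their points. -/
theorem mem_cellRegion_of_dist_lt (hK : 2 ≤ K) {N j l a b : ℕ} (hN : 1 ≤ N) (ha : a < N)
    (hb : b < N) {ζ w : ℂ} (h : InPiece K N j l a b ζ) (hw : ‖w - ζ‖ ≤ level K (j + 1) / 2) :
    w ∈ cellRegion K j l := by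
  have h1 := h.dist_corner_le hK hN ha hb
  have h2 := (h.norm_le hK hN ha).1
  have h3 := level_pos hK (j + 1)
  have h4 := two_mul_level_succ_le hK j
  rw [dyadicRadius_eq] at h2
  constructor
  · have := norm_add_le (w - ζ) (ζ - corner K j l)
    rw [sub_add_sub_cancel] at this
    linarith
  · have := norm_add_le (w - ζ) ζ
    rw [sub_add_cancel] at this
    linarith

/-- A point w of the region is within 3K^{-j} = 6K · K^{-(j+1)}/2 of the corner, while the kernel
denominator at w is at least K^{-(j+1)}/2. -/
theorem norm_kernel_corner_le (hK : 2 ≤ K) {j l : ℕ} {w z : ℂ} (hw : w ∈ cellRegion K j l)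
    (hz : ‖z‖ ≤ 1) :
    ‖1 - (starRingEnd ℂ) (corner K j l) * z‖ ≤ (1 + 6 * K) * ‖1 - (starRingEnd ℂ) w * z‖ := by
  have h3 := level_pos hK (j + 1)
  refine norm_one_sub_conj_mul_le (d := level K (j + 1) / 2) hz (by positivity) ?_ ?_
  · rw [norm_sub_rev]
    refine hw.1.trans (le_of_eq ?_)
    rw [← level_succ hK j]; ring
  · refine le_trans ?_ (one_sub_mul_le_norm_one_sub_conj_mul w z)
    have := mul_le_of_le_one_right (norm_nonneg w) hz
    linarith [hw.2]

theorem cellSup_ne_top (hK : 2 ≤ K) {f : ℂ → ℂ} (hf : ContinuousOn f (Metric.ball 0 1)) (j l : ℕ) :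
    cellSup K f j l ≠ ∞ := by
  have h3 := level_pos hK (j + 1)
  have hsub : cellRegion K j l ⊆ Metric.closedBall 0 (1 - level K (j + 1) / 2) := fun w hw => by
    simpa using hw.2
  obtain ⟨C, hC⟩ := (isCompact_closedBall (0 : ℂ) (1 - level K (j + 1) / 2)).exists_bound_of_continuousOn
    (hf.mono (Metric.closedBall_subset_ball (by linarith)))
  refine ((iSup₂_le fun w hw => ?_ : cellSup K f j l ≤ ENNReal.ofReal C).trans_lt
    ENNReal.ofReal_lt_top).ne
  rw [← ofReal_norm]
  exact ENNReal.ofReal_le_ofReal (hC w (hsub hw))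

theorem norm_le_toReal_cellSup (hK : 2 ≤ K) {f : ℂ → ℂ} (hf : ContinuousOn f (Metric.ball 0 1))
    {j l : ℕ} {w : ℂ} (hw : w ∈ cellRegion K j l) : ‖f w‖ ≤ (cellSup K f j l).toReal := by
  rw [← ENNReal.ofReal_le_iff_le_toReal (cellSup_ne_top hK hf j l), ofReal_norm]
  exact le_cellSup f hw

/-- The Schwarz lemma, as g maps the disc into the closed disc of radius 2S about g(c). -/
theorem norm_sub_le_of_norm_le {g : ℂ → ℂ} {c w : ℂ} {R S : ℝ}
    (hg : DifferentiableOn ℂ g (Metric.ball c R)) (hS : ∀ w ∈ Metric.ball c R, ‖g w‖ ≤ S)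
    (hw : w ∈ Metric.ball c R) : ‖g w - g c‖ ≤ 2 * S / R * ‖w - c‖ := by
  have hR : 0 < R := Metric.pos_of_mem_ball hw
  have := Complex.dist_le_div_mul_dist_of_mapsTo_ball (R₂ := 2 * S) hg (fun v hv => ?_) hw
  · rwa [dist_eq_norm, dist_eq_norm] at this
  · rw [mem_closedBall_iff_norm]
    have h1 := hS v hv
    have h2 := hS c (Metric.mem_ball_self hR)
    linarith [norm_sub_le (g v) (g c)]

/-- Oscillation of `f(ζ) (1 - conj ζ z)^{-M}` on a piece. -/
theorem norm_kernel_osc_le (hK : 2 ≤ K) {N j l a b : ℕ} (hN : 36 * K ^ 2 < N) (ha : a < N)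
    (hb : b < N) {f : ℂ → ℂ} (hf : DifferentiableOn ℂ f (Metric.ball 0 1)) {ζ ζ' z : ℂ}
    (h : InPiece K N j l a b ζ) (h' : InPiece K N j l a b ζ') (hz : ‖z‖ < 1) (M : ℕ) :
    ‖f ζ * (1 / (1 - (starRingEnd ℂ) ζ * z) ^ M) - f ζ' * (1 / (1 - (starRingEnd ℂ) ζ' * z) ^ M)‖ ≤
      24 * K * (1 + 6 * K) ^ M / Real.sqrt N * ((cellSup K f j l).toReal *
        ‖1 - (starRingEnd ℂ) (corner K j l) * z‖⁻¹ ^ M) := by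
  have hN1 : 1 ≤ N := by omega
  have hK0 : (0 : ℝ) < K := by exact_mod_cast (by omega : 0 < K)
  -- This makes the diameter bound 3K^{-j}/√N of a piece smaller than the radius K^{-(j+1)}/2 on
  -- which the Schwarz lemma is applied.
  have hs : 6 * (K : ℝ) < Real.sqrt N := by
    refine Real.lt_sqrt_of_sq_lt ?_
    have : ((36 * K ^ 2 : ℕ) : ℝ) < N := by exact_mod_cast hN
    push_cast at this
    linarith
  have hs0 : 0 < Real.sqrt N := by linarith
  have hl := level_pos hK (j + 1)
  have hl' := level_succ hK j
  set R := level K (j + 1) / 2 with hR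
  have hR0 : 0 < R := by positivity
  have hdist : ‖ζ - ζ'‖ ≤ 3 * level K j / Real.sqrt N := h.dist_le hK hN1 ha h'
  have hdR : ‖ζ - ζ'‖ < R := by
    refine hdist.trans_lt ?_
    rw [div_lt_iff₀ hs0, ← hl', hR]
    nlinarith
  have hball : ∀ w ∈ Metric.ball ζ' R, w ∈ cellRegion K j l := fun w hw =>
    mem_cellRegion_of_dist_lt hK hN1 ha hb h' (by simpa [dist_eq_norm] using (Metric.mem_ball.1 hw).le)
  have hball1 : Metric.ball ζ' R ⊆ Metric.ball 0 1 := fun w hw => by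
    have := (hball w hw).2
    rw [mem_ball_zero_iff]
    linarith
  set S := (cellSup K f j l).toReal with hS
  set κ := ‖1 - (starRingEnd ℂ) (corner K j l) * z‖⁻¹ with hκ
  have hfS : ∀ w ∈ Metric.ball ζ' R, ‖f w‖ ≤ S := fun w hw =>
    norm_le_toReal_cellSup hK hf.continuousOn (hball w hw)
  have hmem : ζ ∈ Metric.ball ζ' R := by simpa [dist_eq_norm] using hdR
  have hmem' : ζ' ∈ Metric.ball ζ' R := Metric.mem_ball_self hR0
  have hfo := norm_sub_le_of_norm_le (hf.mono hball1) hfS hmem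
  set H := ((1 + 6 * K) * κ) ^ M with hH
  have hker : ∀ w ∈ Metric.ball ζ' R, 0 < ‖1 - (starRingEnd ℂ) w * z‖ ∧
      ‖1 / (1 - (starRingEnd ℂ) w * z) ^ M‖ ≤ H := by
    intro w hw
    have h1 := norm_kernel_corner_le hK (hball w hw) hz.le
    have h2 := one_sub_mul_le_norm_one_sub_conj_mul (corner K j l) z
    have h3 : ‖corner K j l‖ * ‖z‖ < 1 := by
      rw [norm_corner hK]
      nlinarith [level_pos hK j, level_le_one hK j, norm_nonneg z]
    have h4 : 0 < ‖1 - (starRingEnd ℂ) w * z‖ := by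
      by_contra hc
      have : (1 + 6 * (K : ℝ)) * ‖1 - (starRingEnd ℂ) w * z‖ ≤ 0 :=
        mul_nonpos_of_nonneg_of_nonpos (by positivity) (not_lt.1 hc)
      linarith
    refine ⟨h4, ?_⟩
    rw [norm_div, norm_one, norm_pow, ← one_div_pow, hH]
    refine pow_le_pow_left₀ (by positivity) ?_ M
    rw [hκ, ← div_eq_mul_inv, div_le_div_iff₀ h4 (by linarith)]
    linarith
  have hho : ‖1 / (1 - (starRingEnd ℂ) ζ * z) ^ M - 1 / (1 - (starRingEnd ℂ) ζ' * z) ^ M‖ ≤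
      2 * H / R * ‖ζ - ζ'‖ := by
    -- The kernel is antiholomorphic in ζ, so the Schwarz lemma is applied in the conjugate
    -- variable.
    have hconj : ∀ v ∈ Metric.ball ((starRingEnd ℂ) ζ') R, (starRingEnd ℂ) v ∈ Metric.ball ζ' R := by
      intro v hv
      rw [mem_ball_iff_norm] at hv ⊢
      rw [← RCLike.norm_conj]
      simpa using hv
    have := norm_sub_le_of_norm_le (g := fun v => 1 / (1 - v * z) ^ M) (c := (starRingEnd ℂ) ζ')
      (w := (starRingEnd ℂ) ζ) (R := R) (S := H) ?_ ?_ ?_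
    · rwa [← map_sub, RCLike.norm_conj] at this
    · intro v hv
      have := (hker _ (hconj v hv)).1
      rw [Complex.conj_conj] at this
      refine DifferentiableAt.differentiableWithinAt ?_
      refine DifferentiableAt.div (by fun_prop) (by fun_prop) (pow_ne_zero _ (norm_pos_iff.1 this))
    · intro v hv
      have := (hker _ (hconj v hv)).2
      rwa [Complex.conj_conj] at this
    · rw [mem_ball_iff_norm, ← map_sub, RCLike.norm_conj]
      exact hdR
  have hS0 : 0 ≤ S := ENNReal.toReal_nonneg
  have hH0 : 0 ≤ H := (norm_nonneg _).trans (hker ζ hmem).2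
  calc _ = ‖(f ζ - f ζ') * (1 / (1 - (starRingEnd ℂ) ζ * z) ^ M) +
        f ζ' * (1 / (1 - (starRingEnd ℂ) ζ * z) ^ M - 1 / (1 - (starRingEnd ℂ) ζ' * z) ^ M)‖ := by
        congr 1; ring
    _ ≤ (2 * S / R * ‖ζ - ζ'‖) * H + S * (2 * H / R * ‖ζ - ζ'‖) := by
        refine (norm_add_le _ _).trans ?_
        rw [norm_mul, norm_mul]
        gcongr
        · exact (hker ζ hmem).2
        · exact hfS ζ' hmem'
    _ = 4 * S * H / R * ‖ζ - ζ'‖ := by ring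
    _ ≤ 4 * S * H / R * (3 * level K j / Real.sqrt N) := by gcongr
    _ = _ := by
        rw [hR, hH, ← hl', mul_pow]
        field_simp
        ring

end cut

/-! ### Discretization of the reproducing formula -/

theorem norm_integral_sub_sum_le {F : ℝ → ℂ} {u : ℕ → ℝ} {n : ℕ} {v : ℕ → ℂ} {e : ℕ → ℝ}
    (hF : ∀ k < n, IntervalIntegrable F volume (u k) (u (k + 1)))
    (h : ∀ k < n, ‖(∫ t in u k..u (k + 1), F t) - v k‖ ≤ e k) :
    ‖(∫ t in u 0..u n, F t) - ∑ k ∈ Finset.range n, v k‖ ≤ ∑ k ∈ Finset.range n, e k := by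
  rw [← intervalIntegral.sum_integral_adjacent_intervals hF, ← Finset.sum_sub_distrib]
  exact norm_sum_le_of_le _ fun k hk => h k (Finset.mem_range.1 hk)

theorem norm_integral_sub_le_of_norm_sub_le {g : ℝ → ℂ} {x y : ℝ} (hxy : x ≤ y) {v : ℂ} {e : ℝ}
    (hg : IntervalIntegrable g volume x y) (h : ∀ t ∈ Set.Icc x y, ‖g t - v‖ ≤ e) :
    ‖(∫ t in x..y, g t) - ((y - x : ℝ) : ℂ) * v‖ ≤ (y - x) * e := by
  have : ((y - x : ℝ) : ℂ) * v = ∫ _t in x..y, v := by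
    rw [intervalIntegral.integral_const, Complex.real_smul]
  rw [this, ← intervalIntegral.integral_sub hg intervalIntegrable_const]
  refine (intervalIntegral.norm_integral_le_of_norm_le_const (C := e) fun t ht => ?_).trans
    (le_of_eq ?_)
  · rw [Set.uIoc_of_le hxy] at ht
    exact h t ⟨ht.1.le, ht.2⟩
  · rw [abs_of_nonneg (sub_nonneg.2 hxy), mul_comm]

section

variable {K : ℕ}

theorem norm_integral_angle_sub_sum_le (hK : 2 ≤ K) {N : ℕ} (hN : 1 ≤ N) (j : ℕ) {g : ℝ → ℂ}
    (hg : Continuous g) {v : ℕ → ℕ → ℂ} {e : ℕ → ℝ}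
    (h : ∀ l < K ^ (j + 3), ∀ b < N, ∀ t ∈ Set.Icc (cutAngle K j N l b) (cutAngle K j N l (b + 1)),
      ‖g t - v l b‖ ≤ e l) :
    ‖(∫ t in (0 : ℝ)..2 * Real.pi, g t) - ∑ l ∈ Finset.range (K ^ (j + 3)), ∑ b ∈ Finset.range N,
      ((2 * Real.pi / ((K : ℝ) ^ (j + 3) * N) : ℝ) : ℂ) * v l b‖ ≤
      ∑ l ∈ Finset.range (K ^ (j + 3)), 2 * Real.pi / (K : ℝ) ^ (j + 3) * e l := by
  have hK0 : (0 : ℝ) < K := by exact_mod_cast (by omega : 0 < K)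
  have hN0 : (0 : ℝ) < N := by exact_mod_cast hN
  have hii : ∀ x y : ℝ, IntervalIntegrable g volume x y := fun x y => hg.intervalIntegrable x y
  have h1 := norm_integral_sub_sum_le (F := g) (n := K ^ (j + 3))
    (u := fun l => 2 * Real.pi * ((l : ℝ) / (K : ℝ) ^ (j + 3)))
    (v := fun l => ∑ b ∈ Finset.range N, ((2 * Real.pi / ((K : ℝ) ^ (j + 3) * N) : ℝ) : ℂ) * v l b)
    (e := fun l => 2 * Real.pi / (K : ℝ) ^ (j + 3) * e l) (fun k _ => hii _ _) ?_
  · have e1 : 2 * Real.pi * (((0 : ℕ) : ℝ) / (K : ℝ) ^ (j + 3)) = 0 := by simp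
    have e2 : 2 * Real.pi * (((K ^ (j + 3) : ℕ) : ℝ) / (K : ℝ) ^ (j + 3)) = 2 * Real.pi := by
      push_cast
      rw [div_self (by positivity), mul_one]
    simp only [e1, e2] at h1
    exact h1
  · intro l hl
    have h2 := norm_integral_sub_sum_le (F := g) (n := N) (u := cutAngle K j N l)
      (v := fun b => ((2 * Real.pi / ((K : ℝ) ^ (j + 3) * N) : ℝ) : ℂ) * v l b)
      (e := fun _ => 2 * Real.pi / ((K : ℝ) ^ (j + 3) * N) * e l) (fun k _ => hii _ _) ?_
    · rw [cutAngle_zero, cutAngle_self _ _ hN] at h2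
      refine h2.trans (le_of_eq ?_)
      rw [Finset.sum_const, Finset.card_range, nsmul_eq_mul]
      field_simp
    · intro b hb
      have h3 := cutAngle_mono (K := K) j N l (Nat.le_succ b)
      rw [← cutAngle_succ_sub j N l b]
      exact norm_integral_sub_le_of_norm_sub_le h3 (hii _ _) (h l hl b hb)

/-- The weighted area of a piece with radial index `a` at level `j`. -/
def pieceWeight (K N d j a : ℕ) : ℝ :=
  (∫ r in cutAt K j N a..cutAt K j N (a + 1), radialDensity d r) / ((K : ℝ) ^ (j + 3) * N)

theorem radialDensity_nonneg (d : ℕ) {r : ℝ} (h0 : 0 ≤ r) (h1 : r ≤ 1) : 0 ≤ radialDensity d r := by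
  unfold radialDensity
  have : 0 ≤ 1 - r ^ 2 := by nlinarith
  positivity

theorem radialDensity_le (d : ℕ) {r s : ℝ} (h0 : 0 ≤ r) (h1 : r ≤ 1) (h : 1 - r ≤ s) :
    radialDensity d r ≤ (d + 1) * 2 ^ (d + 1) * s ^ d := by
  have h2 : 0 ≤ 1 - r ^ 2 := by nlinarith
  have h3 : 1 - r ^ 2 ≤ 2 * s := by nlinarith
  have h4 : 0 ≤ s := by linarith
  calc radialDensity d r ≤ (d + 1) * (2 * s) ^ d * (2 * 1) := by
        unfold radialDensity
        gcongr
    _ = _ := by rw [mul_pow, pow_succ]; ring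

theorem integral_radialDensity_le (hK : 2 ≤ K) (d j : ℕ) {x y : ℝ} (hxy : x ≤ y)
    (hx : dyadicRadius K j ≤ x) (hy : y ≤ dyadicRadius K (j + 1)) :
    ∫ r in x..y, radialDensity d r ≤ (d + 1) * 2 ^ (d + 1) * level K j ^ (d + 1) := by
  have h0 := dyadicRadius_nonneg hK j
  have h1 := dyadicRadius_lt_one hK (j + 1)
  have hl := level_pos hK j
  have h2 : ∫ r in x..y, radialDensity d r ≤ ∫ _r in x..y, (d + 1) * 2 ^ (d + 1) * level K j ^ d := by
    refine intervalIntegral.integral_mono_on hxy ((continuous_radialDensity d).intervalIntegrable _ _)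
      intervalIntegrable_const fun r hr => ?_
    refine radialDensity_le d (by linarith [hr.1]) (by linarith [hr.2]) ?_
    rw [dyadicRadius_eq] at hx
    linarith [hr.1]
  refine h2.trans ?_
  rw [intervalIntegral.integral_const, smul_eq_mul, pow_succ (level K j)]
  have h3 : y - x ≤ level K j := by
    rw [dyadicRadius_eq] at hx hy
    linarith [level_pos hK (j + 1)]
  calc (y - x) * ((d + 1) * 2 ^ (d + 1) * level K j ^ d) ≤
        level K j * ((d + 1) * 2 ^ (d + 1) * level K j ^ d) := by gcongr
    _ = _ := by ring

theorem integral_radialDensity_cut_nonneg (hK : 2 ≤ K) {N : ℕ} (hN : 1 ≤ N) (d j : ℕ) {a : ℕ}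
    (ha : a < N) : 0 ≤ ∫ r in cutAt K j N a..cutAt K j N (a + 1), radialDensity d r := by
  refine intervalIntegral.integral_nonneg (cutAt_mono hK j N (Nat.le_succ a)) fun r hr => ?_
  refine radialDensity_nonneg d ((dyadicRadius_nonneg hK j).trans
    ((dyadicRadius_le_cutAt hK j N a).trans hr.1)) ?_
  exact hr.2.trans ((cutAt_le_dyadicRadius hK j hN ha).trans (dyadicRadius_lt_one hK _).le)

theorem one_div_pow_le_level (hK : 2 ≤ K) (j : ℕ) : 1 / (K : ℝ) ^ (j + 3) ≤ level K j := by
  have := level_anti hK (show j ≤ j + 3 by omega)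
  rwa [level, ← one_div] at this

theorem pieceWeight_nonneg (hK : 2 ≤ K) {N : ℕ} (hN : 1 ≤ N) (d j : ℕ) {a : ℕ} (ha : a < N) :
    0 ≤ pieceWeight K N d j a :=
  div_nonneg (integral_radialDensity_cut_nonneg hK hN d j ha) (by positivity)

/-- The radial integral is O(K^{-j(d+1)}) and the angular factor is at most K^{-j}, giving K^{-2nj}
when d + 2 = 2n. -/
theorem pieceWeight_le (hK : 2 ≤ K) {N : ℕ} (hN : 1 ≤ N) (d j : ℕ) {a : ℕ} (ha : a < N) :
    pieceWeight K N d j a ≤ (d + 1) * 2 ^ (d + 1) * level K j ^ (d + 2) := by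
  have hK0 : (0 : ℝ) < K := by exact_mod_cast (by omega : 0 < K)
  have hN0 : (1 : ℝ) ≤ N := by exact_mod_cast hN
  have h1 := integral_radialDensity_le hK d j (cutAt_mono hK j N (Nat.le_succ a))
    (dyadicRadius_le_cutAt hK j N a) (cutAt_le_dyadicRadius hK j hN ha)
  have h2 : ((K : ℝ) ^ (j + 3) * N)⁻¹ ≤ level K j := by
    refine le_trans ?_ (one_div_pow_le_level hK j)
    rw [one_div]
    exact inv_anti₀ (by positivity) (le_mul_of_one_le_right (by positivity) hN0)
  have hl := level_pos hK j
  rw [pieceWeight, div_eq_mul_inv]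
  calc _ ≤ ((d + 1) * 2 ^ (d + 1) * level K j ^ (d + 1)) * level K j := by
        refine mul_le_mul h1 h2 (by positivity) (by positivity)
    _ = _ := by ring

/-- The integrand of the reproducing formula. -/
def kernelMul (d : ℕ) (f : ℂ → ℂ) (z ζ : ℂ) : ℂ := f ζ * (1 / (1 - (starRingEnd ℂ) ζ * z) ^ (d + 2))

theorem continuousOn_kernelMul {d : ℕ} {f : ℂ → ℂ} (hf : ContinuousOn f (Metric.ball 0 1)) {z : ℂ}
    (hz : ‖z‖ < 1) : ContinuousOn (kernelMul d f z) (Metric.ball 0 1) := by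
  unfold kernelMul
  refine hf.mul (ContinuousOn.div (by fun_prop) (by fun_prop) fun ζ hζ => pow_ne_zero _ ?_)
  have h1 : ‖ζ‖ < 1 := by simpa using hζ
  have h2 := one_sub_mul_le_norm_one_sub_conj_mul ζ z
  rw [← norm_pos_iff]
  nlinarith [norm_nonneg ζ, norm_nonneg z]

/-- The discretization error of the reproducing formula on one level. -/
theorem norm_level_error_le (hK : 2 ≤ K) {N : ℕ} (hN : 36 * K ^ 2 < N) (d j : ℕ) {f : ℂ → ℂ}
    (hf : DifferentiableOn ℂ f (Metric.ball 0 1)) {z : ℂ} (hz : ‖z‖ < 1) {D : ℝ → ℂ}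
    (hD : ContinuousOn D (Set.Icc 0 1))
    (hDf : ∀ r ∈ Set.Ioo (0 : ℝ) 1, D r = Real.circleAverage (kernelMul d f z) 0 r) :
    ‖(∫ r in dyadicRadius K j..dyadicRadius K (j + 1), radialDensity d r • D r) -
      ∑ x : LevelIndex K N j, (pieceWeight K N d j x.2.1 : ℂ) *
        kernelMul d f z (pieceCenter K N ⟨j, x⟩)‖ ≤
      24 * K * (1 + 6 * K) ^ (d + 2) * ((d + 1) * 2 ^ (d + 1)) / Real.sqrt N *
        (level K j ^ (d + 2) * ∑ l : Fin (K ^ (j + 3)), (cellSup K f j l).toReal *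
          ‖1 - (starRingEnd ℂ) (corner K j l) * z‖⁻¹ ^ (d + 2)) := by
  have hN1 : 1 ≤ N := by omega
  have hK0 : (0 : ℝ) < K := by exact_mod_cast (by omega : 0 < K)
  have hN0 : (0 : ℝ) < N := by exact_mod_cast hN1
  set cen : ℕ → ℕ → ℕ → ℂ := fun a l b => circleMap 0
      ((cutAt K j N a + cutAt K j N (a + 1)) / 2)
      ((cutAngle K j N l b + cutAngle K j N l (b + 1)) / 2) with hcen
  set ε := 24 * K * (1 + 6 * K) ^ (d + 2) / Real.sqrt N with hε
  set e : ℕ → ℝ := fun l => ε * ((cellSup K f j l).toReal *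
          ‖1 - (starRingEnd ℂ) (corner K j l) * z‖⁻¹ ^ (d + 2)) with he
  set V : ℕ → ℂ := fun a => ∑ l ∈ Finset.range (K ^ (j + 3)), ∑ b ∈ Finset.range N,
    ((1 / ((K : ℝ) ^ (j + 3) * N) : ℝ) : ℂ) * kernelMul d f z (cen a l b) with hV
  set X := ∑ l ∈ Finset.range (K ^ (j + 3)), 1 / (K : ℝ) ^ (j + 3) * e l with hX
  have hcutle : ∀ a < N, cutAt K j N (a + 1) ≤ dyadicRadius K (j + 1) := fun a ha =>
    cutAt_le_dyadicRadius hK j hN1 ha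
  have hr1 := dyadicRadius_lt_one hK (j + 1)
  have hr0 := dyadicRadius_nonneg hK j
  -- For r fixed in a radial piece, the circle average is compared with the angular sum over the
  -- centres. The oscillation bound allows different radii inside one piece, so `V a` does not
  -- depend on r.
  have hDV : ∀ a < N, ∀ r ∈ Set.Ioc (cutAt K j N a) (cutAt K j N (a + 1)), ‖D r - V a‖ ≤ X := by
    intro a ha r hr
    have hrpos : 0 < r := (hr0.trans (dyadicRadius_le_cutAt hK j N a)).trans_lt hr.1
    have hrlt : r < 1 := hr.2.trans_lt ((hcutle a ha).trans_lt hr1)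
    have hg : Continuous fun t => kernelMul d f z (circleMap 0 r t) :=
      (continuousOn_kernelMul hf.continuousOn hz).comp_continuous (continuous_circleMap 0 r) fun t => by
        simpa [abs_of_pos hrpos] using hrlt
    have h1 := norm_integral_angle_sub_sum_le hK hN1 j hg (v := fun l b => kernelMul d f z (cen a l b))
      (e := e) (fun l _ b hb t ht => by
        have hm := cutAt_mono hK j N (Nat.le_succ a)
        have hm' := cutAngle_mono (K := K) j N l (Nat.le_succ b)
        simp only [Nat.succ_eq_add_one] at hm hm'
        have hin : InPiece K N j l a b (circleMap 0 r t) := ⟨r, ⟨hr.1.le, hr.2⟩, t, ht, rfl⟩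
        have hin' : InPiece K N j l a b (cen a l b) :=
          ⟨_, ⟨by linarith, by linarith⟩, _, ⟨by linarith, by linarith⟩, rfl⟩
        exact norm_kernel_osc_le hK hN ha hb hf hin hin' hz (d + 2))
    have e1 : D r - V a = (((2 * Real.pi)⁻¹ : ℝ) : ℂ) *
        ((∫ t in (0 : ℝ)..2 * Real.pi, kernelMul d f z (circleMap 0 r t)) -
        ∑ l ∈ Finset.range (K ^ (j + 3)), ∑ b ∈ Finset.range N,
        ((2 * Real.pi / ((K : ℝ) ^ (j + 3) * N) : ℝ) : ℂ) * kernelMul d f z (cen a l b)) := by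
      rw [hDf r ⟨hrpos, hrlt⟩, Real.circleAverage_def, Complex.real_smul, mul_sub, Finset.mul_sum, hV]
      congr 1
      refine Finset.sum_congr rfl fun l _ => ?_
      rw [Finset.mul_sum]
      refine Finset.sum_congr rfl fun b _ => ?_
      rw [← mul_assoc, ← Complex.ofReal_mul]
      congr 2
      field_simp
    rw [e1, norm_mul, Complex.norm_real, Real.norm_of_nonneg (by positivity)]
    calc _ ≤ (2 * Real.pi)⁻¹ * ∑ l ∈ Finset.range (K ^ (j + 3)), 2 * Real.pi / (K : ℝ) ^ (j + 3) * e l := by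
          gcongr
      _ = X := by
          rw [hX, Finset.mul_sum]
          refine Finset.sum_congr rfl fun l _ => ?_
          field_simp
  have hii : ∀ x y : ℝ, 0 ≤ x → x ≤ y → y ≤ 1 →
      IntervalIntegrable (fun r => radialDensity d r • D r) volume x y := by
    intro x y hx hxy hy
    refine ContinuousOn.intervalIntegrable ?_
    rw [Set.uIcc_of_le hxy]
    exact (continuous_radialDensity d).continuousOn.smul (hD.mono (Set.Icc_subset_Icc hx hy))
  have hφ : ∀ x y : ℝ, IntervalIntegrable (radialDensity d) volume x y := fun x y =>
    (continuous_radialDensity d).intervalIntegrable x y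
  -- The density is integrated exactly over each radial piece; the whole error comes from replacing
  -- `D r` by `V a`.
  have hmain := norm_integral_sub_sum_le (F := fun r => radialDensity d r • D r) (n := N)
    (u := cutAt K j N)
    (v := fun a => ((∫ r in cutAt K j N a..cutAt K j N (a + 1), radialDensity d r : ℝ) : ℂ) * V a)
    (e := fun a => (∫ r in cutAt K j N a..cutAt K j N (a + 1), radialDensity d r) * X) ?_ ?_
  rotate_left
  · intro a ha
    exact hii _ _ (hr0.trans (dyadicRadius_le_cutAt hK j N a)) (cutAt_mono hK j N (Nat.le_succ a))
      ((hcutle a ha).trans hr1.le)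
  · intro a ha
    have hm := cutAt_mono hK j N (Nat.le_succ a)
    have ha0 := hr0.trans (dyadicRadius_le_cutAt hK j N a)
    simp only [Nat.succ_eq_add_one] at hm
    have e1 : ((∫ r in cutAt K j N a..cutAt K j N (a + 1), radialDensity d r : ℝ) : ℂ) * V a =
        ∫ r in cutAt K j N a..cutAt K j N (a + 1), radialDensity d r • V a := by
      rw [intervalIntegral.integral_smul_const, Complex.real_smul]
    have hV' : IntervalIntegrable (fun r => radialDensity d r • V a) volume (cutAt K j N a)
        (cutAt K j N (a + 1)) :=
      ((continuous_radialDensity d).smul continuous_const).intervalIntegrable _ _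
    rw [e1, ← intervalIntegral.integral_sub (hii _ _ ha0 hm ((hcutle a ha).trans hr1.le)) hV',
      ← intervalIntegral.integral_mul_const]
    refine intervalIntegral.norm_integral_le_of_norm_le hm ?_ ((hφ _ _).mul_const _)
    refine Filter.Eventually.of_forall fun r hr => ?_
    rw [← smul_sub, norm_smul, Real.norm_of_nonneg (radialDensity_nonneg d (ha0.trans hr.1.le)
      (hr.2.trans ((hcutle a ha).trans hr1.le)))]
    exact mul_le_mul_of_nonneg_left (hDV a ha r hr) (radialDensity_nonneg d (ha0.trans hr.1.le)
      (hr.2.trans ((hcutle a ha).trans hr1.le)))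
  rw [cutAt_zero hK, cutAt_self hK j hN1] at hmain
  have e2 : ∑ x : LevelIndex K N j, (pieceWeight K N d j x.2.1 : ℂ) *
        kernelMul d f z (pieceCenter K N ⟨j, x⟩) = ∑ a ∈ Finset.range N,
      ((∫ r in cutAt K j N a..cutAt K j N (a + 1), radialDensity d r : ℝ) : ℂ) * V a := by
    rw [Finset.sum_range, Fintype.sum_prod_type_right]
    simp_rw [Fintype.sum_prod_type]
    refine Finset.sum_congr rfl fun a _ => ?_
    rw [hV, Finset.mul_sum, Finset.sum_comm, Finset.sum_range]
    refine Finset.sum_congr rfl fun l _ => ?_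
    rw [Finset.mul_sum, Finset.sum_range]
    refine Finset.sum_congr rfl fun b _ => ?_
    rw [pieceCenter_eq, ← mul_assoc, ← Complex.ofReal_mul, pieceWeight, mul_one_div]
  rw [e2]
  refine hmain.trans ?_
  have hX0 : 0 ≤ X := by
    rw [hX]
    refine Finset.sum_nonneg fun l _ => ?_
    rw [he]
    positivity
  rw [← Finset.sum_mul, intervalIntegral.sum_integral_adjacent_intervals (fun k _ => hφ _ _),
    cutAt_zero hK, cutAt_self hK j hN1]
  have hl := level_pos hK j
  have h5 : X ≤ level K j * (ε * ∑ l : Fin (K ^ (j + 3)), (cellSup K f j l).toReal *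
          ‖1 - (starRingEnd ℂ) (corner K j l) * z‖⁻¹ ^ (d + 2)) := by
    rw [hX, ← Finset.mul_sum, Finset.sum_range, Finset.mul_sum (a := ε)]
    have := one_div_pow_le_level hK j
    gcongr
  calc _ ≤ ((d + 1) * 2 ^ (d + 1) * level K j ^ (d + 1)) *
        (level K j * (ε * ∑ l : Fin (K ^ (j + 3)), (cellSup K f j l).toReal *
          ‖1 - (starRingEnd ℂ) (corner K j l) * z‖⁻¹ ^ (d + 2))) := by
        refine mul_le_mul (integral_radialDensity_le hK d j (dyadicRadius_mono hK (Nat.le_succ j))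
          le_rfl le_rfl) h5 hX0 (by positivity)
    _ = _ := by rw [hε]; ring

/-- The discretization error of the reproducing formula. -/
theorem enorm_sub_tsum_le (hK : 2 ≤ K) {N : ℕ} (hN : 36 * K ^ 2 < N) (d : ℕ) {f : ℂ → ℂ}
    (hf : DifferentiableOn ℂ f (Metric.ball 0 1)) {z : ℂ} (hz : ‖z‖ < 1)
    (hs : Summable fun i : PieceIndex K N => (pieceWeight K N d i.1 i.2.2.1 : ℂ) *
      kernelMul d f z (pieceCenter K N i)) :
    ‖f z - ∑' i : PieceIndex K N, (pieceWeight K N d i.1 i.2.2.1 : ℂ) *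
      kernelMul d f z (pieceCenter K N i)‖ₑ ≤
      ENNReal.ofReal (24 * K * (1 + 6 * K) ^ (d + 2) * ((d + 1) * 2 ^ (d + 1)) / Real.sqrt N) *
      ∑' j, ((K : ℝ≥0∞) ^ j)⁻¹ ^ (d + 2) *
        ∑ l : Fin (K ^ (j + 3)), cellSup K f j l * kerAbs (corner K j l) z ^ (d + 2) := by
  obtain ⟨D, hD, hDf, hDi⟩ := exists_integral_radialDensity_circleAverage hf d hz
  have hcont : ContinuousOn (fun r => radialDensity d r • D r) (Set.Icc 0 1) :=
    (continuous_radialDensity d).continuousOn.smul hD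
  -- Only the one-dimensional integral of the continuous function `D` is cut into blocks, so again
  -- no area integrability of f is needed.
  have h1 : HasSum (fun j => ∫ r in dyadicRadius K j..dyadicRadius K (j + 1), radialDensity d r • D r)
      (f z) := by
    have h2 := hasSum_integral_iUnion (μ := volume) (f := fun r => radialDensity d r • D r)
      (s := fun j => Set.Ioc (dyadicRadius K j) (dyadicRadius K (j + 1)))
      (fun _ => measurableSet_Ioc)
      (Monotone.pairwise_disjoint_on_Ioc_succ fun _ _ h => dyadicRadius_mono hK h) ?_
    · rw [iUnion_Ioc_dyadicRadius hK, ← integral_Ioc_eq_integral_Ioo,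
        ← intervalIntegral.integral_of_le zero_le_one, hDi] at h2
      refine h2.congr_fun ?_
      intro j
      exact intervalIntegral.integral_of_le (dyadicRadius_mono hK (Nat.le_succ j))
    · rw [iUnion_Ioc_dyadicRadius hK]
      exact (hcont.integrableOn_Icc).mono_set Set.Ioo_subset_Icc_self
  have h3 := hs.hasSum.sigma (g := fun j => ∑ x : LevelIndex K N j, (pieceWeight K N d j x.2.1 : ℂ) *
        kernelMul d f z (pieceCenter K N ⟨j, x⟩)) fun j => hasSum_fintype _
  rw [← (h1.sub h3).tsum_eq, ← ENNReal.tsum_mul_left]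
  refine enorm_tsum_le_tsum_enorm.trans (ENNReal.tsum_le_tsum fun j => ?_)
  have hz' : ∀ l : ℕ, ‖corner K j l‖ * ‖z‖ < 1 := fun l => by
    rw [norm_corner hK]
    nlinarith [level_pos hK j, level_le_one hK j, norm_nonneg z]
  have hl := level_pos hK j
  have h4 := ENNReal.ofReal_le_ofReal (norm_level_error_le hK hN d j hf hz hD hDf)
  rw [ofReal_norm] at h4
  refine h4.trans (le_of_eq ?_)
  rw [ENNReal.ofReal_mul (by positivity), ENNReal.ofReal_mul (by positivity),
    ENNReal.ofReal_pow hl.le, ofReal_level hK, ENNReal.ofReal_sum_of_nonneg fun l _ => by positivity]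
  congr 2
  refine Finset.sum_congr rfl fun l _ => ?_
  rw [ENNReal.ofReal_mul ENNReal.toReal_nonneg,
    ENNReal.ofReal_toReal (cellSup_ne_top hK hf.continuousOn j l), ENNReal.ofReal_pow (by positivity),
    ← kerAbs_eq_ofReal (hz' l)]

end

/-! ### Atoms and the functions they generate -/

/-- The hypotheses under which sums of atoms of exponent `2n` are controlled by their
coefficients. -/
structure AtomicParams (p : ℝ≥0∞) (q : ℝ) (ω : ℝ → ℝ) (K B n : ℕ) : Prop where
  p_pos : 0 < p
  q_pos : 0 < q
  two_le : 2 ≤ K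
  weightAt_le : ∀ j, weightAt ω K j ≤ (K : ℝ≥0∞) ^ B * weightAt ω K (j + 1)
  ne_zero : omegaHat ω 0 ≠ 0
  ne_top : omegaHat ω 0 ≠ ∞
  lower : LowerDoublingWith ω K
  two_le_exp : 2 ≤ n
  two_le_mul : p ≠ ∞ → 2 ≤ n * p.toReal
  le_mul : (B : ℝ) + 1 ≤ (2 * (n : ℝ) - 1 - (p⁻¹).toReal) * q

theorem finiteNorm_eq {ι : Type} [Fintype ι] [MeasurableSpace ι] [MeasurableSingletonClass ι]
    (p : ℝ≥0∞) (c : ι → ℂ) : finiteNorm p c = lpFun p Measure.count fun i => ‖c i‖ₑ := by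
  unfold finiteNorm lpFun
  split_ifs
  · rfl
  · rw [lintegral_count, tsum_fintype]

theorem lpFun_count_sum_le {ι κ : Type} [Fintype ι] [Fintype κ] [MeasurableSpace ι]
    [MeasurableSingletonClass ι] [MeasurableSpace κ] [MeasurableSingletonClass κ] {p : ℝ≥0∞}
    (hp0 : 0 < p) (F : ι × κ → ℝ≥0∞) :
    lpFun p Measure.count (fun i => ∑ x, F (i, x)) ≤
      Fintype.card κ * lpFun p Measure.count F := by
  by_cases hp : p = ∞
  · subst hp
    simp only [lpFun_top]
    refine iSup_le fun i => ?_
    calc ∑ x, F (i, x) ≤ ∑ _x : κ, ⨆ y, F y := Finset.sum_le_sum fun x _ => le_iSup F (i, x)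
      _ = _ := by rw [Finset.sum_const, Finset.card_univ, nsmul_eq_mul]
  · have hpp := ENNReal.toReal_pos hp0.ne' hp
    rw [← ENNReal.rpow_le_rpow_iff hpp, ENNReal.mul_rpow_of_nonneg _ _ hpp.le,
      lpFun_count_rpow hp0 hp, lpFun_count_rpow hp0 hp, Fintype.sum_prod_type, Finset.mul_sum]
    refine Finset.sum_le_sum fun i _ => ?_
    simpa using ENNReal.sum_mul_rpow_le (fun _ : κ => (1 : ℝ≥0∞)) (fun x => F (i, x)) hpp

theorem lpFun_count_comp_fst {ι κ : Type} [Fintype ι] [Fintype κ] [MeasurableSpace ι]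
    [MeasurableSingletonClass ι] [MeasurableSpace κ] [MeasurableSingletonClass κ] {p : ℝ≥0∞}
    (hp0 : 0 < p) (a : ι → ℝ≥0∞) :
    lpFun p Measure.count (fun x : ι × κ => a x.1) ≤
      (Fintype.card κ : ℝ≥0∞) ^ (p⁻¹).toReal * lpFun p Measure.count a := by
  by_cases hp : p = ∞
  · subst hp
    simp only [lpFun_top, ENNReal.inv_top, ENNReal.toReal_zero, ENNReal.rpow_zero, one_mul]
    exact iSup_le fun x => le_iSup a x.1
  · have hpp := ENNReal.toReal_pos hp0.ne' hp
    rw [← ENNReal.rpow_le_rpow_iff hpp, ENNReal.mul_rpow_of_nonneg _ _ hpp.le,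
      lpFun_count_rpow hp0 hp, lpFun_count_rpow hp0 hp, Fintype.sum_prod_type, Finset.mul_sum,
      ← ENNReal.rpow_mul, ENNReal.toReal_inv, inv_mul_cancel₀ hpp.ne', ENNReal.rpow_one]
    refine Finset.sum_le_sum fun i _ => ?_
    simp

section

variable {p : ℝ≥0∞} {q : ℝ} {ω : ℝ → ℝ} {K B n N : ℕ}

theorem seqNorm_rpow (hq : 0 < q) (c : PieceIndex K N → ℂ) : seqNorm p q c ^ q =
    ∑' j, lpFun p Measure.count (fun x : LevelIndex K N j => ‖c ⟨j, x⟩‖ₑ) ^ q := by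
  rw [seqNorm, ← ENNReal.rpow_mul, one_div_mul_cancel hq.ne', ENNReal.rpow_one]
  simp_rw [finiteNorm_eq]

/-- The sums of the moduli of coefficients over each rectangle `Q_{j,l}`. -/
def coarsen (c : PieceIndex K N → ℂ) (j : ℕ) (l : Fin (K ^ (j + 3))) : ℝ≥0∞ :=
  ∑ x : Fin N × Fin N, ‖c ⟨j, (l, x)⟩‖ₑ

theorem coarseNorm_coarsen_le (hp0 : 0 < p) (hq : 0 < q) (c : PieceIndex K N → ℂ) :
    coarseNorm p q (coarsen c) ≤ (N * N : ℕ) * seqNorm p q c := by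
  rw [← ENNReal.rpow_le_rpow_iff hq, ENNReal.mul_rpow_of_nonneg _ _ hq.le, coarseNorm_rpow hq,
    seqNorm_rpow hq, ← ENNReal.tsum_mul_left]
  refine ENNReal.tsum_le_tsum fun j => ?_
  rw [← ENNReal.mul_rpow_of_nonneg _ _ hq.le]
  gcongr
  unfold coarsen
  simpa using lpFun_count_sum_le hp0 (ι := Fin (K ^ (j + 3))) (κ := Fin N × Fin N)
    (fun x => ‖c ⟨j, x⟩‖ₑ)

theorem seqNorm_le_coarseNorm (hp0 : 0 < p) (hq : 0 < q) {c : PieceIndex K N → ℂ}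
    {a : ∀ j, Fin (K ^ (j + 3)) → ℝ≥0∞} (h : ∀ i, ‖c i‖ₑ ≤ a i.1 i.2.1) :
    seqNorm p q c ≤ ((N * N : ℕ) : ℝ≥0∞) ^ (p⁻¹).toReal * coarseNorm p q a := by
  rw [← ENNReal.rpow_le_rpow_iff hq, ENNReal.mul_rpow_of_nonneg _ _ hq.le, coarseNorm_rpow hq,
    seqNorm_rpow hq, ← ENNReal.tsum_mul_left]
  refine ENNReal.tsum_le_tsum fun j => ?_
  rw [← ENNReal.mul_rpow_of_nonneg _ _ hq.le]
  gcongr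
  refine (lpFun_mono fun x => h ⟨j, x⟩).trans ?_
  simpa using lpFun_count_comp_fst hp0 (ι := Fin (K ^ (j + 3))) (κ := Fin N × Fin N) (a j)

theorem coarseNorm_const_mul (hp0 : 0 < p) (hq : 0 < q) {C : ℝ≥0∞} (hC : C ≠ ∞)
    (a : ∀ j, Fin (K ^ (j + 3)) → ℝ≥0∞) :
    coarseNorm p q (fun j l => C * a j l) = C * coarseNorm p q a := by
  refine (ENNReal.rpow_left_injective hq.ne') ?_
  simp only
  rw [ENNReal.mul_rpow_of_nonneg _ _ hq.le, coarseNorm_rpow hq, coarseNorm_rpow hq,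
    ← ENNReal.tsum_mul_left]
  refine tsum_congr fun j => ?_
  rw [lpFun_const_mul hp0 C hC, ENNReal.mul_rpow_of_nonneg _ _ hq.le]

theorem coarseSum_const_mul (C : ℝ≥0∞) (a : ∀ j, Fin (K ^ (j + 3)) → ℝ≥0∞) (z : ℂ) :
    coarseSum p q ω K n (fun j l => C * a j l) z = C * coarseSum p q ω K n a z := by
  unfold coarseSum levelSum
  rw [← ENNReal.tsum_mul_left]
  refine tsum_congr fun j => ?_
  rw [Finset.mul_sum, Finset.mul_sum, Finset.mul_sum]
  refine Finset.sum_congr rfl fun l _ => ?_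
  ring

/-- The numerator of an atom of exponent `2n`. -/
def atomCoeff (p : ℝ≥0∞) (q : ℝ) (ω : ℝ → ℝ) (n K N : ℕ) (i : PieceIndex K N) : ℝ :=
  (1 - ‖pieceCenter K N i‖ ^ 2) ^ (2 * (n : ℝ) - (p⁻¹).toReal) *
      (omegaHat ω (dyadicRadius K i.1)).toReal ^ (-(1 / q))

/-- The exponent M = 2n is a natural number, so the complex power is an ordinary one and no branch
enters. -/
theorem atom_eq (i : PieceIndex K N) (z : ℂ) : atom p q ω (2 * n : ℝ) K N i z =
    (atomCoeff p q ω n K N i : ℂ) / (1 - (starRingEnd ℂ) (pieceCenter K N i) * z) ^ (2 * n) := by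
  rw [atom, atomCoeff, show (((2 * n : ℝ) : ℝ) : ℂ) = ((2 * n : ℕ) : ℂ) by push_cast; rfl,
    Complex.cpow_natCast]

/-- The size of the atoms at level `j`. -/
def coarseScale (p : ℝ≥0∞) (q : ℝ) (ω : ℝ → ℝ) (K n j : ℕ) : ℝ≥0∞ :=
  ((K : ℝ≥0∞) ^ j)⁻¹ ^ (2 * (n : ℝ) - (p⁻¹).toReal) * weightAt ω K j ^ (-(1 / q))

theorem one_le_of_fin (i : PieceIndex K N) : 1 ≤ N := by
  have := i.2.2.1.2
  omega

theorem level_succ_le_one_sub_norm (hK : 2 ≤ K) (i : PieceIndex K N) :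
    level K (i.1 + 1) ≤ 1 - ‖pieceCenter K N i‖ ∧ 1 - ‖pieceCenter K N i‖ ≤ level K i.1 := by
  have h := (inPiece_pieceCenter hK i).norm_le hK (one_le_of_fin i) i.2.2.1.2
  rw [dyadicRadius_eq, dyadicRadius_eq] at h
  constructor <;> linarith [h.1, h.2]

theorem norm_pieceCenter_lt_one (hK : 2 ≤ K) (i : PieceIndex K N) : ‖pieceCenter K N i‖ < 1 := by
  linarith [(level_succ_le_one_sub_norm hK i).1, level_pos hK (i.1 + 1)]

theorem one_sub_norm_sq_pos (hK : 2 ≤ K) (i : PieceIndex K N) :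
    0 < 1 - ‖pieceCenter K N i‖ ^ 2 := by
  have := norm_pieceCenter_lt_one hK i
  nlinarith [norm_nonneg (pieceCenter K N i)]

namespace AtomicParams

theorem exp_nonneg (H : AtomicParams p q ω K B n) : 0 ≤ 2 * (n : ℝ) - (p⁻¹).toReal := by
  by_contra h
  have h1 := H.le_mul
  have h2 : (2 * (n : ℝ) - 1 - (p⁻¹).toReal) * q ≤ 0 :=
    mul_nonpos_of_nonpos_of_nonneg (by linarith) H.q_pos.le
  have : (0 : ℝ) ≤ B := by positivity
  linarith

theorem weightAt_ne_zero (H : AtomicParams p q ω K B n) (j : ℕ) : weightAt ω K j ≠ 0 :=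
  _root_.weightAt_ne_zero H.weightAt_le H.ne_zero j

theorem weightAt_ne_top (H : AtomicParams p q ω K B n) (j : ℕ) : weightAt ω K j ≠ ∞ :=
  _root_.weightAt_ne_top H.two_le H.ne_top j

theorem ofReal_weight_rpow (H : AtomicParams p q ω K B n) (j : ℕ) (s : ℝ) :
    ENNReal.ofReal ((omegaHat ω (dyadicRadius K j)).toReal ^ s) = weightAt ω K j ^ s := by
  have h0 := H.weightAt_ne_zero j
  have ht := H.weightAt_ne_top j
  rw [weightAt] at *
  rw [← ENNReal.ofReal_rpow_of_pos (ENNReal.toReal_pos h0 ht), ENNReal.ofReal_toReal ht]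

theorem atomCoeff_pos (H : AtomicParams p q ω K B n) (i : PieceIndex K N) :
    0 < atomCoeff p q ω n K N i :=
  mul_pos (Real.rpow_pos_of_pos (one_sub_norm_sq_pos H.two_le i) _)
    (Real.rpow_pos_of_pos (ENNReal.toReal_pos (H.weightAt_ne_zero i.1) (H.weightAt_ne_top i.1)) _)

theorem ofReal_atomCoeff (H : AtomicParams p q ω K B n) (i : PieceIndex K N) :
    ENNReal.ofReal (atomCoeff p q ω n K N i) =
      ENNReal.ofReal (1 - ‖pieceCenter K N i‖ ^ 2) ^ (2 * (n : ℝ) - (p⁻¹).toReal) *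
        weightAt ω K i.1 ^ (-(1 / q)) := by
  have h := one_sub_norm_sq_pos H.two_le i
  rw [atomCoeff, ENNReal.ofReal_mul (Real.rpow_nonneg h.le _), ENNReal.ofReal_rpow_of_pos h,
    H.ofReal_weight_rpow]

theorem ofReal_atomCoeff_le (H : AtomicParams p q ω K B n) (i : PieceIndex K N) :
    ENNReal.ofReal (atomCoeff p q ω n K N i) ≤
      2 ^ (2 * (n : ℝ) - (p⁻¹).toReal) * coarseScale p q ω K n i.1 := by
  rw [H.ofReal_atomCoeff, coarseScale, ← mul_assoc, ← ENNReal.mul_rpow_of_nonneg _ _ H.exp_nonneg]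
  gcongr
  · exact H.exp_nonneg
  · rw [← ofReal_level H.two_le, ← ENNReal.ofReal_ofNat, ← ENNReal.ofReal_mul (by norm_num)]
    refine ENNReal.ofReal_le_ofReal ?_
    have h1 := (level_succ_le_one_sub_norm H.two_le i).2
    have h2 := norm_pieceCenter_lt_one H.two_le i
    nlinarith [norm_nonneg (pieceCenter K N i)]

/-- The quantity 1 - |ζ|² is at least K^{-(j+1)}, so the numerator of an atom is bounded below, up
to a factor depending only on K, n and p, by its value at scale K^{-j}. -/
theorem coarseScale_le (H : AtomicParams p q ω K B n) (i : PieceIndex K N) :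
    coarseScale p q ω K n i.1 ≤ (K : ℝ≥0∞) ^ (2 * (n : ℝ) - (p⁻¹).toReal) *
      ENNReal.ofReal (atomCoeff p q ω n K N i) := by
  rw [H.ofReal_atomCoeff, coarseScale, ← mul_assoc, ← ENNReal.mul_rpow_of_nonneg _ _ H.exp_nonneg]
  gcongr
  · exact H.exp_nonneg
  · rw [← ofReal_level H.two_le, ← ENNReal.ofReal_natCast, ← ENNReal.ofReal_mul (by positivity)]
    refine ENNReal.ofReal_le_ofReal ?_
    rw [← level_succ H.two_le]
    have h1 := (level_succ_le_one_sub_norm H.two_le i).1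
    have h2 := norm_pieceCenter_lt_one H.two_le i
    gcongr
    nlinarith [norm_nonneg (pieceCenter K N i)]

/-- The constant comparing an atom with the kernel at the corner of its rectangle. -/
def _root_.atomConst (p : ℝ≥0∞) (K n : ℕ) : ℝ≥0∞ :=
  2 ^ (2 * (n : ℝ) - (p⁻¹).toReal) * ENNReal.ofReal (1 + 2 * K) ^ (2 * n)

theorem atomConst_ne_top (H : AtomicParams p q ω K B n) : atomConst p K n ≠ ∞ :=
  ENNReal.mul_ne_top (ENNReal.rpow_ne_top_of_nonneg H.exp_nonneg (by simp))
    (ENNReal.pow_ne_top (by simp))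

theorem _root_.enorm_one_sub_conj_mul_inv {ξ z : ℂ} (h : ‖ξ‖ * ‖z‖ < 1) (m : ℕ) :
    ‖((1 - (starRingEnd ℂ) ξ * z) ^ m)⁻¹‖ₑ = kerAbs ξ z ^ m := by
  have h1 := one_sub_mul_le_norm_one_sub_conj_mul ξ z
  have h2 : 1 - (starRingEnd ℂ) ξ * z ≠ 0 := by
    rw [← norm_pos_iff]; linarith
  rw [enorm_inv (pow_ne_zero _ h2), enorm_pow, kerAbs, ENNReal.inv_pow]

theorem _root_.mul_norm_lt_one {ξ z : ℂ} (hξ : ‖ξ‖ < 1) (hz : ‖z‖ ≤ 1) : ‖ξ‖ * ‖z‖ < 1 :=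
  (mul_le_of_le_one_right (norm_nonneg _) hz).trans_lt hξ

theorem enorm_atom (H : AtomicParams p q ω K B n) (i : PieceIndex K N) {z : ℂ} (hz : ‖z‖ ≤ 1) :
    ‖atom p q ω (2 * n : ℝ) K N i z‖ₑ =
      ENNReal.ofReal (atomCoeff p q ω n K N i) * kerAbs (pieceCenter K N i) z ^ (2 * n) := by
  rw [atom_eq, div_eq_mul_inv, enorm_mul, enorm_one_sub_conj_mul_inv
    (mul_norm_lt_one (norm_pieceCenter_lt_one H.two_le i) hz), ← ofReal_norm, Complex.norm_real,
    Real.norm_of_nonneg (H.atomCoeff_pos i).le]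

theorem _root_.kerAbs_pieceCenter_le (hK : 2 ≤ K) (i : PieceIndex K N) {z : ℂ} (hz : ‖z‖ ≤ 1) :
    kerAbs (pieceCenter K N i) z ≤ ENNReal.ofReal (1 + 2 * K) * kerAbs (corner K i.1 i.2.1) z := by
  refine kerAbs_le_mul (by positivity) ?_
  refine norm_one_sub_conj_mul_le (d := level K (i.1 + 1)) hz (by positivity) ?_ ?_
  · rw [norm_sub_rev, mul_assoc, level_succ hK]
    exact (inPiece_pieceCenter hK i).dist_corner_le hK (one_le_of_fin i) i.2.2.1.2 i.2.2.2.2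
  · refine le_trans ?_ (one_sub_mul_le_norm_one_sub_conj_mul _ z)
    have := mul_le_of_le_one_right (norm_nonneg (pieceCenter K N i)) hz
    linarith [(level_succ_le_one_sub_norm hK i).1]

theorem enorm_atom_le (H : AtomicParams p q ω K B n) (i : PieceIndex K N) {z : ℂ} (hz : ‖z‖ ≤ 1) :
    ‖atom p q ω (2 * n : ℝ) K N i z‖ₑ ≤ atomConst p K n *
      (coarseScale p q ω K n i.1 * kerAbs (corner K i.1 i.2.1) z ^ (2 * n)) := by
  rw [H.enorm_atom i hz]
  calc _ ≤ (2 ^ (2 * (n : ℝ) - (p⁻¹).toReal) * coarseScale p q ω K n i.1) *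
        (ENNReal.ofReal (1 + 2 * K) * kerAbs (corner K i.1 i.2.1) z) ^ (2 * n) :=
        mul_le_mul' (H.ofReal_atomCoeff_le i)
          (pow_le_pow_left' (kerAbs_pieceCenter_le H.two_le i hz) _)
    _ = _ := by rw [atomConst, mul_pow]; ring

theorem tsum_enorm_le (H : AtomicParams p q ω K B n) (c : PieceIndex K N → ℂ) {z : ℂ}
    (hz : ‖z‖ ≤ 1) : ∑' i, ‖c i * atom p q ω (2 * n : ℝ) K N i z‖ₑ ≤
      coarseSum p q ω K n (fun j l => atomConst p K n * coarsen c j l) z := by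
  rw [coarseSum_const_mul, ENNReal.tsum_sigma', coarseSum, ← ENNReal.tsum_mul_left]
  refine ENNReal.tsum_le_tsum fun j => ?_
  rw [tsum_fintype, Fintype.sum_prod_type, levelSum, Finset.mul_sum, Finset.mul_sum]
  refine Finset.sum_le_sum fun l _ => ?_
  calc _ ≤ ∑ x : Fin N × Fin N, ‖c ⟨j, (l, x)⟩‖ₑ * (atomConst p K n *
        (coarseScale p q ω K n j * kerAbs (corner K j l) z ^ (2 * n))) := by
        refine Finset.sum_le_sum fun x _ => ?_
        rw [enorm_mul]
        gcongr
        exact H.enorm_atom_le ⟨j, (l, x)⟩ hz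
    _ = _ := by
        rw [← Finset.sum_mul, coarseScale, coarsen]
        ring

/-- Point evaluations of sums of atoms are bounded on the coefficient space. -/
theorem exists_tsum_enorm_le (H : AtomicParams p q ω K B n) (N : ℕ) {z : ℂ}
    (hz : z ∈ Metric.ball (0 : ℂ) 1) : ∃ C : ℝ≥0∞, C ≠ ∞ ∧ ∀ c : PieceIndex K N → ℂ,
      ∑' i, ‖c i * atom p q ω (2 * n : ℝ) K N i z‖ₑ ≤ C * seqNorm p q c := by
  obtain ⟨C, hC, h⟩ := exists_coarseSum_le H.p_pos H.q_pos H.two_le H.weightAt_le H.ne_zero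
    H.le_mul hz
  refine ⟨C * atomConst p K n * (N * N : ℕ), ENNReal.mul_ne_top
    (ENNReal.mul_ne_top hC H.atomConst_ne_top) (ENNReal.natCast_ne_top _), fun c => ?_⟩
  refine (H.tsum_enorm_le c (by simpa using (Metric.mem_ball.1 hz).le)).trans ((h _).trans ?_)
  rw [coarseNorm_const_mul H.p_pos H.q_pos H.atomConst_ne_top, mul_assoc, mul_assoc]
  gcongr
  exact coarseNorm_coarsen_le H.p_pos H.q_pos c

/-- Sums of atoms are bounded in mixed norm by their coefficients. -/
theorem exists_mixedNorm_le (H : AtomicParams p q ω K B n) (N : ℕ) :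
    ∃ C : ℝ≥0∞, C ≠ ∞ ∧ ∀ (c : PieceIndex K N → ℂ) (f : ℂ → ℂ),
      (∀ z ∈ Metric.ball (0 : ℂ) 1, ‖f z‖ₑ ≤ ∑' i, ‖c i * atom p q ω (2 * n : ℝ) K N i z‖ₑ) →
      mixedNorm p q ω f ≤ C * seqNorm p q c := by
  obtain ⟨C, -, hC, h⟩ := exists_mixedNorm_le_of_le_coarseSum H.p_pos H.q_pos H.two_le H.weightAt_le
    H.ne_zero H.ne_top H.lower H.two_le_exp H.two_le_mul H.le_mul
  refine ⟨C * atomConst p K n * (N * N : ℕ), ENNReal.mul_ne_top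
    (ENNReal.mul_ne_top hC H.atomConst_ne_top) (ENNReal.natCast_ne_top _), fun c f hf => ?_⟩
  refine (h _ f fun z hz => (hf z hz).trans
    (H.tsum_enorm_le c (by simpa using (Metric.mem_ball.1 hz).le))).trans ?_
  rw [coarseNorm_const_mul H.p_pos H.q_pos H.atomConst_ne_top, mul_assoc, mul_assoc]
  gcongr
  exact coarseNorm_coarsen_le H.p_pos H.q_pos c

theorem summable_norm (H : AtomicParams p q ω K B n) {c : PieceIndex K N → ℂ}
    (hc : seqNorm p q c ≠ ∞) {z : ℂ} (hz : z ∈ Metric.ball (0 : ℂ) 1) :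
    Summable fun i => ‖c i * atom p q ω (2 * n : ℝ) K N i z‖ := by
  obtain ⟨C, hC, h⟩ := H.exists_tsum_enorm_le N hz
  have h1 : ∑' i, ‖c i * atom p q ω (2 * n : ℝ) K N i z‖ₑ ≠ ∞ :=
    ((h c).trans_lt (ENNReal.mul_lt_top hC.lt_top hc.lt_top)).ne
  simpa using ENNReal.summable_toReal h1

theorem differentiableOn_atom (H : AtomicParams p q ω K B n) (i : PieceIndex K N) :
    DifferentiableOn ℂ (atom p q ω (2 * n : ℝ) K N i) (Metric.ball 0 1) := by
  have e : atom p q ω (2 * n : ℝ) K N i = fun z => (atomCoeff p q ω n K N i : ℂ) /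
      (1 - (starRingEnd ℂ) (pieceCenter K N i) * z) ^ (2 * n) := funext fun z => atom_eq i z
  rw [e]
  refine DifferentiableOn.div (by fun_prop) (by fun_prop) fun z hz => pow_ne_zero _ ?_
  have h1 := one_sub_mul_le_norm_one_sub_conj_mul (pieceCenter K N i) z
  have h2 := mul_norm_lt_one (norm_pieceCenter_lt_one H.two_le i) (z := z)
    (by simpa using (Metric.mem_ball.1 hz).le)
  rw [← norm_pos_iff]
  linarith

/-- At z = 0 an atom equals its numerator, so absolute convergence at the origin, multiplied by (1 -
R)^{-2n}, is a summable majorant on |z| < R. -/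
theorem differentiableOn_tsum (H : AtomicParams p q ω K B n) {c : PieceIndex K N → ℂ}
    (hc : seqNorm p q c ≠ ∞) :
    DifferentiableOn ℂ (fun z => ∑' i, c i * atom p q ω (2 * n : ℝ) K N i z) (Metric.ball 0 1) := by
  intro z₀ hz₀
  obtain ⟨R, hR, hR1⟩ := exists_between (show ‖z₀‖ < 1 by simpa using hz₀)
  have hs := H.summable_norm hc (Metric.mem_ball_self one_pos)
  have hsub : Metric.ball (0 : ℂ) R ⊆ Metric.ball 0 1 := Metric.ball_subset_ball hR1.le
  have h := Complex.differentiableOn_tsum_of_summable_norm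
    (F := fun i z => c i * atom p q ω (2 * n : ℝ) K N i z)
    (u := fun i => ‖c i * atom p q ω (2 * n : ℝ) K N i 0‖ * (1 - R)⁻¹ ^ (2 * n))
    (hs.mul_right _) (fun i => ((H.differentiableOn_atom i).mono hsub).const_mul (c i))
    Metric.isOpen_ball fun i z hz => ?_
  · exact (h.differentiableAt (Metric.isOpen_ball.mem_nhds (by simpa using hR))).differentiableWithinAt
  · have hz' : ‖z‖ < R := by simpa using hz
    have h1 := one_sub_mul_le_norm_one_sub_conj_mul (pieceCenter K N i) z
    have h2 : ‖pieceCenter K N i‖ * ‖z‖ ≤ ‖z‖ :=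
      mul_le_of_le_one_left (norm_nonneg _) (norm_pieceCenter_lt_one H.two_le i).le
    rw [norm_mul, norm_mul, mul_assoc, atom_eq, atom_eq, mul_zero, sub_zero, one_pow, div_one,
      div_eq_mul_inv, norm_mul, norm_inv, norm_pow, inv_pow]
    gcongr
    · linarith

/-- Every sequence in `ℓ^{p,q}` gives a function of the mixed norm space. -/
theorem exists_synthesis (H : AtomicParams p q ω K B n) (N : ℕ) :
    ∃ C : ℝ≥0∞, C ≠ ∞ ∧ ∀ c : PieceIndex K N → ℂ, seqNorm p q c < ∞ →
      ∃ f : ℂ → ℂ, MemMixedSpace p q ω f ∧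
        (∀ z ∈ Metric.ball (0 : ℂ) 1,
          HasSum (fun i => c i * atom p q ω (2 * n : ℝ) K N i z) (f z)) ∧
        mixedNorm p q ω f ≤ C * seqNorm p q c := by
  obtain ⟨C, hC, h⟩ := H.exists_mixedNorm_le N
  refine ⟨C, hC, fun c hc => ⟨_, ⟨H.differentiableOn_tsum hc.ne, ?_⟩,
    fun z hz => (H.summable_norm hc.ne hz).of_norm.hasSum, ?_⟩⟩
  · exact (h c _ fun z _ => enorm_tsum_le_tsum_enorm).trans_lt
      (ENNReal.mul_lt_top hC.lt_top hc)
  · exact h c _ fun z _ => enorm_tsum_le_tsum_enorm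

end AtomicParams


/-! ### The sampling operator and its residual -/

/-- The coefficients of the discretized reproducing formula. -/
def sampleCoeff (p : ℝ≥0∞) (q : ℝ) (ω : ℝ → ℝ) (n K N : ℕ) (f : ℂ → ℂ) (i : PieceIndex K N) : ℂ :=
  ((pieceWeight K N (2 * n - 2) i.1 i.2.2.1 / atomCoeff p q ω n K N i : ℝ) : ℂ) *
    f (pieceCenter K N i)

/-- The error of the discretized reproducing formula. -/
def sampleResidual (p : ℝ≥0∞) (q : ℝ) (ω : ℝ → ℝ) (n K N : ℕ) (f : ℂ → ℂ) (z : ℂ) : ℂ :=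
  f z - ∑' i, sampleCoeff p q ω n K N f i * atom p q ω (2 * n : ℝ) K N i z

namespace AtomicParams

theorem sampleCoeff_mul_atom (H : AtomicParams p q ω K B n) (f : ℂ → ℂ) (i : PieceIndex K N)
    (z : ℂ) : sampleCoeff p q ω n K N f i * atom p q ω (2 * n : ℝ) K N i z =
      (pieceWeight K N (2 * n - 2) i.1 i.2.2.1 : ℂ) *
        kernelMul (2 * n - 2) f z (pieceCenter K N i) := by
  have h1 : (atomCoeff p q ω n K N i : ℂ) ≠ 0 := by exact_mod_cast (H.atomCoeff_pos i).ne'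
  have h2 : 2 * n - 2 + 2 = 2 * n := by have := H.two_le_exp; omega
  rw [sampleCoeff, atom_eq, kernelMul, h2]
  push_cast
  field_simp

/-- The normalizations of atoms and of local suprema are dual: the weight and 1/p cancel, leaving
the K^{-2nj} that occurs in the discretization error. -/
theorem scale_mul_coeff (H : AtomicParams p q ω K B n) (j : ℕ) : coarseScale p q ω K n j *
      (((K : ℝ≥0∞) ^ j)⁻¹ ^ (p⁻¹).toReal * weightAt ω K j ^ (1 / q)) =
      ((K : ℝ≥0∞) ^ j)⁻¹ ^ (2 * n) := by
  have hW : weightAt ω K j ^ (-(1 / q)) * weightAt ω K j ^ (1 / q) = 1 := by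
    rw [← ENNReal.rpow_add _ _ (H.weightAt_ne_zero j) (H.weightAt_ne_top j), neg_add_cancel,
      ENNReal.rpow_zero]
  have hl : ((K : ℝ≥0∞) ^ j)⁻¹ ^ (2 * (n : ℝ) - (p⁻¹).toReal) * ((K : ℝ≥0∞) ^ j)⁻¹ ^ (p⁻¹).toReal =
      ((K : ℝ≥0∞) ^ j)⁻¹ ^ (2 * n) := by
    rw [← ENNReal.rpow_add_of_nonneg _ _ H.exp_nonneg ENNReal.toReal_nonneg, sub_add_cancel]
    exact_mod_cast ENNReal.rpow_natCast ((K : ℝ≥0∞) ^ j)⁻¹ (2 * n)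
  calc _ = (((K : ℝ≥0∞) ^ j)⁻¹ ^ (2 * (n : ℝ) - (p⁻¹).toReal) * ((K : ℝ≥0∞) ^ j)⁻¹ ^ (p⁻¹).toReal) *
        (weightAt ω K j ^ (-(1 / q)) * weightAt ω K j ^ (1 / q)) := by rw [coarseScale]; ring
    _ = _ := by rw [hW, hl, mul_one]

theorem coarseSum_cellCoeff (H : AtomicParams p q ω K B n) (f : ℂ → ℂ) (z : ℂ) :
    coarseSum p q ω K n (cellCoeff p q ω K f) z = ∑' j, ((K : ℝ≥0∞) ^ j)⁻¹ ^ (2 * n) *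
      ∑ l : Fin (K ^ (j + 3)), cellSup K f j l * kerAbs (corner K j l) z ^ (2 * n) := by
  rw [coarseSum]
  refine tsum_congr fun j => ?_
  rw [← H.scale_mul_coeff, coarseScale, levelSum, Finset.mul_sum, Finset.mul_sum]
  refine Finset.sum_congr rfl fun l _ => ?_
  rw [cellCoeff]
  ring

theorem exists_enorm_sampleCoeff_le (H : AtomicParams p q ω K B n) :
    ∃ C : ℝ≥0∞, C ≠ ∞ ∧ ∀ (N : ℕ) (f : ℂ → ℂ) (i : PieceIndex K N),
      ‖sampleCoeff p q ω n K N f i‖ₑ ≤ C * cellCoeff p q ω K f i.1 i.2.1 := by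
  set d := 2 * n - 2 with hd
  have hd2 : d + 2 = 2 * n := by have := H.two_le_exp; omega
  refine ⟨ENNReal.ofReal ((d + 1) * 2 ^ (d + 1)) * (K : ℝ≥0∞) ^ (2 * (n : ℝ) - (p⁻¹).toReal),
    ENNReal.mul_ne_top (by simp) (ENNReal.rpow_ne_top_of_nonneg H.exp_nonneg (by simp)),
    fun N f i => ?_⟩
  have hN := one_le_of_fin i
  have hin := inPiece_pieceCenter H.two_le i
  have hpos := H.atomCoeff_pos i
  have hpw := pieceWeight_nonneg H.two_le hN d i.1 i.2.2.1.2
  have hf : ‖f (pieceCenter K N i)‖ₑ ≤ cellSup K f i.1 i.2.1 := by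
    refine le_cellSup f (mem_cellRegion_of_dist_lt H.two_le hN i.2.2.1.2 i.2.2.2.2 hin ?_)
    rw [sub_self, norm_zero]
    linarith [level_pos H.two_le (i.1 + 1)]
  -- A piece has weight O(K^{-2nj}), which `scale_mul_coeff` factors into the size of an atom times
  -- the normalization of the suprema.
  have hw : ENNReal.ofReal (pieceWeight K N d i.1 i.2.2.1) ≤
      ENNReal.ofReal ((d + 1) * 2 ^ (d + 1)) * (K : ℝ≥0∞) ^ (2 * (n : ℝ) - (p⁻¹).toReal) *
      (((K : ℝ≥0∞) ^ i.1)⁻¹ ^ (p⁻¹).toReal * weightAt ω K i.1 ^ (1 / q)) *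
      ENNReal.ofReal (atomCoeff p q ω n K N i) := by
    have h1 := ENNReal.ofReal_le_ofReal (pieceWeight_le H.two_le hN d i.1 i.2.2.1.2)
    rw [ENNReal.ofReal_mul (by positivity), ENNReal.ofReal_pow (level_pos H.two_le _).le,
      ofReal_level H.two_le, hd2, ← H.scale_mul_coeff] at h1
    refine h1.trans ?_
    calc _ ≤ ENNReal.ofReal ((d + 1) * 2 ^ (d + 1)) *
          (((K : ℝ≥0∞) ^ (2 * (n : ℝ) - (p⁻¹).toReal) * ENNReal.ofReal (atomCoeff p q ω n K N i)) *
          (((K : ℝ≥0∞) ^ i.1)⁻¹ ^ (p⁻¹).toReal * weightAt ω K i.1 ^ (1 / q))) := by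
          gcongr
          exact H.coarseScale_le i
      _ = _ := by ring
  rw [sampleCoeff, enorm_mul, ← ofReal_norm, Complex.norm_real, Real.norm_of_nonneg
    (div_nonneg hpw hpos.le), ENNReal.ofReal_div_of_pos hpos, cellCoeff, ← mul_assoc]
  exact mul_le_mul' (ENNReal.div_le_of_le_mul hw) hf

/-- The discretized coefficients are bounded by the mixed norm. -/
theorem exists_seqNorm_sampleCoeff_le (H : AtomicParams p q ω K B n) (N : ℕ) :
    ∃ C : ℝ≥0∞, C ≠ ∞ ∧ ∀ f : ℂ → ℂ, DifferentiableOn ℂ f (Metric.ball 0 1) →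
      seqNorm p q (sampleCoeff p q ω n K N f) ≤ C * mixedNorm p q ω f := by
  obtain ⟨C₁, hC₁, h₁⟩ := H.exists_enorm_sampleCoeff_le
  obtain ⟨C₂, hC₂, h₂⟩ := exists_coarseNorm_cellCoeff_le H.p_pos H.q_pos H.two_le H.weightAt_le
    H.ne_zero H.ne_top H.lower
  refine ⟨((N * N : ℕ) : ℝ≥0∞) ^ (p⁻¹).toReal * (C₁ * C₂), ENNReal.mul_ne_top
    (ENNReal.rpow_ne_top_of_nonneg ENNReal.toReal_nonneg (ENNReal.natCast_ne_top _))
    (ENNReal.mul_ne_top hC₁ hC₂), fun f hf => ?_⟩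
  refine (seqNorm_le_coarseNorm H.p_pos H.q_pos
    (a := fun j l => C₁ * cellCoeff p q ω K f j l) fun i => h₁ N f i).trans ?_
  rw [coarseNorm_const_mul H.p_pos H.q_pos hC₁, mul_assoc, mul_assoc]
  gcongr
  exact h₂ f hf

theorem seqNorm_sampleCoeff_lt_top (H : AtomicParams p q ω K B n) {f : ℂ → ℂ}
    (hf : MemMixedSpace p q ω f) : seqNorm p q (sampleCoeff p q ω n K N f) < ∞ := by
  obtain ⟨C, hC, h⟩ := H.exists_seqNorm_sampleCoeff_le N
  exact (h f hf.1).trans_lt (ENNReal.mul_lt_top hC.lt_top hf.2)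

/-- The constant is chosen before N, and the majorant is indexed by the rectangles Q_{j,l} rather
than by their N² pieces. Passing through the coefficients of the pieces would cost powers of N and
spoil the gain N^{-1/2}. -/
theorem exists_enorm_residual_le (H : AtomicParams p q ω K B n) :
    ∃ C : ℝ, 0 ≤ C ∧ ∀ N : ℕ, 36 * K ^ 2 < N → ∀ f : ℂ → ℂ, MemMixedSpace p q ω f →
      ∀ z ∈ Metric.ball (0 : ℂ) 1, ‖sampleResidual p q ω n K N f z‖ₑ ≤
        coarseSum p q ω K n
          (fun j l => ENNReal.ofReal (C / Real.sqrt N) * cellCoeff p q ω K f j l) z := by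
  set d := 2 * n - 2 with hd
  have hd2 : d + 2 = 2 * n := by have := H.two_le_exp; omega
  refine ⟨24 * K * (1 + 6 * K) ^ (d + 2) * ((d + 1) * 2 ^ (d + 1)), by positivity,
    fun N hN f hf z hz => ?_⟩
  have hs := (H.summable_norm (H.seqNorm_sampleCoeff_lt_top hf (N := N)).ne hz).of_norm
  simp_rw [H.sampleCoeff_mul_atom] at hs
  have h := enorm_sub_tsum_le H.two_le hN d hf.1 (by simpa using hz) hs
  rw [coarseSum_const_mul, H.coarseSum_cellCoeff, sampleResidual]
  simp_rw [H.sampleCoeff_mul_atom]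
  rw [hd2] at h ⊢
  exact h

/-- Convergence of the iteration in mixed norm has to be turned into pointwise convergence; a bound
for point evaluations of the residual does this. -/
theorem exists_enorm_residual_apply_le (H : AtomicParams p q ω K B n) (hN : 36 * K ^ 2 < N) {z : ℂ}
    (hz : z ∈ Metric.ball (0 : ℂ) 1) :
    ∃ C : ℝ≥0∞, C ≠ ∞ ∧ ∀ f : ℂ → ℂ, MemMixedSpace p q ω f →
      ‖sampleResidual p q ω n K N f z‖ₑ ≤ C * mixedNorm p q ω f := by
  obtain ⟨C₁, -, h₁⟩ := H.exists_enorm_residual_le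
  obtain ⟨C₂, hC₂, h₂⟩ := exists_coarseNorm_cellCoeff_le H.p_pos H.q_pos H.two_le H.weightAt_le
    H.ne_zero H.ne_top H.lower
  obtain ⟨C₃, hC₃, h₃⟩ := exists_coarseSum_le H.p_pos H.q_pos H.two_le H.weightAt_le H.ne_zero
    H.le_mul hz
  refine ⟨ENNReal.ofReal (C₁ / Real.sqrt N) * (C₃ * C₂), ENNReal.mul_ne_top (by simp)
    (ENNReal.mul_ne_top hC₃ hC₂), fun f hf => ?_⟩
  refine (h₁ N hN f hf z hz).trans ?_
  rw [coarseSum_const_mul, mul_assoc, mul_assoc]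
  gcongr
  refine (h₃ _).trans ?_
  gcongr
  exact h₂ f hf.1

/-- For fine subdivisions the discretized reproducing formula is close to the identity. -/
theorem exists_mixedNorm_residual_le (H : AtomicParams p q ω K B n) {ε : ℝ≥0∞} (hε : 0 < ε) :
    ∃ N₀ : ℕ, 1 ≤ N₀ ∧ ∀ N, N₀ ≤ N → 36 * K ^ 2 < N ∧ ∀ f : ℂ → ℂ, MemMixedSpace p q ω f →
      mixedNorm p q ω (sampleResidual p q ω n K N f) ≤ ε * mixedNorm p q ω f := by
  obtain ⟨C₁, hC₁, h₁⟩ := H.exists_enorm_residual_le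
  obtain ⟨C₂, hC₂, h₂⟩ := exists_coarseNorm_cellCoeff_le H.p_pos H.q_pos H.two_le H.weightAt_le
    H.ne_zero H.ne_top H.lower
  obtain ⟨C₃, -, hC₃, h₃⟩ := exists_mixedNorm_le_of_le_coarseSum H.p_pos H.q_pos H.two_le
    H.weightAt_le H.ne_zero H.ne_top H.lower H.two_le_exp H.two_le_mul H.le_mul
  have hlim : Filter.Tendsto (fun N : ℕ => C₃ * C₂ * ENNReal.ofReal (C₁ / Real.sqrt N))
      Filter.atTop (nhds 0) := by
    have h4 : Filter.Tendsto (fun N : ℕ => C₁ / Real.sqrt N) Filter.atTop (nhds 0) :=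
      Filter.Tendsto.div_atTop tendsto_const_nhds
        (Real.tendsto_sqrt_atTop.comp tendsto_natCast_atTop_atTop)
    have h5 := ENNReal.Tendsto.const_mul (ENNReal.tendsto_ofReal h4) (a := C₃ * C₂)
      (Or.inr (ENNReal.mul_ne_top hC₃ hC₂))
    simpa using h5
  obtain ⟨N₁, hN₁⟩ := Filter.eventually_atTop.1 (hlim.eventually_lt_const hε)
  refine ⟨max N₁ (36 * K ^ 2 + 1), by omega, fun N hN => ⟨by omega, fun f hf => ?_⟩⟩
  refine (h₃ _ _ (h₁ N (by omega) f hf)).trans ?_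
  rw [coarseNorm_const_mul H.p_pos H.q_pos (by simp)]
  calc _ ≤ C₃ * (ENNReal.ofReal (C₁ / Real.sqrt N) * (C₂ * mixedNorm p q ω f)) := by
        gcongr
        exact h₂ f hf.1
    _ = C₃ * C₂ * ENNReal.ofReal (C₁ / Real.sqrt N) * mixedNorm p q ω f := by ring
    _ ≤ _ := by
        gcongr
        exact (hN₁ N (by omega)).le

theorem differentiableOn_residual (H : AtomicParams p q ω K B n) {f : ℂ → ℂ}
    (hf : MemMixedSpace p q ω f) :
    DifferentiableOn ℂ (sampleResidual p q ω n K N f) (Metric.ball 0 1) :=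
  hf.1.sub (H.differentiableOn_tsum (H.seqNorm_sampleCoeff_lt_top hf).ne)

end AtomicParams

/-! ### Iteration of the sampling operator -/

/-- The coefficients of `f` obtained by iterating the discretized reproducing formula. -/
def analysisCoeff (p : ℝ≥0∞) (q : ℝ) (ω : ℝ → ℝ) (n K N : ℕ) (f : ℂ → ℂ) (i : PieceIndex K N) : ℂ :=
  ∑' m : ℕ, sampleCoeff p q ω n K N ((sampleResidual p q ω n K N)^[m] f) i

/-- The quasi-triangle inequality with weights 2^{-m}. The loss 2^{Em}, where E = q(1 + 1/p), is
recovered later from the geometric smallness of the iterates. -/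
theorem seqNorm_tsum_rpow_le (hp0 : 0 < p) (hq : 0 < q) (c : ℕ → PieceIndex K N → ℂ) :
    seqNorm p q (fun i => ∑' m, c m i) ^ q ≤ 2 ^ (q * (1 + (p⁻¹).toReal)) *
      ∑' m : ℕ, (2 ^ (q * (1 + (p⁻¹).toReal))) ^ m * seqNorm p q (c m) ^ q := by
  simp_rw [seqNorm_rpow hq, ← ENNReal.tsum_mul_left]
  rw [ENNReal.tsum_comm]
  refine ENNReal.tsum_le_tsum fun j => ?_
  have h := lpFun_tsum_rpow_le hp0 hq (μ := Measure.count)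
    (fun (m : ℕ) (x : LevelIndex K N j) => ‖c m ⟨j, x⟩‖ₑ) (fun _ => Measurable.of_discrete)
    (fun m => 2⁻¹ ^ m) (fun m => pow_ne_zero _ (by simp)) (fun m => ENNReal.pow_ne_top (by simp))
  rw [ENNReal.tsum_geometric, ENNReal.one_sub_inv_two, inv_inv] at h
  refine (ENNReal.rpow_le_rpow (lpFun_mono fun x => enorm_tsum_le_tsum_enorm) hq.le).trans
    (h.trans (le_of_eq ?_))
  rw [← ENNReal.tsum_mul_left]
  refine tsum_congr fun m => ?_
  rw [ENNReal.inv_pow, inv_inv, ← ENNReal.rpow_natCast, ← ENNReal.rpow_natCast, ← ENNReal.rpow_mul,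
    ← ENNReal.rpow_mul, mul_comm (m : ℝ)]

namespace AtomicParams

theorem mixedNorm_iterate_le (H : AtomicParams p q ω K B n) {ε : ℝ≥0∞} (hε : ε < 1)
    (hr : ∀ f : ℂ → ℂ, MemMixedSpace p q ω f →
      mixedNorm p q ω (sampleResidual p q ω n K N f) ≤ ε * mixedNorm p q ω f) {f : ℂ → ℂ}
    (hf : MemMixedSpace p q ω f) (m : ℕ) : MemMixedSpace p q ω ((sampleResidual p q ω n K N)^[m] f) ∧
      mixedNorm p q ω ((sampleResidual p q ω n K N)^[m] f) ≤ ε ^ m * mixedNorm p q ω f := by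
  induction m with
  | zero => simpa using hf
  | succ m ih =>
    rw [Function.iterate_succ_apply']
    have h1 := hr _ ih.1
    refine ⟨⟨H.differentiableOn_residual ih.1, h1.trans_lt
      (ENNReal.mul_lt_top (hε.trans ENNReal.one_lt_top) ih.1.2)⟩, h1.trans ?_⟩
    rw [pow_succ', mul_assoc]
    gcongr
    exact ih.2

theorem seqNorm_analysisCoeff_le (H : AtomicParams p q ω K B n) {ε : ℝ≥0∞} (hε : ε < 1)
    (hε2 : 2 ^ (q * (1 + (p⁻¹).toReal)) * ε ^ q ≤ 2⁻¹)
    (hr : ∀ f : ℂ → ℂ, MemMixedSpace p q ω f →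
      mixedNorm p q ω (sampleResidual p q ω n K N f) ≤ ε * mixedNorm p q ω f) {C : ℝ≥0∞}
    (hC : ∀ f : ℂ → ℂ, DifferentiableOn ℂ f (Metric.ball 0 1) →
      seqNorm p q (sampleCoeff p q ω n K N f) ≤ C * mixedNorm p q ω f) {f : ℂ → ℂ}
    (hf : MemMixedSpace p q ω f) :
    seqNorm p q (analysisCoeff p q ω n K N f) ≤
      (2 ^ (q * (1 + (p⁻¹).toReal)) * 2) ^ (1 / q) * C * mixedNorm p q ω f := by
  have hq := H.q_pos
  set E := q * (1 + (p⁻¹).toReal) with hE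
  rw [← ENNReal.rpow_le_rpow_iff hq, ENNReal.mul_rpow_of_nonneg _ _ hq.le,
    ENNReal.mul_rpow_of_nonneg _ _ hq.le, ← ENNReal.rpow_mul, one_div_mul_cancel hq.ne',
    ENNReal.rpow_one]
  refine (seqNorm_tsum_rpow_le H.p_pos hq _).trans ?_
  rw [← hE]
  calc _ ≤ (2 : ℝ≥0∞) ^ E * ∑' m : ℕ, 2⁻¹ ^ m * (C ^ q * mixedNorm p q ω f ^ q) := by
        refine mul_le_mul_right (ENNReal.tsum_le_tsum fun m => ?_) _
        have h1 := H.mixedNorm_iterate_le hε hr hf m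
        calc _ ≤ ((2 : ℝ≥0∞) ^ E) ^ m * (C * (ε ^ m * mixedNorm p q ω f)) ^ q := by
              gcongr
              exact (hC _ h1.1.1).trans (by gcongr; exact h1.2)
          _ = (2 ^ E * ε ^ q) ^ m * (C ^ q * mixedNorm p q ω f ^ q) := by
              rw [ENNReal.mul_rpow_of_nonneg _ _ hq.le, ENNReal.mul_rpow_of_nonneg _ _ hq.le,
                mul_pow, ← ENNReal.rpow_natCast, ← ENNReal.rpow_natCast, ← ENNReal.rpow_natCast,
                ← ENNReal.rpow_mul ε, ← ENNReal.rpow_mul ε, mul_comm (m : ℝ)]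
              ring
          _ ≤ _ := by gcongr
    _ = _ := by
        rw [ENNReal.tsum_mul_right, ENNReal.tsum_geometric, ENNReal.one_sub_inv_two, inv_inv]
        ring

/-- The sampled sum of the m-th residual g_m equals g_m - g_{m+1}, so summing over m telescopes to
f(z). The double family in m and the pieces is absolutely summable, and the order of summation can
be exchanged. -/
theorem hasSum_analysisCoeff (H : AtomicParams p q ω K B n) (hN : 36 * K ^ 2 < N) {ε : ℝ≥0∞}
    (hε : ε < 1) (hr : ∀ f : ℂ → ℂ, MemMixedSpace p q ω f →
      mixedNorm p q ω (sampleResidual p q ω n K N f) ≤ ε * mixedNorm p q ω f) {f : ℂ → ℂ}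
    (hf : MemMixedSpace p q ω f) {z : ℂ} (hz : z ∈ Metric.ball (0 : ℂ) 1) :
    HasSum (fun i => analysisCoeff p q ω n K N f i * atom p q ω (2 * n : ℝ) K N i z) (f z) := by
  set g : ℕ → ℂ → ℂ := fun m => (sampleResidual p q ω n K N)^[m] f with hg
  have hgm := H.mixedNorm_iterate_le hε hr hf
  obtain ⟨C₁, hC₁, h₁⟩ := H.exists_seqNorm_sampleCoeff_le N
  obtain ⟨C₂, hC₂, h₂⟩ := H.exists_tsum_enorm_le N hz
  obtain ⟨C₃, hC₃, h₃⟩ := H.exists_enorm_residual_apply_le hN hz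
  set F : ℕ × PieceIndex K N → ℂ := fun x =>
    sampleCoeff p q ω n K N (g x.1) x.2 * atom p q ω (2 * n : ℝ) K N x.2 z with hF
  have hgeom : ∑' m : ℕ, ε ^ m ≠ ∞ := by
    rw [ENNReal.tsum_geometric]
    exact ENNReal.inv_ne_top.2 (tsub_pos_of_lt hε).ne'
  have hsumF : Summable F := by
    have h4 : ∑' x, ‖F x‖ₑ ≠ ∞ := by
      rw [ENNReal.tsum_prod']
      refine ((ENNReal.tsum_le_tsum fun m => ?_ :
        _ ≤ ∑' m : ℕ, C₂ * C₁ * mixedNorm p q ω f * ε ^ m).trans_lt ?_).ne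
      · refine (h₂ _).trans ?_
        calc _ ≤ C₂ * (C₁ * (ε ^ m * mixedNorm p q ω f)) := by
              gcongr
              exact (h₁ _ (hgm m).1.1).trans (by gcongr; exact (hgm m).2)
          _ = _ := by ring
      · rw [ENNReal.tsum_mul_left]
        exact ENNReal.mul_lt_top (ENNReal.mul_lt_top (ENNReal.mul_lt_top hC₂.lt_top hC₁.lt_top) hf.2)
          hgeom.lt_top
    refine Summable.of_norm ?_
    simpa using ENNReal.summable_toReal h4
  have hrow : HasSum (fun m => g m z - g (m + 1) z) (∑' x, F x) := by
    have h5 := hsumF.hasSum.prod_fiberwise fun m => (hsumF.prod_factor m).hasSum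
    refine h5.congr_fun ?_
    intro m
    simp only [hg, Function.iterate_succ_apply', sampleResidual, hF]
    ring
  -- The sequence is shifted by one since the pointwise bound concerns residuals, and g_0 = f is not
  -- one.
  have hlim : Filter.Tendsto (fun m => g m z) Filter.atTop (nhds 0) := by
    rw [← Filter.tendsto_add_atTop_iff_nat 1, tendsto_zero_iff_enorm_tendsto_zero]
    have h6 : Filter.Tendsto (fun m : ℕ => C₃ * mixedNorm p q ω f * ε ^ m) Filter.atTop (nhds 0) := by
      have := ENNReal.Tendsto.const_mul (ENNReal.tendsto_pow_atTop_nhds_zero_of_lt_one hε)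
        (a := C₃ * mixedNorm p q ω f) (Or.inr (ENNReal.mul_ne_top hC₃ hf.2.ne))
      simpa using this
    refine tendsto_of_tendsto_of_tendsto_of_le_of_le tendsto_const_nhds h6 (fun _ => zero_le)
      fun m => ?_
    simp only [hg, Function.iterate_succ_apply']
    refine (h₃ _ (hgm m).1).trans ?_
    calc _ ≤ C₃ * (ε ^ m * mixedNorm p q ω f) := by
          gcongr
          exact (hgm m).2
      _ = _ := by ring
  have hval : ∑' x, F x = f z := by
    refine tendsto_nhds_unique hrow.tendsto_sum_nat ?_
    simp_rw [Finset.sum_range_sub']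
    have := (tendsto_const_nhds (x := g 0 z)).sub hlim
    simpa [hg] using this
  rw [← hval]
  have hswap := (Equiv.prodComm (PieceIndex K N) ℕ).hasSum_iff.2 hsumF.hasSum
  refine hswap.prod_fiberwise fun i => ?_
  have h7 := (hswap.summable.prod_factor i).hasSum
  have h8 : ∑' m, (F ∘ Equiv.prodComm (PieceIndex K N) ℕ) (i, m) =
      analysisCoeff p q ω n K N f i * atom p q ω (2 * n : ℝ) K N i z := by
    rw [analysisCoeff, ← tsum_mul_right]
    rfl
  rwa [h8] at h7

/-- Every function of the mixed norm space is a sum of atoms, for fine subdivisions. -/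
theorem exists_atomic_decomposition (H : AtomicParams p q ω K B n) :
    ∃ N₀ : ℕ, 1 ≤ N₀ ∧ ∀ N : ℕ, N₀ ≤ N → ∃ C : ℝ≥0∞, C ≠ ∞ ∧
      ∀ f : ℂ → ℂ, MemMixedSpace p q ω f → ∃ c : PieceIndex K N → ℂ,
        (∀ z ∈ Metric.ball (0 : ℂ) 1,
          HasSum (fun i => c i * atom p q ω (2 * n : ℝ) K N i z) (f z)) ∧
        seqNorm p q c ≤ C * mixedNorm p q ω f := by
  have hq := H.q_pos
  set E := q * (1 + (p⁻¹).toReal) with hE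
  have hE0 : 0 < E := by positivity
  -- Chosen so that 2^E ε^q = 1/2, the ratio of the geometric series bounding the iterated
  -- coefficients.
  set ε : ℝ≥0∞ := 2 ^ (-((E + 1) / q)) with hε
  have hε1 : ε < 1 := ENNReal.rpow_lt_one_of_one_lt_of_neg (by norm_num) (by
    have : 0 < (E + 1) / q := by positivity
    linarith)
  have hε0 : 0 < ε := ENNReal.rpow_pos (by norm_num) (by norm_num)
  have hε2 : 2 ^ E * ε ^ q ≤ 2⁻¹ := by
    rw [hε, ← ENNReal.rpow_mul, ← ENNReal.rpow_add _ _ (by norm_num) (by norm_num),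
      ← ENNReal.rpow_neg_one]
    refine le_of_eq ?_
    congr 1
    field_simp
    ring
  obtain ⟨N₀, hN₀, h⟩ := H.exists_mixedNorm_residual_le hε0
  refine ⟨N₀, hN₀, fun N hN => ?_⟩
  obtain ⟨hN36, hr⟩ := h N hN
  obtain ⟨C, hC, hCs⟩ := H.exists_seqNorm_sampleCoeff_le N
  refine ⟨(2 ^ E * 2) ^ (1 / q) * C, ENNReal.mul_ne_top (ENNReal.rpow_ne_top_of_nonneg
    (by positivity) (ENNReal.mul_ne_top (ENNReal.rpow_ne_top_of_nonneg hE0.le (by simp)) (by simp)))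
    hC, fun f hf => ⟨analysisCoeff p q ω n K N f, fun z hz => ?_, ?_⟩⟩
  · exact H.hasSum_analysisCoeff hN36 hε1 hr hf hz
  · exact H.seqNorm_analysisCoeff_le hε1 hε2 hr hCs hf

end AtomicParams

end

/-! ### Choice of the exponent and conclusion -/

theorem exists_atomic_exponent {p : ℝ≥0∞} (hp : 0 < p) {q : ℝ} (hq : 0 < q) (B : ℕ) :
    ∃ n : ℕ, 2 ≤ n ∧ (p ≠ ∞ → 2 ≤ n * p.toReal) ∧
      (B : ℝ) + 1 ≤ (2 * (n : ℝ) - 1 - (p⁻¹).toReal) * q := by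
  obtain ⟨n₁, h₁⟩ := exists_nat_ge (2 / p.toReal)
  obtain ⟨n₂, h₂⟩ := exists_nat_ge (((B : ℝ) + 1) / q + 1 + (p⁻¹).toReal)
  refine ⟨max 2 (max n₁ n₂), le_max_left _ _, fun hpt => ?_, ?_⟩
  · have hpp := ENNReal.toReal_pos hp.ne' hpt
    rw [div_le_iff₀ hpp] at h₁
    refine h₁.trans ?_
    gcongr
    omega
  · rw [← div_le_iff₀ hq]
    have h3 : (n₂ : ℝ) ≤ ((max 2 (max n₁ n₂) : ℕ) : ℝ) := by exact_mod_cast (by omega)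
    have h4 : (0 : ℝ) ≤ n₂ := by positivity
    linarith

end

theorem theorem2 (p : ℝ≥0∞) (hp : 0 < p) (q : ℝ) (hq : 0 < q)
    (ω : ℝ → ℝ) (hω : IsRadialWeight ω) (hω0 : omegaHat ω 0 ≠ 0) (hD : Doubling ω) :
    ∃ M : ℝ, 0 < M ∧
      ∀ K : ℕ, 2 ≤ K → LowerDoublingWith ω (K : ℝ) →
        ∃ N₀ : ℕ, 1 ≤ N₀ ∧ ∀ N : ℕ, N₀ ≤ N →
          ∃ C : ℝ≥0,
            (∀ f : ℂ → ℂ, MemMixedSpace p q ω f →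
              ∃ c : PieceIndex K N → ℂ,
                seqNorm p q c < ∞ ∧
                (∀ z ∈ Metric.ball (0 : ℂ) 1,
                  HasSum (fun i => c i * atom p q ω M K N i z) (f z)) ∧
                seqNorm p q c ≤ C * mixedNorm p q ω f ∧
                mixedNorm p q ω f ≤ C * seqNorm p q c) ∧
            (∀ c : PieceIndex K N → ℂ, seqNorm p q c < ∞ →
              ∃ f : ℂ → ℂ, MemMixedSpace p q ω f ∧
                (∀ z ∈ Metric.ball (0 : ℂ) 1,
                  HasSum (fun i => c i * atom p q ω M K N i z) (f z)) ∧
                mixedNorm p q ω f ≤ C * seqNorm p q c) := by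
  -- B, and with it n and M = 2n, depends on p, q and ω only; K enters afterwards.
  obtain ⟨B, hB⟩ := hD.1.exists_weightAt_le
  obtain ⟨n, hn, hnp, hτ⟩ := exists_atomic_exponent hp hq B
  have hn0 : (2 : ℝ) ≤ n := by exact_mod_cast hn
  refine ⟨2 * n, by linarith, fun K hK hL => ?_⟩
  have H : AtomicParams p q ω K B n :=
    ⟨hp, hq, hK, hB K hK, hω0, hω.omegaHat_zero_ne_top hD.1, hL, hn, hnp, hτ⟩
  obtain ⟨N₀, hN₀, h⟩ := H.exists_atomic_decomposition
  refine ⟨N₀, hN₀, fun N hN => ?_⟩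
  obtain ⟨C₁, hC₁, h₁⟩ := h N hN
  obtain ⟨C₂, hC₂, h₂⟩ := H.exists_mixedNorm_le N
  obtain ⟨C₃, hC₃, h₃⟩ := H.exists_synthesis N
  have hC : ((C₁ + C₂ + C₃).toNNReal : ℝ≥0∞) = C₁ + C₂ + C₃ :=
    ENNReal.coe_toNNReal (by simp [hC₁, hC₂, hC₃])
  have hle₁ : C₁ ≤ C₁ + C₂ + C₃ := le_self_add.trans le_self_add
  have hle₂ : C₂ ≤ C₁ + C₂ + C₃ := le_add_self.trans le_self_add
  have hle₃ : C₃ ≤ C₁ + C₂ + C₃ := le_add_self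
  refine ⟨(C₁ + C₂ + C₃).toNNReal, fun f hf => ?_, fun c hc => ?_⟩
  · obtain ⟨c, hsum, hc⟩ := h₁ f hf
    refine ⟨c, hc.trans_lt (ENNReal.mul_lt_top hC₁.lt_top hf.2), hsum, ?_, ?_⟩
    · rw [hC]
      exact hc.trans (by gcongr)
    · rw [hC]
      -- The reverse inequality holds for any coefficients representing f, because |f| is bounded by
      -- the sum of the moduli of the terms.
      refine (h₂ c f fun z hz => ?_).trans (by gcongr)
      rw [← (hsum z hz).tsum_eq]
      exact enorm_tsum_le_tsum_enorm
  · obtain ⟨f, hf, hsum, hle⟩ := h₃ c hc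
    exact ⟨f, hf, hsum, by rw [hC]; exact hle.trans (by gcongr)⟩
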